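/- Let $g,m\ge 0$ and $h=2g+m$. Permutations are composed from right to left, $\mathfrak S_{p+1}$ acts on $[p]=\{0,\dots,p\}$, $\omega_p$ is the rotation $k\mapsto k+1 \bmod (p+1)$, $\mathrm{ncyc}$ counts the cycles of a permutation (fixed points included) and $\ell$ is the word length with respect to all transpositions. **The relative complex.** A cell of bidegree $(p,q)$, $0\le p\le 2h$, $0\le q\le h$, is a tuple $\Sigma=(\sigma_q,\dots,\sigma_0)$ in $\mathfrak S_{p+1}$ with $\mathrm{norm}(\Sigma)=\sum_{i=1}^{q}\ell(\sigma_i\sigma_{i-1}^{-1})\le h$ and $\mathrm{ncyc}(\sigma_q)\le m+1$. It is non-degenerate if $\mathrm{norm}(\Sigma)=h$, $\mathrm{ncyc}(\sigma_q)=m+1$, $\sigma_i(p)=0$ for all $i$, $\sigma_0=\omega_p$, $\sigma_{i+1}\ne\sigma_i$ for $0\le i<q$, and there is no $0\le k<p$ with $\sigma_i(k)=k+1$ for all $i$. The relative cellular complex $\mathbb P/\mathbb P'$ of the pair of parallel slit complexes $(\mathrm{Par},\mathrm{Par}')$ (for one boundary curve) is free on the non-degenerate cells, with total boundary $\partial=\partial'+(-1)^q\partial''$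 in bidegree $(p,q)$, where $\partial'=\sum_{i=0}^q(-1)^i\partial'_i$, $\partial''=\sum_{j=0}^p(-1)^j\partial''_j$, $\partial'_i$ omits $\sigma_i$, $\partial''_j$ deletes the letter $j$ from the cycles of all $\sigma_i$ and renumbers, and degenerate cells are set to $0$. The punctures of $\Sigma$ are the $m$ cycles of $\sigma_q$ not containing $0$. The orientation system $\mathcal O$ has as fibre over $\Sigma$ the orientations of the set of punctures (enumerations up to even permutations), identified with $\mathbb Z$ through the enumeration by increasing minima of the cycles; with coefficients in $\mathcal O$ the operator $\partial''_j$ is therefore multiplied by the sign of the permutation comparing the enumerations for $\Sigma$ and $\partial''_j\Sigma$. For $m\le 1$, $\mathcal O$ is the constant system $\mathbb Z$. **The cell $T$.** In bar notation $[\tau_q|\dots|\tau_1]$ stands for $\sigma_k=\tau_k\cdots\tau_1\omega_p$. Let $T=[\tau_h|\dots|\tau_1]$ in bidegree $(2h,h)$ with the $g$ interlocking pairs $\tau_{2k+1}=(4k{+}1\;\,4k{+}3)$, $\tau_{2k+2}=(4k{+}2\;\,4k{+}4)$, $0\le k<g$, followed by the $m$ neighbour transpositions $\tau_{2g+s}=(4g{+}2s{-}1\;\,4g{+}2s)$,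 $1\le s\le m$. For $\alpha\in\mathfrak S_{2h}$ (permutations of $\{1,\dots,2h\}$) and $\pi\in\mathfrak S_h$ put $\pi.\kappa_\alpha(T)=[\alpha\tau_{\pi(h)}\alpha^{-1}|\dots|\alpha\tau_{\pi(1)}\alpha^{-1}]$ and $\kappa_\alpha(T)=\mathrm{id}.\kappa_\alpha(T)$, and let $\Lambda(h,m)$ be the set of all $\alpha\in\mathfrak S_{2h}$ with $\mathrm{ncyc}(\alpha\tau_h\cdots\tau_1\alpha^{-1}\omega_{2h})=m+1$. **Orientations.** Write $\tau_i=(a_i\;b_i)$ with $a_i<b_i$ and, for $\alpha\in\Lambda(h,m)$, $x_i=\alpha(a_i)$, $y_i=\alpha(b_i)$. Let $c_i$ be the closed curve that enters the slit $x_i$ from below and leaves the slit $y_i$ upwards. The curves $c_1,\dots,c_h$ form a basis of the first homology of the surface of $\kappa_\alpha(T)$ without dipole and punctures. Their intersection numbers are $$\langle c_i,c_j\rangle=\tfrac12\bigl(\operatorname{sgn}(x_j-x_i)-\operatorname{sgn}(y_j-x_i)-\operatorname{sgn}(x_j-y_i)+\operatorname{sgn}(y_j-y_i)\bigr),$$ and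 the loop around the puncture given by a cycle $C$ is $\sum_i\bigl([x_i-1\in C]-[y_i-1\in C]\bigr)c_i$, where $[\cdot]$ is $1$ if the condition holds and $0$ otherwise. Call $\alpha$ positively oriented if there is an isomorphism, of determinant $1$ in the bases $(c_i)$, from the free abelian group of $T=\kappa_{\mathrm{id}}(T)$ to that of $\kappa_\alpha(T)$ that preserves the intersection numbers and carries the loops around the punctures to each other, punctures being enumerated by increasing minima. A representative system is a set $R$ of positively oriented elements of $\Lambda(h,m)$ such that for each $\beta\in\Lambda(h,m)$ there is exactly one $\alpha\in R$ with $\{\alpha\tau_i\alpha^{-1}\}_{i}=\{\beta\tau_i\beta^{-1}\}_{i}$ as unordered sets. **Theorem.** Representative systems exist, and for every representative system $R$ the chain $$\mu=\sum_{\pi\in\mathfrak S_h}\ \sum_{\alpha\in R}\operatorname{sign}(\pi)\operatorname{sign}(\alpha)\;\pi.\kappa_\alpha(T)$$ lies in bidegree $(2h,h)$ of $\mathbb P/\mathbb P'$, is a relative cycle with coefficients in $\mathcal O$, and represents the fundamental (orientation) class of the relative manifold $(\mathrm{Par},\mathrm{Par}')$: every non-degenerate cell of dimension $3h$ occurs in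 $\mu$ with coefficient $\pm1$, and $H_{3h}(\mathbb P,\mathbb P';\mathcal O)$ is infinite cyclic, generated by $[\mu]$. For $m\le1$ the same holds with (untwisted) integral coefficients. -/

import Mathlib

namespace ParallelSlit

open Equiv

noncomputable section

/-! ### Permutations of the rows `[p] = {0, …, p}` -/

/-- The number of cycles of a permutation, fixed points included. -/
def ncyc {n : ℕ} (σ : Perm (Fin n)) : ℕ :=
  Nat.card (Quotient (Perm.SameCycle.setoid σ))

/-- The word length with respect to the generating set of all transpositions. -/
def wordLength {n : ℕ} (α : Perm (Fin n)) : ℕ :=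
  sInf {k | ∃ l : List (Perm (Fin n)), (∀ t ∈ l, t.IsSwap) ∧ l.prod = α ∧ l.length = k}

/-- The deletion operator `D_j`: delete the letter `j` from its cycle and renormalize the
remaining letters. The lemma `succAbove_del` is the formula `d_j ∘ D_j(α) = (α(j), j) ∘ α ∘ d_j`,
which is `D_j(α) = s_j ∘ (α(j), j) ∘ α ∘ d_j` because `s_j ∘ d_j = id`. -/
def del {p : ℕ} (j : Fin (p + 2)) (α : Perm (Fin (p + 2))) : Perm (Fin (p + 1)) :=
  removeNone (((finSuccEquiv' j).symm.trans α).trans (finSuccEquiv' j))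

theorem succAbove_del {p : ℕ} (j : Fin (p + 2)) (α : Perm (Fin (p + 2))) (k : Fin (p + 1)) :
    j.succAbove (del j α k) = swap (α j) j (α (j.succAbove k)) := by
  have key : some (del j α k) = finSuccEquiv' j (swap (α j) j (α (j.succAbove k))) := by
    by_cases hk : α (j.succAbove k) = j
    · have h0 : (((finSuccEquiv' j).symm.trans α).trans (finSuccEquiv' j)) (some k) = none := by
        simp [hk]
      have h1 := removeNone_none _ h0
      unfold del
      rw [h1]
      simp [hk]
    · obtain ⟨i, hi⟩ := Fin.exists_succAbove_eq hk
      have h0 : (((finSuccEquiv' j).symm.trans α).trans (finSuccEquiv' j)) (some k) = some i := by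
        simp [← hi]
      have h1 := removeNone_some _ ⟨i, h0⟩
      have hne : α (j.succAbove k) ≠ α j := fun h => Fin.succAbove_ne j k (α.injective h)
      unfold del
      rw [h1, h0, swap_apply_of_ne_of_ne hne hk, ← hi]
      simp
  have := congrArg (finSuccEquiv' j).symm key
  simpa using this

/-! ### Cells -/

/-- A cell of bidegree `(p, q)`: a tuple `Σ = (σ_q, …, σ_0)` of permutations of `[p]`, where
`perm i` is `σ_i`. -/
structure Cell where
  p : ℕ
  q : ℕ
  perm : Fin (q + 1) → Perm (Fin (p + 1))

/-- `ℓ(σ_q σ_{q-1}⁻¹) + ⋯ + ℓ(σ_1 σ_0⁻¹)`. -/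
def Cell.norm (c : Cell) : ℕ :=
  ∑ i : Fin c.q, wordLength (c.perm i.succ * (c.perm i.castSucc)⁻¹)

/-- The leftmost permutation `σ_q`. -/
def Cell.top (c : Cell) : Perm (Fin (c.p + 1)) := c.perm (Fin.last c.q)

/-- The generators of the chain complex `ℙ(h, m)`. -/
def Cell.InPar (h m : ℕ) (c : Cell) : Prop :=
  c.p ≤ 2 * h ∧ c.q ≤ h ∧ c.norm ≤ h ∧ ncyc c.top ≤ m + 1

/-- The degenerate cells, which generate `ℙ'(h, m)`. The permutation `finRotate (p + 1)` is the
rotation `ω_p : k ↦ k + 1`. -/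
def Cell.Degenerate (h m : ℕ) (c : Cell) : Prop :=
  c.norm < h ∨ ncyc c.top < m + 1 ∨
  ¬ ((∀ i, c.perm i (Fin.last c.p) = 0) ∧
     c.perm 0 = finRotate (c.p + 1) ∧
     (∀ i : Fin c.q, c.perm i.succ ≠ c.perm i.castSucc) ∧
     ¬ ∃ k : Fin c.p, ∀ i, c.perm i k.castSucc = k.succ)

def Cell.Nondegenerate (h m : ℕ) (c : Cell) : Prop :=
  c.InPar h m ∧ ¬ c.Degenerate h m

/-! ### The relative cellular complex, with integral or twisted coefficients -/

/-- The class of a cell in the quotient `ℙ/ℙ'`: zero if the cell is degenerate. -/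
def Cell.cls (h m : ℕ) (c : Cell) : Cell →₀ ℤ :=
  open Classical in if c.Nondegenerate h m then Finsupp.single c 1 else 0

/-- A rule for the sign with which the horizontal face operator `∂''_j` acts on the coefficients,
as a function of `j` and of `σ_q`. The vertical face operators `∂'_i` never carry a sign: those with
`0 < i < q` do not change `σ_q`, and those with `i = 0` and `i = q` give degenerate cells. -/
abbrev SignRule : Type := ∀ p : ℕ, Fin (p + 2) → Perm (Fin (p + 2)) → ℤ

/-- Untwisted integral coefficients. -/
def integral : SignRule := fun _ _ _ => 1

/-- The punctures of a cell are the cycles of `σ = σ_q` that do not contain `0` (the cycle of `0`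
runs through the dipole). A puncture is recorded by the minimum of its cycle. -/
def puncture {n : ℕ} (σ : Perm (Fin (n + 1))) : Set (Fin (n + 1)) :=
  {x | ¬ σ.SameCycle 0 x ∧ ∀ y, σ.SameCycle x y → x ≤ y}

/-- After the letter `j` is deleted, the cycle of `y` has a smaller minimum than that of `x`. -/
def Overtakes {n : ℕ} (j : Fin n) (σ : Perm (Fin n)) (x y : Fin n) : Prop :=
  ∃ a, σ.SameCycle y a ∧ a ≠ j ∧ ∀ b, σ.SameCycle x b → b ≠ j → a < b

/-- The orientation system `𝒪`. The fibre of `𝒪` over a cell consists of the orientations of its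
set of punctures, that is, of the enumerations of the punctures up to even permutations, and it is
identified with `ℤ` through the enumeration by increasing minima of the cycles. A horizontal face
operator thus acts by the sign of the permutation between the enumeration of the punctures of the
cell and that of its face. -/
def orientation : SignRule := fun p j σ =>
  open Classical in
  ∏ z : Fin (p + 2) × Fin (p + 2),
    if z.1 ∈ puncture σ ∧ z.2 ∈ puncture σ ∧ z.1 < z.2 ∧ Overtakes j σ z.1 z.2 then -1 else 1

/-- `∂' = ∑ (-1)^i ∂'_i`, where `∂'_i` omits `σ_i`. -/
def verticalBoundary (h m : ℕ) : Cell → (Cell →₀ ℤ)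
  | ⟨_, 0, _⟩ => 0
  | ⟨p, q + 1, σ⟩ =>
      ∑ i : Fin (q + 2), (-1 : ℤ) ^ (i : ℕ) • Cell.cls h m ⟨p, q, fun k => σ (i.succAbove k)⟩

/-- `∂'' = ∑ (-1)^j ∂''_j`, where `∂''_j` applies `D_j` to all `σ_i`. -/
def horizontalBoundary (𝒪 : SignRule) (h m : ℕ) : Cell → (Cell →₀ ℤ)
  | ⟨0, _, _⟩ => 0
  | ⟨p + 1, q, σ⟩ =>
      ∑ j : Fin (p + 2), ((-1 : ℤ) ^ (j : ℕ) * 𝒪 p j (σ (Fin.last q))) •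
        Cell.cls h m ⟨p, q, fun k => del j (σ k)⟩

/-- The total boundary operator `∂ = ∂' + (-1)^q ∂''`. -/
def boundary (𝒪 : SignRule) (h m : ℕ) : (Cell →₀ ℤ) →ₗ[ℤ] (Cell →₀ ℤ) :=
  Finsupp.linearCombination ℤ fun c =>
    verticalBoundary h m c + (-1 : ℤ) ^ c.q • horizontalBoundary 𝒪 h m c

/-- The group `(ℙ/ℙ')_{p,q}`, free on the non-degenerate cells of bidegree `(p, q)`. -/
def bichains (h m p q : ℕ) : Submodule ℤ (Cell →₀ ℤ) :=
  Finsupp.supported ℤ ℤ {c | c.Nondegenerate h m ∧ c.p = p ∧ c.q = q}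

/-- The relative chains of total degree `n`. -/
def chains (h m n : ℕ) : Submodule ℤ (Cell →₀ ℤ) :=
  Finsupp.supported ℤ ℤ {c | c.Nondegenerate h m ∧ c.p + c.q = n}

def cycles (𝒪 : SignRule) (h m n : ℕ) : Submodule ℤ (Cell →₀ ℤ) :=
  chains h m n ⊓ LinearMap.ker (boundary 𝒪 h m)

def boundaries (𝒪 : SignRule) (h m n : ℕ) : Submodule ℤ (Cell →₀ ℤ) :=
  (chains h m (n + 1)).map (boundary 𝒪 h m)

/-- The relative homology `H_n(ℙ, ℙ'; 𝒪)`. -/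
abbrev Homology (𝒪 : SignRule) (h m n : ℕ) : Type :=
  cycles 𝒪 h m n ⧸ (boundaries 𝒪 h m n).comap (cycles 𝒪 h m n).subtype

/-- The chain `z` is a relative cycle of degree `3h` that represents a fundamental class of the
connected relative manifold `(Par, Par')` of dimension `3h` with coefficients in `𝒪`: at every
top-dimensional cell it restricts to a generator of the local homology, and its class freely
generates `H_{3h}(ℙ, ℙ'; 𝒪) ≅ ℤ`. -/
def RepresentsFundamentalClass (𝒪 : SignRule) (h m : ℕ) (z : Cell →₀ ℤ) : Prop :=
  ∃ hz : z ∈ cycles 𝒪 h m (3 * h),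
    (∀ c : Cell, c.Nondegenerate h m → c.p + c.q = 3 * h → IsUnit (z c)) ∧
    Function.Bijective fun k : ℤ => k • (Submodule.Quotient.mk ⟨z, hz⟩ : Homology 𝒪 h m (3 * h))

/-! ### The cell `T` and its conjugates -/

/-- The cell `[τ_q | ⋯ | τ_1]` in bar notation, `σ_k = τ_k ⋯ τ_1 ω_p`; here `τ i` is `τ_{i+1}`. -/
def bar {p q : ℕ} (τ : Fin q → Perm (Fin (p + 1))) : Cell where
  p := p
  q := q
  perm := Fin.induction (motive := fun _ => Perm (Fin (p + 1))) (finRotate (p + 1))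
    fun i σ => τ i * σ

/-- The symmetric group on the letters `1, …, n`, which is `Perm (Fin n)` with `x` standing for the
letter `x + 1`, as the stabilizer of `0` in the symmetric group on `0, …, n`. -/
def fixZero {n : ℕ} (α : Perm (Fin n)) : Perm (Fin (n + 1)) :=
  Perm.decomposeFin.symm (0, α)

theorem fixZero_zero {n : ℕ} (α : Perm (Fin n)) : fixZero α 0 = 0 := by
  simp [fixZero]

theorem fixZero_succ {n : ℕ} (α : Perm (Fin n)) (x : Fin n) : fixZero α x.succ = (α x).succ := by
  simp [fixZero]

/-- The smaller of the letters moved by `τ_{i+1}` (shifted by one, see `fixZero`). -/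
def lo (g m : ℕ) (i : Fin (2 * g + m)) : Fin (2 * (2 * g + m)) :=
  if (i : ℕ) < 2 * g ∧ (i : ℕ) % 2 = 1 then ⟨2 * i - 1, by omega⟩ else ⟨2 * i, by omega⟩

/-- The larger of the letters moved by `τ_{i+1}` (shifted by one, see `fixZero`). -/
def hi (g m : ℕ) (i : Fin (2 * g + m)) : Fin (2 * (2 * g + m)) :=
  if h : (i : ℕ) < 2 * g ∧ (i : ℕ) % 2 = 0 then ⟨2 * i + 2, by omega⟩ else ⟨2 * i + 1, by omega⟩

/-- `τ_{i+1}`: the interlocking pairs `τ_{2k+1} = (4k+3, 4k+1)`, `τ_{2k+2} = (4k+4, 4k+2)` for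
`k < g`, followed by the neighbour transpositions `τ_{2g+s} = (4g+2s, 4g+2s-1)` for `1 ≤ s ≤ m`. -/
def tau (g m : ℕ) (i : Fin (2 * g + m)) : Perm (Fin (2 * (2 * g + m) + 1)) :=
  swap (hi g m i).succ (lo g m i).succ

/-- The horizontally conjugated transposition `α τ_{i+1} α⁻¹`. -/
def conjTau (g m : ℕ) (α : Perm (Fin (2 * (2 * g + m)))) (i : Fin (2 * g + m)) :
    Perm (Fin (2 * (2 * g + m) + 1)) :=
  fixZero α * tau g m i * (fixZero α)⁻¹

/-- `κ_α(T) = [α τ_h α⁻¹ | ⋯ | α τ_1 α⁻¹]`. -/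
def kappa (g m : ℕ) (α : Perm (Fin (2 * (2 * g + m)))) : Cell :=
  bar (conjTau g m α)

/-- The last permutation `σ_h = α τ_h ⋯ τ_1 α⁻¹ ω` of `κ_α(T)`. -/
def kappaTop (g m : ℕ) (α : Perm (Fin (2 * (2 * g + m)))) : Perm (Fin (2 * (2 * g + m) + 1)) :=
  (kappa g m α).top

/-- `π . κ_α(T) = [α τ_{π(h)} α⁻¹ | ⋯ | α τ_{π(1)} α⁻¹]`. -/
def permKappa (g m : ℕ) (π : Perm (Fin (2 * g + m))) (α : Perm (Fin (2 * (2 * g + m)))) : Cell :=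
  bar fun i => conjTau g m α (π i)

/-- The set `Λ(h, m)`, for `h = 2g + m`. -/
def Lam (g m : ℕ) : Set (Perm (Fin (2 * (2 * g + m)))) :=
  {α | ncyc (kappaTop g m α) = m + 1}

/-! ### Orientations

The `i`-th slit pair of `κ_α(T)` has slits at the heights `x_i = α(lo i)` and `y_i = α(hi i)`. The
closed curve `c_i` on the surface that enters the slit `x_i` from below and leaves the slit `y_i`
upwards crosses no other slit, and `c_1, …, c_h` is a basis of the first homology of the surface
without dipole and punctures. -/

/-- Twice the intersection matrix of the curves `c_1, …, c_h`. -/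
def intersection (g m : ℕ) (α : Perm (Fin (2 * (2 * g + m)))) :
    Matrix (Fin (2 * g + m)) (Fin (2 * g + m)) ℤ :=
  let x (i : Fin (2 * g + m)) : ℤ := (α (lo g m i) : ℕ)
  let y (i : Fin (2 * g + m)) : ℤ := (α (hi g m i) : ℕ)
  fun i j => (x j - x i).sign - (y j - x i).sign - (x j - y i).sign + (y j - y i).sign

/-- The coordinates in the basis `c_1, …, c_h` of the loop around the puncture given by the cycle
of `s`: it crosses upwards the slits lying directly above the rows `r` of the cycle. The row `r` and
the slit above it have the same value, as `slit.castSucc = r`. -/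
def punctureLoop (g m : ℕ) (α : Perm (Fin (2 * (2 * g + m))))
    (s : Fin (2 * (2 * g + m) + 1)) : Fin (2 * g + m) → ℤ :=
  open Classical in fun i =>
    (if (kappaTop g m α).SameCycle s (α (lo g m i)).castSucc then 1 else 0) -
    (if (kappaTop g m α).SameCycle s (α (hi g m i)).castSucc then 1 else 0)

/-- `α` is positively oriented: the bases `c_1, …, c_h` for `T` and for `κ_α(T)` correspond to each
other, up to determinant one, under an isomorphism of first homology groups that preserves the
intersection form and the loops around the punctures, enumerated by increasing minima. -/
def Positive (g m : ℕ) (α : Perm (Fin (2 * (2 * g + m)))) : Prop :=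
  ∃ A : Matrix (Fin (2 * g + m)) (Fin (2 * g + m)) ℤ,
    A.det = 1 ∧
    A * intersection g m α * A.transpose = intersection g m 1 ∧
    ∃ e : puncture (kappaTop g m 1) ≃o puncture (kappaTop g m α),
      ∀ s : puncture (kappaTop g m 1),
        Matrix.vecMul (punctureLoop g m 1 s) A = punctureLoop g m α (e s)

/-- `R` consists of positively oriented elements of `Λ(h, m)`, exactly one for each unordered set
`{β τ_1 β⁻¹, …, β τ_h β⁻¹}` with `β ∈ Λ(h, m)`. -/
def IsRepresentativeSystem (g m : ℕ) (R : Finset (Perm (Fin (2 * (2 * g + m))))) : Prop :=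
  (∀ α ∈ R, α ∈ Lam g m ∧ Positive g m α) ∧
  ∀ β ∈ Lam g m, ∃! α, α ∈ R ∧ Set.range (conjTau g m α) = Set.range (conjTau g m β)

/-- `μ = ∑_π ∑_α sign(π) sign(α) π . κ_α(T)`, where `π` runs over `𝔖_h` and `α` over `R`. -/
def mu (g m : ℕ) (R : Finset (Perm (Fin (2 * (2 * g + m))))) : Cell →₀ ℤ :=
  ∑ π : Perm (Fin (2 * g + m)), ∑ α ∈ R,
    ((Perm.sign π : ℤ) * (Perm.sign α : ℤ)) • Finsupp.single (permKappa g m π α) 1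

end

end ParallelSlit

namespace ParallelSlit

open Equiv

noncomputable section

/-! A top-dimensional cell is a word of `h` numbered chords whose `2h` ends fill the slits, taken up
to exchanging the two ends of a chord (`exists_word`, `slits_eq_iff`). The point is that every
non-degenerate face of codimension one is a wall between exactly two such cells. An inner vertical
face multiplies two successive disjoint transpositions and only forgets their order. A horizontal
face is non-degenerate precisely when the deleted slit `x` and the slit `y` directly above it belong
to different chords; the other cell at this wall arises when `y` slides along the chord of `x`
(`Slide.eq_or_eq`). A chain is therefore a cycle if and only if its coefficients satisfy one
equation for each exchange of successive chords and one for each slide (`boundary_eq_zero_iff`).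

These equations are consistent because of an orientation. The coefficient `fundSign` of a word is
the sign of the word relative to `T`, times the determinant of an isomorphism from the homology data
of `T` (intersection form and loops around the punctures), times the sign of the induced permutation
of the punctures. A slide acts on homology by a transvection, of determinant one, and on the
punctures by the sign that `𝒪` records (`Slide.isIso`, `Slide.isoSign_eq`). A reordering of the
chords changes the determinant by its sign, which is the sign required at the vertical faces, and a
flip of chords changes the sign of the word and the determinant by the same factor. The coefficient
is well defined because an automorphism of the data of `T` is block triangular with a symplectic
block, of determinant one, and a permutation matrix (`IsBase.isoSign_eq_one`).

The solution is unique up to a multiple because the cells are connected through walls. As in the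
classification of surfaces, slides bring each word to interlocking pairs followed by pairs of
neighbours (`exists_slideEquiv_normalList`), and the number of cycles decides how many pairs of each
kind there are. Since there are no cells of dimension `3h + 1`, the homology is the group of cycles,
which is infinite cyclic. Finally, positivity of `α` means that `fundSign` is `sign α`, and each
cell is `π . κ_α(T)` for exactly one pair, so that `μ` has the coefficients `fundSign` (`mu_apply`).
-/

/-! ### Words -/

/-- A word of `q` chords: the end `b` of the chord `i` is the slit at height `e (i, b)`. -/
abbrev Word (q N : ℕ) : Type := Fin q × Bool ≃ Fin N

/-- The other end of the chord. -/
def opp {ι : Type*} (l : ι × Bool) : ι × Bool := (l.1, !l.2)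

@[simp] theorem opp_opp {ι : Type*} (l : ι × Bool) : opp (opp l) = l := by simp [opp]

@[simp] theorem opp_fst {ι : Type*} (l : ι × Bool) : (opp l).1 = l.1 := rfl

theorem opp_ne {ι : Type*} (l : ι × Bool) : opp l ≠ l := by
  intro h
  have := congrArg Prod.snd h
  simp [opp] at this

theorem eq_or_eq_opp {ι : Type*} {l l' : ι × Bool} (h : l.1 = l'.1) : l = l' ∨ l = opp l' := by
  obtain ⟨i, b⟩ := l
  obtain ⟨j, c⟩ := l'
  cases b <;> cases c <;> simp_all [opp]

/-- The transposition given by a chord. -/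
def arc {q p : ℕ} (a : Fin q × Bool → Fin (p + 1)) (i : Fin q) : Perm (Fin (p + 1)) :=
  swap (a (i, true)) (a (i, false))

/-- The permutations `σ_0, …, σ_q` of the cell given by the transpositions of the chords. -/
def arcs {q p : ℕ} (a : Fin q × Bool → Fin (p + 1)) : Fin (q + 1) → Perm (Fin (p + 1)) :=
  (bar (arc a)).perm

theorem arc_eq {q p : ℕ} (a : Fin q × Bool → Fin (p + 1)) (l : Fin q × Bool) :
    arc a l.1 = swap (a l) (a (opp l)) := by
  obtain ⟨i, b⟩ := l
  cases b
  · exact swap_comm _ _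
  · rfl

theorem arcs_zero {q p : ℕ} (a : Fin q × Bool → Fin (p + 1)) : arcs a 0 = finRotate (p + 1) := rfl

theorem arcs_succ {q p : ℕ} (a : Fin q × Bool → Fin (p + 1)) (i : Fin q) :
    arcs a i.succ = arc a i * arcs a i.castSucc := rfl

theorem arc_eq_mul_inv {q p : ℕ} (a : Fin q × Bool → Fin (p + 1)) (i : Fin q) :
    arcs a i.succ * (arcs a i.castSucc)⁻¹ = arc a i := by
  rw [arcs_succ, mul_inv_cancel_right]

theorem arcs_eq_iff {q p : ℕ} {a b : Fin q × Bool → Fin (p + 1)} :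
    arcs a = arcs b ↔ ∀ i, arc a i = arc b i := by
  constructor
  · intro h i
    rw [← arc_eq_mul_inv, ← arc_eq_mul_inv, h]
  · intro h
    have : arc a = arc b := funext h
    unfold arcs
    rw [this]

theorem eq_arcs {q p : ℕ} {a : Fin q × Bool → Fin (p + 1)} {σ : Fin (q + 1) → Perm (Fin (p + 1))}
    (h0 : σ 0 = finRotate (p + 1)) (h1 : ∀ i : Fin q, σ i.succ = arc a i * σ i.castSucc) :
    σ = arcs a := by
  funext k
  induction k using Fin.induction with
  | zero => rw [h0, arcs_zero]
  | succ i ih => rw [h1, arcs_succ, ih]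

/-- The letters of the slits of a word. -/
def letters {q N : ℕ} (e : Word q N) (l : Fin q × Bool) : Fin (N + 1) := (e l).succ

def slits {q N : ℕ} (e : Word q N) : Fin (q + 1) → Perm (Fin (N + 1)) := arcs (letters e)

def cellOf {q N : ℕ} (e : Word q N) : Cell := ⟨N, q, slits e⟩

theorem letters_injective {q N : ℕ} (e : Word q N) : Function.Injective (letters e) :=
  (Fin.succ_injective _).comp e.injective

theorem arc_letters_apply {q N : ℕ} (e : Word q N) (i : Fin q) (l : Fin q × Bool) :
    arc (letters e) i (e l).succ = (e (if l.1 = i then opp l else l)).succ := by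
  split_ifs with h
  · subst h
    rw [arc_eq]
    exact swap_apply_left _ _
  · apply swap_apply_of_ne_of_ne <;> intro h' <;> apply h <;>
      rw [letters_injective e h']

/-- The transpositions of a word are disjoint, so each slit is moved only once: `σ_k` has exchanged
the ends of precisely the chords numbered below `k`. -/
theorem slits_castSucc {q N : ℕ} (e : Word q N) (k : Fin (q + 1)) (l : Fin q × Bool) :
    slits e k (e l).castSucc = (e (if (l.1 : ℕ) < k then opp l else l)).succ := by
  induction k using Fin.induction with
  | zero =>
    simp [slits, arcs_zero, finRotate_apply]
  | succ i ih =>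
    rw [slits, arcs_succ, Perm.mul_apply]
    rw [slits] at ih
    rw [ih, arc_letters_apply]
    simp only [Fin.val_castSucc, Fin.val_succ]
    congr 2
    by_cases h : (l.1 : ℕ) < i
    · have h1 : l.1 ≠ i := fun h' => by simp [h'] at h
      simp [h, h1, Nat.lt_succ_of_lt h]
    · by_cases h2 : l.1 = i
      · simp [h2]
      · have : ¬ ((l.1 : ℕ) < i + 1) := by
          have : (l.1 : ℕ) ≠ i := fun h' => h2 (Fin.ext h')
          omega
        simp [h, h2, this]

theorem slits_last {q N : ℕ} (e : Word q N) (k : Fin (q + 1)) :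
    slits e k (Fin.last N) = 0 := by
  induction k using Fin.induction with
  | zero => simp [slits, arcs_zero]
  | succ i ih =>
    rw [slits, arcs_succ, Perm.mul_apply]
    rw [slits] at ih
    rw [ih]
    exact swap_apply_of_ne_of_ne (Fin.succ_ne_zero _).symm (Fin.succ_ne_zero _).symm

/-- The last permutation `σ_q`. -/
def top {q N : ℕ} (e : Word q N) : Perm (Fin (N + 1)) := slits e (Fin.last q)

theorem top_castSucc {q N : ℕ} (e : Word q N) (l : Fin q × Bool) :
    top e (e l).castSucc = (e (opp l)).succ := by
  rw [top, slits_castSucc]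
  simp

theorem top_last {q N : ℕ} (e : Word q N) : top e (Fin.last N) = 0 := slits_last _ _

/-- The top permutation depends only on the involution that pairs the slits, not on the numbering of
the chords or of their ends. -/
theorem top_eq_of_opp {q N : ℕ} {e e' : Word q N}
    (h : ∀ r, e (opp (e.symm r)) = e' (opp (e'.symm r))) : top e = top e' := by
  ext1 r
  induction r using Fin.lastCases with
  | last => rw [top_last, top_last]
  | cast r =>
    have h1 := top_castSucc e (e.symm r)
    have h2 := top_castSucc e' (e'.symm r)
    rw [apply_symm_apply] at h1 h2
    rw [h1, h2, h]

/-! ### Word length -/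

theorem wordLength_le {n : ℕ} {l : List (Perm (Fin n))} (h : ∀ t ∈ l, t.IsSwap) :
    wordLength l.prod ≤ l.length :=
  Nat.sInf_le ⟨l, h, rfl, rfl⟩

theorem exists_wordLength {n : ℕ} (α : Perm (Fin n)) :
    ∃ l : List (Perm (Fin n)), (∀ t ∈ l, t.IsSwap) ∧ l.prod = α ∧ l.length = wordLength α := by
  have : {k | ∃ l : List (Perm (Fin n)), (∀ t ∈ l, t.IsSwap) ∧ l.prod = α ∧ l.length = k}.Nonempty := by
    obtain ⟨l⟩ := Perm.truncSwapFactors α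
    exact ⟨_, l.1, l.2.2, l.2.1, rfl⟩
  exact Nat.sInf_mem this

theorem sign_eq_neg_one_pow_wordLength {n : ℕ} (α : Perm (Fin n)) :
    Perm.sign α = (-1) ^ wordLength α := by
  obtain ⟨l, h1, rfl, h3⟩ := exists_wordLength α
  rw [← h3]
  clear h3
  induction l with
  | nil => simp
  | cons t l ih =>
    have ht := h1 t (by simp)
    rw [List.prod_cons, Perm.sign_mul, ih (fun t ht => h1 t (by simp [ht])), ht.sign_eq]
    simp [pow_succ]

@[simp] theorem wordLength_eq_zero {n : ℕ} {α : Perm (Fin n)} : wordLength α = 0 ↔ α = 1 := by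
  constructor
  · intro h
    obtain ⟨l, _, h2, h3⟩ := exists_wordLength α
    rw [h, List.length_eq_zero_iff] at h3
    rw [← h2, h3, List.prod_nil]
  · rintro rfl
    exact Nat.le_zero.1 (wordLength_le (l := []) (by simp))

@[simp] theorem wordLength_eq_one {n : ℕ} {α : Perm (Fin n)} : wordLength α = 1 ↔ α.IsSwap := by
  constructor
  · intro h
    obtain ⟨l, h1, h2, h3⟩ := exists_wordLength α
    rw [h, List.length_eq_one_iff] at h3
    obtain ⟨t, rfl⟩ := h3
    rw [← h2]
    simpa using h1
  · intro h
    have h1 := wordLength_le (l := [α]) (by simpa using h)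
    simp only [List.prod_singleton, List.length_singleton] at h1
    have h2 : wordLength α ≠ 0 := fun h0 => by
      rw [wordLength_eq_zero] at h0
      rw [h0] at h
      have := h.sign_eq
      simp at this
    omega

/-- The length is at most two and its parity is given by the sign, so only length zero has to be
excluded. -/
theorem wordLength_eq_two {n : ℕ} {s t : Perm (Fin n)} (hs : s.IsSwap) (ht : t.IsSwap)
    (h : s * t ≠ 1) : wordLength (s * t) = 2 := by
  have h1 := wordLength_le (l := [s, t]) (by simp [hs, ht])
  simp only [List.prod_cons, List.prod_nil, mul_one, List.length_cons, List.length_nil] at h1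
  have h2 : wordLength (s * t) ≠ 0 := by simpa using h
  have h3 := sign_eq_neg_one_pow_wordLength (s * t)
  rw [Perm.sign_mul, hs.sign_eq, ht.sign_eq] at h3
  have h4 : wordLength (s * t) ≠ 1 := fun h4 => by
    rw [h4] at h3
    simp at h3
  omega

/-! ### Top-dimensional cells -/

theorem arc_isSwap {q p : ℕ} {a : Fin q × Bool → Fin (p + 1)} {i : Fin q}
    (h : a (i, true) ≠ a (i, false)) : (arc a i).IsSwap := ⟨_, _, h, rfl⟩

theorem letters_isSwap {q N : ℕ} (e : Word q N) (i : Fin q) : (arc (letters e) i).IsSwap :=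
  arc_isSwap fun h => by simpa using letters_injective e h

theorem Word.card_eq {q N : ℕ} (e : Word q N) : N = 2 * q := by
  have := Fintype.card_congr e
  simp at this
  omega

/-- The norm of a tuple of permutations. -/
def tupleNorm {p q : ℕ} (σ : Fin (q + 1) → Perm (Fin (p + 1))) : ℕ :=
  ∑ i : Fin q, wordLength (σ i.succ * (σ i.castSucc)⁻¹)

theorem nondegenerate_mk {p q h m : ℕ} {σ : Fin (q + 1) → Perm (Fin (p + 1))} :
    (⟨p, q, σ⟩ : Cell).Nondegenerate h m ↔ p ≤ 2 * h ∧ q ≤ h ∧ tupleNorm σ = h ∧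
      ncyc (σ (Fin.last q)) = m + 1 ∧ (∀ i, σ i (Fin.last p) = 0) ∧ σ 0 = finRotate (p + 1) ∧
      (∀ i : Fin q, σ i.succ ≠ σ i.castSucc) ∧
      ¬ ∃ k : Fin p, ∀ i, σ i k.castSucc = k.succ := by
  have h1 : (⟨p, q, σ⟩ : Cell).norm = tupleNorm σ := rfl
  have h2 : (⟨p, q, σ⟩ : Cell).top = σ (Fin.last q) := rfl
  simp only [Cell.Nondegenerate, Cell.InPar, Cell.Degenerate, h1, h2, not_or, not_not, not_lt]
  constructor
  · rintro ⟨⟨h3, h4, h5, h6⟩, h7, h8, h9⟩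
    exact ⟨h3, h4, le_antisymm h5 h7, le_antisymm h6 h8, h9⟩
  · rintro ⟨h3, h4, h5, h6, h7⟩
    exact ⟨⟨h3, h4, h5.le, h6.le⟩, h5.ge, h6.ge, h7⟩

theorem tupleNorm_of_forall_isSwap {p q : ℕ} {σ : Fin (q + 1) → Perm (Fin (p + 1))}
    (h : ∀ i : Fin q, (σ i.succ * (σ i.castSucc)⁻¹).IsSwap) : tupleNorm σ = q := by
  have : ∀ i : Fin q, wordLength (σ i.succ * (σ i.castSucc)⁻¹) = 1 :=
    fun i => wordLength_eq_one.2 (h i)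
  simp [tupleNorm, this]

theorem slits_succ_ne {q N : ℕ} (e : Word q N) (i : Fin q) :
    slits e i.succ ≠ slits e i.castSucc := by
  intro h
  have h2 := letters_isSwap e i
  rw [← arc_eq_mul_inv] at h2
  rw [slits] at h
  rw [h, mul_inv_cancel] at h2
  simpa using h2.sign_eq

theorem slits_nondegenerate {q N m : ℕ} {e : Word q N} (h : ncyc (top e) = m + 1) :
    (⟨N, q, slits e⟩ : Cell).Nondegenerate q m := by
  refine nondegenerate_mk.2 ⟨e.card_eq.le, le_rfl, ?_, h, slits_last e, rfl, slits_succ_ne e, ?_⟩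
  · apply tupleNorm_of_forall_isSwap
    intro i
    rw [slits, arc_eq_mul_inv]
    exact letters_isSwap e i
  -- The top permutation sends each row to the partner of the slit above it, so `k ↦ k + 1` would
  -- make a slit its own partner.
  · rintro ⟨k, hk⟩
    have h2 : top e (e (e.symm k)).castSucc = k.succ := by
      rw [apply_symm_apply]
      exact hk (Fin.last q)
    rw [top_castSucc] at h2
    have h3 := Fin.succ_injective _ h2
    rw [← Equiv.eq_symm_apply] at h3
    exact opp_ne _ h3

/-- The norm `q` is spread over `q` nontrivial steps, so each step is a transposition; it fixes `0`
because every `σ_i` sends `p` to `0`. A nonzero letter moved by no step would give a row with `k ↦ k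
+ 1` throughout. Hence the `2q` ends cover the `2q` slits, and by counting they do so bijectively.
-/
theorem exists_word {p q m : ℕ} {σ : Fin (q + 1) → Perm (Fin (p + 1))} (hp : p = 2 * q)
    (h : (⟨p, q, σ⟩ : Cell).Nondegenerate q m) :
    ∃ e : Word q p, σ = slits e ∧ ncyc (top e) = m + 1 := by
  obtain ⟨-, -, h1, h2, h3, h4, h5, h6⟩ := nondegenerate_mk.1 h
  have h7 : ∀ i : Fin q, (σ i.succ * (σ i.castSucc)⁻¹).IsSwap := by
    have hge : ∀ i ∈ Finset.univ, 1 ≤ wordLength (σ (Fin.succ i) * (σ (Fin.castSucc i))⁻¹) := by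
      intro i _
      rw [Nat.one_le_iff_ne_zero, Ne, wordLength_eq_zero, mul_inv_eq_one]
      exact h5 i
    have := (Finset.sum_eq_sum_iff_of_le hge).1 (by rw [tupleNorm] at h1; simp [h1])
    exact fun i => wordLength_eq_one.1 (this i (Finset.mem_univ i)).symm
  choose a b hab hτ using h7
  have h0 : ∀ i : Fin q, swap (a i) (b i) 0 = 0 := by
    intro i
    have h8 : (σ i.castSucc)⁻¹ 0 = Fin.last p := by rw [Perm.inv_eq_iff_eq, h3]
    rw [← hτ, Perm.mul_apply, h8, h3]
  have ha : ∀ i, a i ≠ 0 := fun i hi => by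
    have := h0 i
    rw [← hi, swap_apply_left] at this
    exact hab i this.symm
  have hb : ∀ i, b i ≠ 0 := fun i hi => by
    have := h0 i
    rw [← hi, swap_apply_right] at this
    exact hab i this
  let f : Fin q × Bool → Fin p := fun l =>
    if l.2 then (a l.1).pred (ha l.1) else (b l.1).pred (hb l.1)
  have hσ : σ = arcs fun l => (f l).succ := by
    apply eq_arcs h4
    intro i
    rw [← mul_inv_eq_iff_eq_mul, hτ]
    simp [arc, f]
  have hf : Function.Surjective f := by
    intro r
    by_contra! hr
    apply h6
    refine ⟨r, fun i => ?_⟩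
    rw [hσ]
    induction i using Fin.induction with
    | zero => simp [arcs_zero, finRotate_apply]
    | succ i ih =>
      rw [arcs_succ, Perm.mul_apply, ih]
      exact swap_apply_of_ne_of_ne (fun h' => hr _ (Fin.succ_injective _ h').symm)
        (fun h' => hr _ (Fin.succ_injective _ h').symm)
  have hbij : Function.Bijective f := by
    rw [Fintype.bijective_iff_surjective_and_card]
    refine ⟨hf, ?_⟩
    simp
    omega
  refine ⟨Equiv.ofBijective f hbij, hσ, ?_⟩
  rw [top, ← h2, hσ]
  rfl

/-! ### The deletion operators -/

theorem val_succAbove {n : ℕ} (i : Fin (n + 1)) (r : Fin n) :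
    (i.succAbove r : ℕ) = if (r : ℕ) < i then (r : ℕ) else (r : ℕ) + 1 := by
  rw [Fin.succAbove]
  split_ifs with h1 h2 <;> simp_all [Fin.lt_def]

theorem del_swap_mul {p : ℕ} (j : Fin (p + 2)) (a b : Fin (p + 1)) (σ : Perm (Fin (p + 2))) :
    del j (swap (j.succAbove a) (j.succAbove b) * σ) = swap a b * del j σ := by
  ext1 k
  apply Fin.succAbove_right_injective (p := j)
  rw [Perm.mul_apply, Function.Injective.map_swap Fin.succAbove_right_injective, succAbove_del,
    succAbove_del, Perm.mul_apply, Perm.mul_apply]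
  have hj : j = swap (j.succAbove a) (j.succAbove b) j :=
    (swap_apply_of_ne_of_ne (Fin.succAbove_ne j a).symm (Fin.succAbove_ne j b).symm).symm
  set τ := swap (j.succAbove a) (j.succAbove b)
  conv_lhs => rw [hj, ← hj]
  conv_lhs => enter [1, 2]; rw [hj]
  rw [swap_apply_apply]
  simp

/-- When `j` is deleted, the end at `j` of a transposition passes to the letter `σ j` that follows
`j` in its cycle. This determines where a merged slit goes. -/
theorem del_swap_self_mul {p : ℕ} (j : Fin (p + 2)) (a b : Fin (p + 1)) (hab : a ≠ b)
    {σ : Perm (Fin (p + 2))} (hσ : σ j = j.succAbove a) :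
    del j (swap j (j.succAbove b) * σ) = swap a b * del j σ := by
  ext1 k
  apply Fin.succAbove_right_injective (p := j)
  rw [Perm.mul_apply, Function.Injective.map_swap Fin.succAbove_right_injective, succAbove_del,
    succAbove_del, Perm.mul_apply, Perm.mul_apply, hσ]
  have h1 : j.succAbove a ≠ j.succAbove b := fun h => hab (Fin.succAbove_right_injective h)
  rw [swap_apply_of_ne_of_ne (Fin.succAbove_ne j a) h1]
  have h2 := mul_swap_eq_swap_mul (swap (j.succAbove a) j) j (j.succAbove b)
  rw [swap_apply_right, swap_apply_of_ne_of_ne h1.symm (Fin.succAbove_ne j b)] at h2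
  exact Perm.ext_iff.1 h2 _

/-- The transposition of `j` and `σ j` collapses. In a face this makes two successive permutations
equal, hence the face degenerate. -/
theorem del_swap_apply_mul {p : ℕ} (j : Fin (p + 2)) (σ : Perm (Fin (p + 2))) :
    del j (swap j (σ j) * σ) = del j σ := by
  ext1 k
  apply Fin.succAbove_right_injective (p := j)
  rw [succAbove_del, succAbove_del, Perm.mul_apply, Perm.mul_apply, swap_apply_right, swap_self,
    swap_comm]
  rfl

theorem del_finRotate {p : ℕ} (j : Fin (p + 2)) :
    del j (finRotate (p + 2)) = finRotate (p + 1) := by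
  ext1 k
  apply Fin.succAbove_right_injective (p := j)
  rw [succAbove_del, finRotate_apply, finRotate_apply, finRotate_apply]
  have hj := j.isLt
  have hk := k.isLt
  have h : ∀ {n : ℕ} (i : Fin (n + 1)),
      ((i + 1 : Fin (n + 1)) : ℕ) = if (i : ℕ) = n then (0 : ℕ) else (i : ℕ) + 1 := by
    intro n i
    rw [Fin.val_add_one]
    simp only [Fin.ext_iff, Fin.val_last]
  rw [swap_apply_def]
  simp only [Fin.ext_iff, apply_ite Fin.val, h, val_succAbove]
  split_ifs <;> first | contradiction | omega

/-- An orbit of `del j σ` is an orbit of `σ` in which the visit to `j` is skipped. -/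
theorem sameCycle_del {p : ℕ} {j : Fin (p + 2)} {σ : Perm (Fin (p + 2))} {a b : Fin (p + 1)} :
    (del j σ).SameCycle a b ↔ σ.SameCycle (j.succAbove a) (j.succAbove b) := by
  have hne : ∀ {a : Fin (p + 1)}, σ (j.succAbove a) ≠ j →
      j.succAbove (del j σ a) = σ (j.succAbove a) := by
    intro a h
    rw [succAbove_del, swap_apply_of_ne_of_ne _ h]
    exact fun h' => Fin.succAbove_ne j a (σ.injective h')
  have heq : ∀ {a : Fin (p + 1)}, σ (j.succAbove a) = j → j.succAbove (del j σ a) = σ j := by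
    intro a h
    rw [succAbove_del, h, swap_apply_right]
  constructor
  · intro h
    obtain ⟨n, rfl⟩ := h.exists_nat_pow_eq
    clear h
    induction n with
    | zero => exact Perm.SameCycle.refl _ _
    | succ n ih =>
      refine ih.trans ?_
      rw [pow_succ', Perm.mul_apply]
      set c := ((del j σ) ^ n) a
      by_cases h : σ (j.succAbove c) = j
      · have h2 : σ.SameCycle (j.succAbove c) (σ (σ (j.succAbove c))) :=
          (Perm.SameCycle.refl _ _).apply_right.apply_right
        rwa [h, ← heq h] at h2
      · rw [hne h]
        exact (Perm.SameCycle.refl _ _).apply_right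
  · intro h
    obtain ⟨n, hn⟩ := h.exists_nat_pow_eq
    clear h
    -- One step of `del j σ` stands for two steps of `σ` at a visit to `j`, so the exponent may drop
    -- by two.
    induction n using Nat.strong_induction_on generalizing a with
    | _ n ih =>
      rcases n with _ | n
      · rw [Fin.succAbove_right_injective (by simpa using hn : j.succAbove a = j.succAbove b)]
      · rw [pow_succ, Perm.mul_apply] at hn
        by_cases h : σ (j.succAbove a) = j
        · rw [h] at hn
          rcases n with _ | n
          · exact absurd hn.symm (Fin.succAbove_ne j b)
          · rw [pow_succ, Perm.mul_apply, ← heq h] at hn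
            exact (Perm.sameCycle_apply_left).1 (ih n (by omega) hn)
        · rw [← hne h] at hn
          exact (Perm.sameCycle_apply_left).1 (ih n (by omega) hn)

/-- As `j` is not a fixed point, its cycle survives the deletion. -/
theorem ncyc_del {p : ℕ} {j : Fin (p + 2)} {σ : Perm (Fin (p + 2))} (h : σ j ≠ j) :
    ncyc (del j σ) = ncyc σ := by
  refine Nat.card_congr (Equiv.ofBijective
    (Quotient.map' (s₁ := Perm.SameCycle.setoid (del j σ)) (s₂ := Perm.SameCycle.setoid σ)
      j.succAbove fun a b hab => sameCycle_del.1 hab) ⟨?_, ?_⟩)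
  · rintro ⟨a⟩ ⟨b⟩ hab
    exact Quotient.sound' (s₁ := Perm.SameCycle.setoid (del j σ))
      (sameCycle_del.2 (Quotient.exact' (s₁ := Perm.SameCycle.setoid σ) hab))
  · rintro ⟨r⟩
    by_cases hr : r = j
    · obtain ⟨c, hc⟩ := Fin.exists_succAbove_eq h
      refine ⟨Quotient.mk'' c, Quotient.sound' (s₁ := Perm.SameCycle.setoid σ) ?_⟩
      rw [hc, hr]
      exact (Perm.SameCycle.refl σ j).apply_left
    · obtain ⟨c, hc⟩ := Fin.exists_succAbove_eq hr
      exact ⟨Quotient.mk'' c, Quotient.sound' (s₁ := Perm.SameCycle.setoid σ) (by rw [hc])⟩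

theorem swap_eq_swap {α : Type*} [DecidableEq α] {a b c d : α} (hab : a ≠ b)
    (h : swap a b = swap c d) : a = c ∧ b = d ∨ a = d ∧ b = c := by
  have h1 : swap c d a = b := by rw [← h, swap_apply_left]
  by_cases hc : a = c
  · left
    rw [hc, swap_apply_left] at h1
    exact ⟨hc, h1.symm⟩
  · by_cases hd : a = d
    · right
      rw [hd, swap_apply_right] at h1
      exact ⟨hd, h1.symm⟩
    · exact absurd (swap_apply_of_ne_of_ne hc hd ▸ h1) hab

/-- The transpositions are the quotients of successive permutations, so a cell remembers its word up
to the order of the two ends of each chord. -/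
theorem slits_eq_iff {q N : ℕ} {e e' : Word q N} :
    slits e = slits e' ↔ ∀ l, (e'.symm (e l)).1 = l.1 := by
  rw [slits, slits, arcs_eq_iff]
  constructor
  · intro h l
    have h1 := h l.1
    rw [arc_eq, show l.1 = (l.1, true).1 from rfl, arc_eq] at h1
    rcases swap_eq_swap (fun h => opp_ne l (letters_injective e h).symm) h1 with ⟨h2, -⟩ | ⟨h2, -⟩
    · rw [Fin.succ_injective _ h2, symm_apply_apply]
    · rw [Fin.succ_injective _ h2, symm_apply_apply]
      rfl
  · intro h i
    have h1 : ∀ l, e' (e'.symm (e l)) = e l := fun l => apply_symm_apply _ _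
    have h2 : e'.symm (e (i, true)) = opp (e'.symm (e (i, false))) := by
      refine (eq_or_eq_opp ?_).resolve_left ?_
      · rw [h, h]
      · simp
    have h3 := h (i, true)
    have h4 := arc_eq (letters e') (e'.symm (e (i, true)))
    rw [h3] at h4
    rw [arc, h4, h2, opp_opp, ← h2, letters, letters, letters, letters, h1, h1]

section

/-! ### Horizontal faces -/

variable {q n : ℕ}

/-- The slit `w` lies directly above the slit `z`, and they belong to different chords. -/
structure Above (e : Word q (n + 1)) (z w : Fin q × Bool) : Prop where
  fst_ne : z.1 ≠ w.1
  eq : (e w).castSucc = (e z).succ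

/-- The letters of the horizontal face of a word in which the slit `z` is merged with a slit
above it. -/
structure FaceLetters (e : Word q (n + 1)) (z w : Fin q × Bool)
    (a : Fin q × Bool → Fin (n + 1)) : Prop where
  succAbove : ∀ l ≠ z, (e z).succ.succAbove (a l) = (e l).succ
  merge : a z = a (if w.1 < z.1 then opp w else w)

/-- The horizontal face of a word at the letter of `z`. -/
def face (e : Word q (n + 1)) (z : Fin q × Bool) : Fin (q + 1) → Perm (Fin (n + 1)) :=
  fun k => del (e z).succ (slits e k)

theorem Above.ne {e : Word q (n + 1)} {z w : Fin q × Bool} (h : Above e z w) : z ≠ w :=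
  fun h' => h.fst_ne (by rw [h'])

theorem Above.top_ne {e : Word q (n + 1)} {z w : Fin q × Bool} (h : Above e z w) :
    top e (e z).succ ≠ (e z).succ := by
  rw [← h.eq, top_castSucc, h.eq]
  intro h1
  have h2 := e.injective (Fin.succ_injective _ h1)
  exact h.fst_ne (by rw [← h2, opp_fst])

theorem FaceLetters.injOn {e : Word q (n + 1)} {z w : Fin q × Bool}
    {a : Fin q × Bool → Fin (n + 1)} (h : FaceLetters e z w a) {l l' : Fin q × Bool} (hl : l ≠ z)
    (hl' : l' ≠ z) (h1 : a l = a l') : l = l' := by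
  have h2 := h.succAbove l hl
  rw [h1, h.succAbove l' hl'] at h2
  exact e.injective (Fin.succ_injective _ h2.symm)

theorem FaceLetters.ne_zero {e : Word q (n + 1)} {z w : Fin q × Bool}
    {a : Fin q × Bool → Fin (n + 1)} (h : FaceLetters e z w a) (ha : z.1 ≠ w.1)
    (l : Fin q × Bool) : a l ≠ 0 := by
  have key : ∀ l ≠ z, a l ≠ 0 := by
    intro l hl h0
    have h2 := h.succAbove l hl
    rw [h0, Fin.succAbove_ne_zero_zero (Fin.succ_ne_zero _)] at h2
    exact (Fin.succ_ne_zero _) h2.symm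
  by_cases hl : l = z
  · rw [hl, h.merge]
    apply key
    split_ifs <;> rintro rfl <;> exact ha rfl
  · exact key l hl

theorem FaceLetters.opp_ne {e : Word q (n + 1)} {z w : Fin q × Bool}
    {a : Fin q × Bool → Fin (n + 1)} (h : FaceLetters e z w a) (ha : z.1 ≠ w.1)
    (l : Fin q × Bool) : a l ≠ a (opp l) := by
  have key : a z ≠ a (opp z) := by
    rw [h.merge]
    intro h1
    have h2 := h.injOn (by split_ifs <;> rintro rfl <;> exact ha rfl) (ParallelSlit.opp_ne z) h1
    apply ha
    have h3 := congrArg Prod.fst h2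
    rw [opp_fst] at h3
    rw [← h3]
    split_ifs <;> rfl
  by_cases hl : l = z
  · rw [hl]; exact key
  · by_cases hl' : opp l = z
    · rw [← hl', opp_opp] at key
      exact key.symm
    · exact fun h1 => ParallelSlit.opp_ne l (h.injOn hl hl' h1).symm

theorem exists_faceLetters {e : Word q (n + 1)} {z w : Fin q × Bool} 
    (h : z.1 ≠ w.1) : ∃ a, FaceLetters e z w a := by
  have h1 : ∀ l ≠ z, ∃ b, (e z).succ.succAbove b = (e l).succ := fun l hl =>
    Fin.exists_succAbove_eq fun h1 => hl (e.injective (Fin.succ_injective _ h1))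
  choose! b hb using h1
  refine ⟨fun l => b (if l = z then if w.1 < z.1 then opp w else w else l), ?_, ?_⟩
  · intro l hl
    simp only [hl, if_false]
    exact hb l hl
  · have : (if w.1 < z.1 then opp w else w) ≠ z := by
      split_ifs <;> rintro rfl <;> exact h rfl
    simp [this]

/-- Deleting the letter `j` of `z` replaces the end `z` by `σ j` (`del_swap_self_mul`). As `j` is
also the row below `w`, `slits_castSucc` shows that `σ j` is the letter of `w`, or of its partner if
the chord of `w` acts before that of `z`. -/
theorem face_eq_arcs {e : Word q (n + 1)} {z w : Fin q × Bool} (h : Above e z w)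
    {a : Fin q × Bool → Fin (n + 1)} (ha : FaceLetters e z w a) : face e z = arcs a := by
  apply eq_arcs
  · exact del_finRotate _
  · intro i
    unfold face
    rw [show slits e i.succ = arc (letters e) i * slits e i.castSucc from rfl]
    by_cases hi : i = z.1
    · subst hi
      rw [arc_eq, arc_eq, letters, letters, ← ha.succAbove _ (ParallelSlit.opp_ne z)]
      apply del_swap_self_mul
      · exact ha.opp_ne h.fst_ne z
      · rw [ha.merge, ha.succAbove]
        · rw [← h.eq, slits_castSucc]
          rfl
        · have := h.fst_ne
          split_ifs <;> rintro rfl <;> exact this rfl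
    · have h1 : ∀ b, (i, b) ≠ z := by
        rintro b rfl
        exact hi rfl
      rw [arc, arc, letters, letters, ← ha.succAbove _ (h1 _), ← ha.succAbove _ (h1 _)]
      apply del_swap_mul

theorem face_nondegenerate {m : ℕ} {e : Word q (n + 1)} {z w : Fin q × Bool} (h : Above e z w)
    (hm : ncyc (top e) = m + 1) : (⟨n, q, face e z⟩ : Cell).Nondegenerate q m := by
  obtain ⟨a, ha⟩ := exists_faceLetters (e := e) h.fst_ne
  have hface := face_eq_arcs h ha
  have hN := e.card_eq
  have hswap : ∀ i : Fin q, (arc a i).IsSwap := fun i => arc_isSwap (ha.opp_ne h.fst_ne (i, true))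
  refine nondegenerate_mk.2 ⟨by omega, le_rfl, ?_, ?_, ?_, ?_, ?_, ?_⟩
  · apply tupleNorm_of_forall_isSwap
    intro i
    rw [hface, arc_eq_mul_inv]
    exact hswap i
  · rw [← hm]
    exact ncyc_del h.top_ne
  · intro k
    rw [hface]
    induction k using Fin.induction with
    | zero => simp [arcs_zero]
    | succ i ih =>
      rw [arcs_succ, Perm.mul_apply, ih]
      exact swap_apply_of_ne_of_ne (ha.ne_zero h.fst_ne _).symm (ha.ne_zero h.fst_ne _).symm
  · exact del_finRotate _
  · intro i hi
    have h2 := hswap i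
    rw [← arc_eq_mul_inv, ← hface, hi, mul_inv_cancel] at h2
    simpa using h2.sign_eq
  -- Such a row has equal images under the bottom and the top permutation of the face. In terms of
  -- the slit `l` above the corresponding row of `e`, this equates the image of `l` under the
  -- exchange of `w` and `z` with the image of `opp l` under the exchange of `opp w` and `z`, which
  -- is impossible.
  · rintro ⟨k, hk⟩
    have h1 : face e z (Fin.last q) k.castSucc = face e z 0 k.castSucc := by rw [hk, hk]
    have h2 := congrArg (e z).succ.succAbove h1
    unfold face at h2
    rw [succAbove_del, succAbove_del] at h2
    obtain ⟨r, hr⟩ : ∃ r : Fin (n + 1), r.castSucc = (e z).succ.succAbove k.castSucc := by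
      refine ⟨((e z).succ.succAbove k.castSucc).castPred ?_, Fin.castSucc_castPred _ _⟩
      intro h3
      have h4 : (e z).succ ≤ Fin.last _ := Fin.le_last _
      rw [Fin.succAbove_eq_last_iff] at h3
      · exact (Fin.castSucc_lt_last k).ne h3
      · intro h5
        have h6 := h.eq
        rw [h5] at h6
        exact (Fin.castSucc_lt_last _).ne h6
    have hrw : r ≠ e w := by
      rintro rfl
      rw [h.eq] at hr
      exact Fin.succAbove_ne _ _ hr.symm
    rw [← hr, ← apply_symm_apply e r] at h2
    have hl : e.symm r ≠ w := fun h3 => hrw (by rw [← h3, apply_symm_apply])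
    generalize e.symm r = l at h2 hl
    conv_lhs at h2 => enter [1, 1]; rw [← h.eq]
    conv_rhs at h2 => enter [1, 1]; rw [← h.eq]
    simp only [slits_castSucc, Fin.val_last, Fin.is_lt, if_true, Fin.val_zero, Nat.not_lt_zero,
      if_false] at h2
    have hinj := letters_injective e
    change swap (letters e (opp w)) (letters e z) (letters e (opp l)) =
      swap (letters e w) (letters e z) (letters e l) at h2
    rw [hinj.swap_apply, hinj.swap_apply] at h2
    have h3 := hinj h2
    have hzw := h.fst_ne
    by_cases hlz : l = z
    · subst hlz
      have h4 : opp l ≠ opp w := fun h5 => hzw (by simpa using congrArg Prod.fst h5)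
      rw [swap_apply_right, swap_apply_of_ne_of_ne h4 (ParallelSlit.opp_ne l)] at h3
      exact hzw (by simpa using congrArg Prod.fst h3)
    · rw [swap_apply_of_ne_of_ne hl hlz] at h3
      have h4 : opp l ≠ opp w := fun h5 => hl (by rw [← opp_opp l, h5, opp_opp])
      by_cases h5 : opp l = z
      · rw [h5, swap_apply_right] at h3
        rw [← h3, opp_opp] at h5
        exact hzw (congrArg Prod.fst h5.symm)
      · rw [swap_apply_of_ne_of_ne h4 h5] at h3
        exact ParallelSlit.opp_ne l h3

/-- Deleting `0` or the last letter contradicts `σ_q(p) = 0`. If the slits on both sides of the row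
`j` belong to one chord, the permutations before and after that chord become equal. -/
theorem exists_above_of_nondegenerate {m : ℕ} {e : Word q (n + 1)} {j : Fin (n + 2)}
    (h : (⟨n, q, fun k => del j (slits e k)⟩ : Cell).Nondegenerate q m) :
    ∃ z w, Above e z w ∧ (e z).succ = j := by
  obtain ⟨-, -, -, -, h3, -, h5, -⟩ := nondegenerate_mk.1 h
  have htop : ∀ l : Fin q × Bool, slits e (Fin.last q) (e l).castSucc = (e (opp l)).succ :=
    top_castSucc e
  have hN := e.card_eq
  have hj0 : j ≠ 0 := by
    rintro rfl
    have h6 := congrArg (Fin.succAbove 0) (h3 (Fin.last q))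
    rw [succAbove_del, Fin.zero_succAbove, Fin.zero_succAbove, Fin.succ_last, slits_last,
      swap_apply_right, ← Fin.castSucc_zero, ← apply_symm_apply e 0, htop] at h6
    have h7 := Fin.succ_injective _ h6
    exact opp_ne _ (e.injective h7)
  have hjl : j ≠ Fin.last (n + 1) := by
    rintro rfl
    have h6 := congrArg (Fin.succAbove (Fin.last (n + 1))) (h3 (Fin.last q))
    rw [succAbove_del, slits_last, Fin.succAbove_last,
      ← apply_symm_apply e (Fin.last n), htop, Fin.castSucc_zero, swap_apply_of_ne_of_ne] at h6
    · exact Fin.succ_ne_zero _ h6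
    · exact Fin.succ_ne_zero _
    · rw [← Fin.succ_last, Ne, Fin.succ_inj, ← Equiv.eq_symm_apply]
      exact opp_ne _
  obtain ⟨r, rfl⟩ := Fin.exists_succ_eq.2 hj0
  obtain ⟨r', hr'⟩ := Fin.exists_castSucc_eq.2 hjl
  refine ⟨e.symm r, e.symm r', ⟨?_, by simp [hr']⟩, by simp⟩
  intro h6
  rcases eq_or_eq_opp h6 with h7 | h7
  · rw [e.symm.injective h7] at hr'
    exact Fin.castSucc_lt_succ.ne hr'
  · apply h5 (e.symm r').1
    rw [show slits e (e.symm r').1.succ =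
      arc (letters e) (e.symm r').1 * slits e (e.symm r').1.castSucc from rfl]
    have h8 : slits e (e.symm r').1.castSucc r.succ = r'.succ := by
      rw [← hr']
      conv_lhs => rw [← apply_symm_apply e r']
      rw [slits_castSucc]
      simp
    rw [arc_eq, swap_comm, letters, letters, ← h7, apply_symm_apply, apply_symm_apply, ← h8]
    exact del_swap_apply_mul _ _

end

section

variable {q n : ℕ}

/-! ### Slides -/

/-- The slit `y` directly above `x` slides along the chord of `x` to the place directly below the
other end of the chord. -/
structure Slide (e e' : Word q (n + 1)) (x y : Fin q × Bool) : Prop where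
  src : Above e x y
  tgt : Above e' y (opp x)
  rem : ∃ r : Fin q × Bool → Fin n,
    ∀ l ≠ y, e l = (e y).succAbove (r l) ∧ e' l = (e' y).succAbove (r l)

/-- Move the letter `i` to the place `k`. -/
def moveTo (i k : Fin (n + 1)) : Perm (Fin (n + 1)) := k.cycleRange.symm * i.cycleRange

theorem moveTo_self (i k : Fin (n + 1)) : moveTo i k i = k := by
  simp [moveTo]

theorem moveTo_succAbove (i k : Fin (n + 1)) (r : Fin n) :
    moveTo i k (i.succAbove r) = k.succAbove r := by
  simp [moveTo]

theorem sign_moveTo (i k : Fin (n + 1)) :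
    (Perm.sign (moveTo i k) : ℤ) = (-1) ^ (i + k : ℕ) := by
  rw [moveTo, Perm.sign_mul, Perm.sign_symm, Fin.sign_cycleRange, Fin.sign_cycleRange, pow_add, mul_comm]
  simp

theorem exists_remainder (e : Word q (n + 1)) (x y : Fin q × Bool) (hxy : x ≠ y) :
    ∃ r : Fin q × Bool → Fin n, ∀ l ≠ y, e l = (e y).succAbove (r l) := by
  have h : ∀ l ≠ y, ∃ b, (e y).succAbove b = e l := fun l hl =>
    Fin.exists_succAbove_eq fun h1 => hl (e.injective h1)
  obtain ⟨b, -⟩ := h x hxy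
  have : Nonempty (Fin n) := ⟨b⟩
  choose! r hr using h
  exact ⟨r, fun l hl => (hr l hl).symm⟩

theorem exists_slide {e : Word q (n + 1)} {x y : Fin q × Bool} (h : Above e x y) :
    ∃ e', Slide e e' x y := by
  obtain ⟨r, hr⟩ := exists_remainder e x y h.ne
  refine ⟨e.trans (moveTo (e y) (r (opp x)).castSucc), h, ⟨h.fst_ne.symm, ?_⟩, r, ?_⟩
  · have hx : opp x ≠ y := by rintro rfl; exact h.fst_ne rfl
    rw [trans_apply, trans_apply, hr _ hx, moveTo_succAbove, moveTo_self,
      Fin.succAbove_castSucc_self, Fin.succ_castSucc]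
  · intro l hl
    refine ⟨hr l hl, ?_⟩
    rw [trans_apply, trans_apply, hr l hl, moveTo_self, moveTo_succAbove]

theorem exists_slide_to {e' : Word q (n + 1)} {x y : Fin q × Bool} (h : Above e' y (opp x)) :
    ∃ e, Slide e e' x y := by
  have hx : x ≠ y := by rintro rfl; exact h.fst_ne rfl
  obtain ⟨r, hr⟩ := exists_remainder e' x y hx
  refine ⟨e'.trans (moveTo (e' y) (r x).succ), ⟨h.fst_ne.symm, ?_⟩, h, r, ?_⟩
  · rw [trans_apply, trans_apply, hr _ hx, moveTo_succAbove, moveTo_self,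
      Fin.succAbove_succ_self, Fin.succ_castSucc]
  · intro l hl
    refine ⟨?_, hr l hl⟩
    rw [trans_apply, trans_apply, hr l hl, moveTo_self, moveTo_succAbove]

/-- The sign of a word relative to a base word. -/
def sgn {N : ℕ} (b e : Word q N) : ℤ := Perm.sign (b.symm.trans e)

theorem sgn_mul_self {N : ℕ} (b e : Word q N) : sgn b e * sgn b e = 1 := by
  rw [sgn]
  exact Int.isUnit_mul_self (Units.isUnit _)

theorem Slide.sgn_eq {e e' : Word q (n + 1)} {x y : Fin q × Bool} (h : Slide e e' x y)
    (b : Word q (n + 1)) : sgn b e' = (-1) ^ (e y + e' y : ℕ) * sgn b e := by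
  obtain ⟨r, hr⟩ := h.rem
  have h1 : e' = e.trans (moveTo (e y) (e' y)) := by
    ext1 l
    by_cases hl : l = y
    · rw [hl, trans_apply, moveTo_self]
    · rw [trans_apply, (hr l hl).1, moveTo_succAbove, ← (hr l hl).2]
  rw [← sign_moveTo]
  conv_lhs => rw [h1]
  rw [sgn, sgn, ← Equiv.trans_assoc, ← Units.val_mul, ← Perm.sign_mul]
  rfl

/-- The chord of `x` acts first. Hence deletion merges `x` with `y` itself in `e`, and merges `y`
with the partner of `opp x`, which is `x`, in `e'`. Both faces have `x` and `y` at a common letter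
and agree elsewhere. -/
theorem Slide.face_eq {e e' : Word q (n + 1)} {x y : Fin q × Bool} (h : Slide e e' x y)
    (hlt : x.1 < y.1) : face e x = face e' y := by
  obtain ⟨r, hr⟩ := h.rem
  have hxy := h.src.ne
  have hval : (e y : ℕ) = e x + 1 := by simpa [Fin.ext_iff] using h.src.eq
  have hrx : (r x).succ = e y := by
    have h1 := congrArg Fin.val (hr x hxy).1
    rw [val_succAbove] at h1
    ext
    rw [Fin.val_succ]
    split_ifs at h1 <;> omega
  rw [face_eq_arcs h.src (a := fun l => (r (if l = y then x else l)).succ),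
    face_eq_arcs h.tgt (a := fun l => (r (if l = y then x else l)).succ)]
  · refine ⟨fun l hl => ?_, ?_⟩
    · rw [if_neg hl, Fin.succ_succAbove_succ, (hr l hl).2]
    · simp [hlt, hxy]
  · refine ⟨fun l hl => ?_, ?_⟩
    · by_cases hly : l = y
      · rw [if_pos hly, hrx, ← h.src.eq, Fin.succAbove_castSucc_self, hly]
      · have h2 : (r l : ℕ) ≠ r x := by
          intro h2
          have h3 : e l = e x := by rw [(hr l hly).1, (hr x hxy).1, Fin.ext h2]
          exact hl (e.injective h3)
        have h3 : (r x : ℕ) + 1 = e y := by simpa [Fin.ext_iff] using hrx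
        rw [if_neg hly, ← h.src.eq, (hr l hly).1]
        ext
        simp only [val_succAbove, Fin.val_succ, Fin.val_castSucc]
        split_ifs <;> omega
    · simp [hlt.not_gt, hxy]

/-- The chords of `x` and `y` are the only two that share a letter in the face. Their order tells
which of the two ends was deleted, and the shared letter tells where to put it back. -/
theorem first_face_unique {e₁ e₂ : Word q (n + 1)} {x₁ y₁ x₂ y₂ : Fin q × Bool}
    (h₁ : Above e₁ x₁ y₁) (h₂ : Above e₂ x₂ y₂) (hlt₁ : x₁.1 < y₁.1) (hlt₂ : x₂.1 < y₂.1)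
    (h : face e₁ x₁ = face e₂ x₂) : slits e₁ = slits e₂ ∧ e₁ x₁ = e₂ x₂ := by
  obtain ⟨a₁, ha₁⟩ := exists_faceLetters (e := e₁) h₁.fst_ne
  obtain ⟨a₂, ha₂⟩ := exists_faceLetters (e := e₂) h₂.fst_ne
  rw [face_eq_arcs h₁ ha₁, face_eq_arcs h₂ ha₂, arcs_eq_iff] at h
  have key : ∀ l, ∃ l' : Fin q × Bool, l'.1 = l.1 ∧ a₂ l' = a₁ l := by
    intro l
    have h3 := h l.1
    rw [arc_eq, show l.1 = (l.1, true).1 from rfl, arc_eq] at h3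
    rcases swap_eq_swap (ha₁.opp_ne h₁.fst_ne l) h3 with ⟨h4, -⟩ | ⟨h4, -⟩
    · exact ⟨(l.1, true), rfl, h4.symm⟩
    · exact ⟨opp (l.1, true), rfl, h4.symm⟩
  choose f hf hfa using key
  have hm₁ : a₁ x₁ = a₁ y₁ := by simpa [hlt₁.not_gt] using ha₁.merge
  have hm₂ : a₂ x₂ = a₂ y₂ := by simpa [hlt₂.not_gt] using ha₂.merge
  have hpair : ∀ l l', a₂ l = a₂ l' → l.1 < l'.1 → l = x₂ ∧ l' = y₂ := by
    intro l l' hll hlt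
    by_cases hl : l = x₂
    · refine ⟨hl, ?_⟩
      by_cases hl' : l' = x₂
      · rw [hl, hl'] at hlt
        exact absurd hlt (lt_irrefl _)
      · refine ha₂.injOn hl' h₂.ne.symm ?_
        rw [← hll, hl, hm₂]
    · by_cases hl' : l' = x₂
      · have h5 : l = y₂ := by
          refine ha₂.injOn hl h₂.ne.symm ?_
          rw [hll, hl', hm₂]
        rw [h5, hl'] at hlt
        exact absurd hlt hlt₂.not_gt
      · rw [ha₂.injOn hl hl' hll] at hlt
        exact absurd hlt (lt_irrefl _)
  obtain ⟨hx, hy⟩ := hpair (f x₁) (f y₁) (by rw [hfa, hfa, hm₁]) (by rw [hf, hf]; exact hlt₁)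
  have hval : ∀ {e : Word q (n + 1)} {x y : Fin q × Bool} {a : Fin q × Bool → Fin (n + 1)},
      Above e x y → FaceLetters e x y a → a y = e y := by
    intro e x y a hab ha
    have h6 := ha.succAbove y hab.ne.symm
    rw [← hab.eq, ← Fin.succAbove_castSucc_self] at h6
    exact Fin.succAbove_right_injective h6
  have hy' : e₁ y₁ = e₂ y₂ := by rw [← hval h₁ ha₁, ← hval h₂ ha₂, ← hy, hfa]
  have hx' : e₁ x₁ = e₂ x₂ := by
    have h7 := h₁.eq
    rw [hy', h₂.eq] at h7
    exact (Fin.succ_injective _ h7).symm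
  refine ⟨slits_eq_iff.2 fun l => ?_, hx'⟩
  have h8 : e₂ (f l) = e₁ l := by
    by_cases hl : l = x₁
    · rw [hl, hx, hx']
    · have h9 := ha₁.succAbove l hl
      have h10 : f l ≠ x₂ := by
        intro h10
        have h11 : a₁ l = a₁ y₁ := by rw [← hfa l, ← hfa y₁, h10, hy, hm₂]
        have h12 := ha₁.injOn hl h₁.ne.symm h11
        rw [h12, hy] at h10
        exact h₂.ne h10.symm
      have h13 := ha₂.succAbove (f l) h10
      rw [hfa, ← hx', h9] at h13
      exact (Fin.succ_injective _ h13).symm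
  rw [← h8, symm_apply_apply, hf]

theorem Slide.unique {e e₁ e₂ : Word q (n + 1)} {x y : Fin q × Bool} (h₁ : Slide e e₁ x y)
    (h₂ : Slide e e₂ x y) : e₁ = e₂ := by
  obtain ⟨r, hr⟩ := h₁.rem
  obtain ⟨s, hs⟩ := h₂.rem
  have hrs : ∀ l ≠ y, r l = s l := fun l hl =>
    Fin.succAbove_right_injective ((hr l hl).1.symm.trans (hs l hl).1)
  have hx : opp x ≠ y := by rintro rfl; exact h₁.src.fst_ne rfl
  have hval : ∀ {a : Fin (n + 1)} {b : Fin (n + 1)} {c : Fin n}, b.castSucc = a.succ →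
      b = a.succAbove c → (a : ℕ) = c := by
    intro a b c h3 h4
    have h5 := congrArg Fin.val h3
    have h6 := congrArg Fin.val h4
    rw [val_succAbove] at h6
    simp only [Fin.val_castSucc, Fin.val_succ] at h5
    split_ifs at h6 <;> omega
  have hy : e₁ y = e₂ y := by
    ext
    rw [hval h₁.tgt.eq (hr _ hx).2, hval h₂.tgt.eq (hs _ hx).2, hrs _ hx]
  ext1 l
  by_cases hl : l = y
  · rw [hl, hy]
  · rw [(hr l hl).2, (hs l hl).2, hrs l hl, hy]

theorem Slide.relabel {e e' : Word q (n + 1)} {x y : Fin q × Bool} {f : Perm (Fin q × Bool)}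
    (hf : ∀ l, f (opp l) = opp (f l)) (h : Slide e e' (f x) (f y)) :
    Slide (f.trans e) (f.trans e') x y := by
  have hxy : x.1 ≠ y.1 := by
    intro hxy
    rcases eq_or_eq_opp hxy with rfl | rfl
    · exact h.src.fst_ne rfl
    · apply h.src.fst_ne
      rw [hf, opp_fst]
  obtain ⟨r, hr⟩ := h.rem
  refine ⟨⟨hxy, h.src.eq⟩, ⟨hxy.symm, ?_⟩, fun l => r (f l), fun l hl => hr (f l) (by simpa)⟩
  rw [trans_apply, trans_apply, hf]
  exact h.tgt.eq

/-- A non-degenerate horizontal face is a face of exactly two top-dimensional cells, which are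
related by a slide. -/
theorem Slide.eq_or_eq {m : ℕ} {e e' e₁ : Word q (n + 1)} {x y : Fin q × Bool}
    (h : Slide e e' x y) (hlt : x.1 < y.1) (hm : ncyc (top e) = m + 1) {j : Fin (n + 2)}
    (hj : face e x = fun k => del j (slits e₁ k)) :
    (slits e₁ = slits e ∧ j = (e x).succ) ∨ (slits e₁ = slits e' ∧ j = (e' y).succ) := by
  have h1 := face_nondegenerate h.src hm
  rw [hj] at h1
  obtain ⟨z, w, hzw, rfl⟩ := exists_above_of_nondegenerate h1
  change face e x = face e₁ z at hj
  rcases hzw.fst_ne.lt_or_gt with h2 | h2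
  · left
    obtain ⟨h3, h4⟩ := first_face_unique h.src hzw hlt h2 hj
    exact ⟨h3.symm, by rw [h4]⟩
  -- Now the deleted slit belongs to the later chord, so the face is the second face of a slide from
  -- some `e₂` to `e₁`. Uniqueness of first faces identifies `e₂` with `e` up to the order of the
  -- ends, and the slide is transported along this relabelling.
  · right
    rw [← opp_opp w] at hzw
    obtain ⟨e₂, he₂⟩ := exists_slide_to hzw
    have h5 := he₂.face_eq h2
    rw [← hj] at h5
    obtain ⟨h3, h4⟩ := first_face_unique h.src he₂.src hlt h2 h5.symm
    rw [slits_eq_iff] at h3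
    have hf : ∀ l, e₂.symm (e (opp l)) = opp (e₂.symm (e l)) := by
      intro l
      refine (eq_or_eq_opp ?_).resolve_left ?_
      · rw [h3, h3, opp_fst]
      · simp [opp_ne]
    have hfx : e₂.symm (e x) = opp w := by rw [h4, symm_apply_apply]
    have hfy : e₂.symm (e y) = z := by
      rw [symm_apply_eq]
      apply Fin.castSucc_injective
      rw [h.src.eq, he₂.src.eq, h4]
    have h6 : Slide e ((e.trans e₂.symm).trans e₁) x y := by
      have h7 := Slide.relabel (f := e.trans e₂.symm) (x := x) (y := y) hf
        (by rw [trans_apply, trans_apply, hfx, hfy]; exact he₂)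
      simpa [Equiv.trans_assoc] using h7
    have h8 := h.unique h6
    refine ⟨slits_eq_iff.2 fun l => ?_, ?_⟩
    · rw [h8, trans_assoc, symm_trans_apply, symm_trans_apply, symm_symm]
      have h9 := h3 (e.symm (e₂ (e₁.symm (e₁ l))))
      rw [symm_apply_apply, apply_symm_apply, symm_apply_apply] at h9
      rw [symm_apply_apply]
      exact h9.symm
    · rw [h8, trans_apply, trans_apply, hfy]

end

section

/-! ### The boundary of a top-dimensional chain -/

variable {q : ℕ}

/-- In total degree `3q` both of the bounds for the bidegree, `2q` and `q`, must be attained. -/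
theorem cell_eq_of_mem_chains {m : ℕ} {z : Cell →₀ ℤ} (hz : z ∈ chains q m (3 * q)) {c : Cell}
    (hc : z c ≠ 0) : ∃ e : Word q (2 * q), c = cellOf e ∧ ncyc (top e) = m + 1 := by
  obtain ⟨hn, hpq⟩ := (Finsupp.mem_supported ℤ z).1 hz (Finsupp.mem_support_iff.2 hc)
  obtain ⟨p, q', σ⟩ := c
  obtain ⟨h1, h2, -⟩ := nondegenerate_mk.1 hn
  dsimp only at hpq
  obtain rfl : q' = q := by omega
  obtain rfl : p = 2 * q' := by omega
  obtain ⟨e, rfl, he⟩ := exists_word rfl hn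
  exact ⟨e, rfl, he⟩

theorem mk_injective {p q : ℕ} :
    Function.Injective fun σ : Fin (q + 1) → Perm (Fin (p + 1)) => (⟨p, q, σ⟩ : Cell) := by
  intro σ σ' h
  simpa using h

theorem boundary_apply {𝒪 : SignRule} {m N : ℕ} (hN : N = 2 * q) {z : Cell →₀ ℤ}
    (hz : z ∈ chains q m (3 * q)) (f : Cell) :
    boundary 𝒪 q m z f = ∑ σ : Fin (q + 1) → Perm (Fin (N + 1)), z ⟨N, q, σ⟩ *
      (verticalBoundary q m ⟨N, q, σ⟩ f + (-1) ^ q * horizontalBoundary 𝒪 q m ⟨N, q, σ⟩ f) := by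
  classical
  subst hN
  rw [boundary, Finsupp.linearCombination_apply, Finsupp.sum, Finsupp.finsetSum_apply]
  rw [← Finset.sum_image (s := Finset.univ)
    (f := fun c : Cell => z c * (verticalBoundary q m c f + (-1) ^ q *
      horizontalBoundary 𝒪 q m c f)) (mk_injective.injOn)]
  rw [Finset.sum_subset (s₂ := Finset.univ.image
    fun σ : Fin (q + 1) → Perm (Fin (2 * q + 1)) => (⟨2 * q, q, σ⟩ : Cell))]
  · apply Finset.sum_congr rfl
    intro c hc
    obtain ⟨σ, -, rfl⟩ := Finset.mem_image.1 hc
    simp [mul_add]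
  · intro c hc
    obtain ⟨e, rfl, -⟩ := cell_eq_of_mem_chains hz (Finsupp.mem_support_iff.1 hc)
    exact Finset.mem_image_of_mem _ (Finset.mem_univ _)
  · intro c _ hc
    rw [Finsupp.notMem_support_iff.1 hc]
    simp

open Classical in
theorem cls_apply {h m : ℕ} (c f : Cell) :
    Cell.cls h m c f = if c = f ∧ f.Nondegenerate h m then 1 else 0 := by
  unfold Cell.cls
  by_cases hc : c = f
  · subst hc
    by_cases hn : c.Nondegenerate h m <;> simp [hn]
  · by_cases hn : c.Nondegenerate h m <;> simp [hn, hc]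

/-- The part of the boundary given by the horizontal faces. -/
def horizontalPart (𝒪 : SignRule) (m n q : ℕ) (z : Cell →₀ ℤ) (f : Cell) : ℤ :=
  ∑ σ : Fin (q + 1) → Perm (Fin (n + 2)), ∑ j : Fin (n + 2),
    z ⟨n + 1, q, σ⟩ * (((-1) ^ (j : ℕ) * 𝒪 n j (σ (Fin.last q))) *
      Cell.cls q m ⟨n, q, fun k => del j (σ k)⟩ f)

/-- By `Slide.eq_or_eq` only two pairs of a cell and a letter contribute. The deleted letters are `e
x + 1 = e y` and `e' y + 1`, which explains the exponents. -/
theorem Slide.horizontalPart_eq {𝒪 : SignRule} {m n : ℕ} (z : Cell →₀ ℤ)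
    (hz : z ∈ chains q m (3 * q)) {e e' : Word q (n + 1)} {x y : Fin q × Bool}
    (h : Slide e e' x y) (hlt : x.1 < y.1) (hm : ncyc (top e) = m + 1) :
    horizontalPart 𝒪 m n q z ⟨n, q, face e x⟩ =
      (-1) ^ (e y : ℕ) * 𝒪 n (e x).succ (top e) * z (cellOf e) +
      (-1) ^ (e' y + 1 : ℕ) * 𝒪 n (e' y).succ (top e') * z (cellOf e') := by
  classical
  rw [horizontalPart, ← Finset.sum_product' (s := Finset.univ) (t := Finset.univ)
    (f := fun (σ : Fin (q + 1) → Perm (Fin (n + 2))) (j : Fin (n + 2)) =>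
      z ⟨n + 1, q, σ⟩ * (((-1) ^ (j : ℕ) * 𝒪 n j (σ (Fin.last q))) *
      Cell.cls q m ⟨n, q, fun k => del j (σ k)⟩ ⟨n, q, face e x⟩))]
  have hn := face_nondegenerate h.src hm
  have hdiff : (slits e, (e x).succ) ≠ (slits e', (e' y).succ) := by
    intro h1
    obtain ⟨h2, h3⟩ := Prod.mk.inj h1
    rw [slits_eq_iff] at h2
    have h4 : e'.symm (e x) = y := by rw [symm_apply_eq, Fin.succ_injective _ h3]
    have h5 := h2 x
    rw [h4] at h5
    exact h.src.fst_ne h5.symm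
  rw [Finset.univ_product_univ, Fintype.sum_eq_add _ _ hdiff]
  · have h1 : (⟨n, q, fun k => del (e x).succ (slits e k)⟩ : Cell) = ⟨n, q, face e x⟩ := rfl
    have h2 : (⟨n, q, fun k => del (e' y).succ (slits e' k)⟩ : Cell) = ⟨n, q, face e x⟩ := by
      rw [h.face_eq hlt]
      rfl
    have h3 : ((e x).succ : ℕ) = e y := by rw [← h.src.eq, Fin.val_castSucc]
    rw [cls_apply, cls_apply, if_pos ⟨h1, hn⟩, if_pos ⟨h2, hn⟩, h3, Fin.val_succ, cellOf, cellOf,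
      top, top]
    ring
  · rintro ⟨σ, j⟩ ⟨h1, h2⟩
    by_contra h3
    have hz0 : z ⟨n + 1, q, σ⟩ ≠ 0 := fun h4 => h3 (by simp [h4])
    have hc : (⟨n, q, fun k => del j (σ k)⟩ : Cell) = ⟨n, q, face e x⟩ := by
      by_contra h4
      exact h3 (by simp [cls_apply, h4])
    have hnd := ((Finsupp.mem_supported ℤ z).1 hz (Finsupp.mem_support_iff.2 hz0)).1
    obtain ⟨e₁, rfl, -⟩ := exists_word e.card_eq hnd
    rcases h.eq_or_eq hlt hm (mk_injective hc).symm with ⟨h4, h5⟩ | ⟨h4, h5⟩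
    · exact h1 (by rw [h4, h5])
    · exact h2 (by rw [h4, h5])

theorem horizontalPart_eq_zero {𝒪 : SignRule} {m n : ℕ} (hn : n + 1 = 2 * q) (z : Cell →₀ ℤ)
    (hz : z ∈ chains q m (3 * q)) (f : Cell)
    (h : ∀ (e e' : Word q (n + 1)) (x y : Fin q × Bool), Slide e e' x y → x.1 < y.1 →
      ncyc (top e) = m + 1 → f ≠ ⟨n, q, face e x⟩) :
    horizontalPart 𝒪 m n q z f = 0 := by
  refine Finset.sum_eq_zero fun σ _ => Finset.sum_eq_zero fun j _ => ?_
  by_contra h3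
  have hz0 : z ⟨n + 1, q, σ⟩ ≠ 0 := fun h4 => h3 (by simp [h4])
  have hc : (⟨n, q, fun k => del j (σ k)⟩ : Cell) = f ∧ f.Nondegenerate q m := by
    by_contra h4
    exact h3 (by simp [cls_apply, h4])
  obtain ⟨rfl, hf⟩ := hc
  have hnd := ((Finsupp.mem_supported ℤ z).1 hz (Finsupp.mem_support_iff.2 hz0)).1
  obtain ⟨e, rfl, hm⟩ := exists_word hn hnd
  obtain ⟨a, b, hab, rfl⟩ := exists_above_of_nondegenerate hf
  rcases hab.fst_ne.lt_or_gt with h1 | h1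
  · obtain ⟨e', he'⟩ := exists_slide hab
    exact h e e' a b he' h1 hm rfl
  · rw [← opp_opp b] at hab
    obtain ⟨e₂, he₂⟩ := exists_slide_to hab
    have h2 := he₂.face_eq h1
    refine h e₂ e (opp b) a he₂ h1 ?_ ?_
    · rw [← hm, ← ncyc_del he₂.src.top_ne, ← ncyc_del hab.top_ne]
      exact congrArg ncyc (congrFun h2 (Fin.last q))
    · rw [h2]
      rfl

/-! ### Vertical faces -/

/-- Change the order of the chords. -/
def reorder {N : ℕ} (π : Perm (Fin q)) (e : Word q N) : Word q N :=
  (Equiv.prodCongr π (Equiv.refl Bool)).trans e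

theorem reorder_apply {N : ℕ} (π : Perm (Fin q)) (e : Word q N) (l : Fin q × Bool) :
    reorder π e l = e (π l.1, l.2) := rfl

theorem arc_reorder {N : ℕ} (π : Perm (Fin q)) (e : Word q N) (i : Fin q) :
    arc (letters (reorder π e)) i = arc (letters e) (π i) := rfl

theorem top_reorder {N : ℕ} (π : Perm (Fin q)) (e : Word q N) : top (reorder π e) = top e := by
  apply top_eq_of_opp
  intro r
  rw [reorder_apply]
  simp [reorder, opp]

theorem slits_reorder_castSucc {N : ℕ} (π : Perm (Fin q)) (e : Word q N) (k : Fin (q + 1))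
    (l : Fin q × Bool) : slits (reorder π e) k (e l).castSucc =
      (e (if (π.symm l.1 : ℕ) < k then opp l else l)).succ := by
  have h := slits_castSucc (reorder π e) k (π.symm l.1, l.2)
  rw [reorder_apply] at h
  simp only [apply_symm_apply, Prod.mk.eta] at h
  rw [h]
  split_ifs <;> simp [reorder_apply, opp]

theorem arc_injective {N : ℕ} (e : Word q N) : Function.Injective (arc (letters e)) := by
  intro i j h
  rw [show i = (i, true).1 from rfl, show j = (j, true).1 from rfl, arc_eq, arc_eq] at h
  rcases swap_eq_swap (fun h => opp_ne _ (letters_injective e h).symm) h with ⟨h1, -⟩ | ⟨h1, -⟩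
  · exact congrArg Prod.fst (letters_injective e h1)
  · exact congrArg Prod.fst (letters_injective e h1)

/-- In a product of two disjoint transpositions the partner of `a` is its image, so the factor that
moves `a` can be read off the product. -/
theorem swap_mul_swap_eq {α : Type*} [DecidableEq α] {a b c d a' b' c' d' : α} (hab : a ≠ b)
    (hcb : c ≠ b) (hdb : d ≠ b) (hca' : c' ≠ a') (hda' : d' ≠ a')
    (hcb' : c' ≠ b') (hdb' : d' ≠ b') (h : swap c d * swap a b = swap c' d' * swap a' b') :
    swap a b = swap a' b' ∨ swap a b = swap c' d' := by
  have h1 := Perm.ext_iff.1 h a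
  rw [Perm.mul_apply, Perm.mul_apply, swap_apply_left,
    swap_apply_of_ne_of_ne hcb.symm hdb.symm] at h1
  by_cases h2 : a = a'
  · subst h2
    rw [swap_apply_left, swap_apply_of_ne_of_ne hcb'.symm hdb'.symm] at h1
    left; rw [h1]
  · by_cases h3 : a = b'
    · subst h3
      rw [swap_apply_right, swap_apply_of_ne_of_ne hca'.symm hda'.symm] at h1
      left; rw [h1, swap_comm]
    · rw [swap_apply_of_ne_of_ne h2 h3] at h1
      right
      by_cases h4 : a = c'
      · subst h4
        rw [h1, swap_apply_left]
      · by_cases h5 : a = d'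
        · subst h5
          rw [h1, swap_apply_right, swap_comm]
        · rw [swap_apply_of_ne_of_ne h4 h5] at h1
          exact absurd h1.symm hab

theorem arc_mul_arc_eq {N : ℕ} {e e' : Word q N} {i j : Fin q} (hij : i ≠ j)
    (h : arc (letters e) j * arc (letters e) i = arc (letters e') j * arc (letters e') i) :
    arc (letters e) i = arc (letters e') i ∨ arc (letters e) i = arc (letters e') j := by
  have hne : ∀ (e : Word q N) (b c : Bool), letters e (j, b) ≠ letters e (i, c) :=
    fun e b c h => hij (congrArg Prod.fst (letters_injective e h)).symm
  exact swap_mul_swap_eq (fun h => by simpa using letters_injective e h) (hne _ _ _) (hne _ _ _)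
    (hne _ _ _) (hne _ _ _) (hne _ _ _) (hne _ _ _) h

/-- The vertical face of a tuple. -/
def vface {N : ℕ} (σ : Fin (q + 2) → Perm (Fin (N + 1))) (i : Fin (q + 2)) :
    Fin (q + 1) → Perm (Fin (N + 1)) := fun k => σ (i.succAbove k)

theorem vface_step {N : ℕ} (e : Word (q + 1) N) (i k : Fin q) :
    vface (slits e) i.succ.castSucc k.succ * (vface (slits e) i.succ.castSucc k.castSucc)⁻¹ =
      if k < i then arc (letters e) k.castSucc else
      if k = i then arc (letters e) k.succ * arc (letters e) k.castSucc else
        arc (letters e) k.succ := by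
  have hs : ∀ i, slits e i.succ = arc (letters e) i * slits e i.castSucc := fun _ => rfl
  unfold vface
  split_ifs with h1 h2
  · rw [Fin.succAbove_of_castSucc_lt, Fin.succAbove_of_castSucc_lt, ← Fin.succ_castSucc, hs,
      mul_inv_cancel_right]
    · simp only [Fin.lt_def, Fin.val_castSucc, Fin.val_succ] at *; omega
    · simp only [Fin.lt_def, Fin.val_castSucc, Fin.val_succ] at *; omega
  · subst h2
    rw [Fin.succAbove_of_le_castSucc, Fin.succAbove_of_castSucc_lt, hs, ← Fin.succ_castSucc, hs,
      ← mul_assoc, mul_inv_cancel_right]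
    · simp only [Fin.lt_def, Fin.val_castSucc, Fin.val_succ] at *; omega
    · simp only [Fin.le_def, Fin.val_castSucc, Fin.val_succ] at *; omega
  · have h3 : (k : ℕ) ≠ i := fun h => h2 (Fin.ext h)
    rw [Fin.succAbove_of_le_castSucc, Fin.succAbove_of_le_castSucc, hs, Fin.succ_castSucc,
      mul_inv_cancel_right]
    · simp only [Fin.lt_def, Fin.le_def, Fin.val_castSucc, Fin.val_succ] at *; omega
    · simp only [Fin.lt_def, Fin.le_def, Fin.val_castSucc, Fin.val_succ] at *; omega

theorem vface_zero {N : ℕ} (σ : Fin (q + 2) → Perm (Fin (N + 1))) (i : Fin q) :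
    vface σ i.succ.castSucc 0 = σ 0 := by
  unfold vface
  rw [Fin.succAbove_ne_zero_zero]
  simp [Fin.ext_iff]

theorem vface_last {N : ℕ} (σ : Fin (q + 2) → Perm (Fin (N + 1))) (i : Fin q) :
    vface σ i.succ.castSucc (Fin.last q) = σ (Fin.last (q + 1)) := by
  unfold vface
  rw [Fin.succAbove_ne_last_last]
  simp [Fin.ext_iff]
  omega

theorem arc_succ_mul_arc_ne_one {N : ℕ} (e : Word (q + 1) N) (k : Fin q) :
    arc (letters e) k.succ * arc (letters e) k.castSucc ≠ 1 := by
  intro h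
  rw [mul_eq_one_iff_eq_inv, arc, arc, swap_inv] at h
  exact Fin.castSucc_lt_succ.ne' (arc_injective e h)

theorem vface_nondegenerate {m N : ℕ} {e : Word (q + 1) N} (hm : ncyc (top e) = m + 1)
    (i : Fin q) :
    (⟨N, q, vface (slits e) i.succ.castSucc⟩ : Cell).Nondegenerate (q + 1) m := by
  obtain ⟨h1, -, -, -, h2, h3, -, h4⟩ := nondegenerate_mk.1 (slits_nondegenerate hm)
  have hswap := letters_isSwap e
  have hstep : ∀ k : Fin q, wordLength (vface (slits e) i.succ.castSucc k.succ *
      (vface (slits e) i.succ.castSucc k.castSucc)⁻¹) = 1 + if k = i then 1 else 0 := by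
    intro k
    rw [vface_step]
    by_cases hk : k < i
    · rw [if_pos hk, if_neg hk.ne, wordLength_eq_one.2 (hswap _)]
    · by_cases hk2 : k = i
      · rw [if_neg hk, if_pos hk2, if_pos hk2, wordLength_eq_two (hswap _) (hswap _)]
        exact arc_succ_mul_arc_ne_one e k
      · rw [if_neg hk, if_neg hk2, if_neg hk2, wordLength_eq_one.2 (hswap _)]
  refine nondegenerate_mk.2 ⟨h1, by omega, ?_, ?_, fun k => h2 _, ?_, ?_, ?_⟩
  · simp only [tupleNorm, hstep]
    simp [Finset.sum_add_distrib]
  · rw [vface_last]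
    exact hm
  · rw [vface_zero, h3]
  · intro k hk
    have h5 := hstep k
    rw [hk, mul_inv_cancel, wordLength_eq_zero.2 rfl] at h5
    omega
  · rintro ⟨k, hk⟩
    have h5 := hk (Fin.last q)
    rw [vface_last] at h5
    have h2 : top e (e (e.symm k)).castSucc = k.succ := by
      rw [apply_symm_apply]
      exact h5
    rw [top_castSucc] at h2
    have h3 := Fin.succ_injective _ h2
    rw [← Equiv.eq_symm_apply] at h3
    exact opp_ne _ h3

/-- Omitting `σ_0` violates the condition that the first permutation is the rotation, and omitting
the last permutation lowers the norm. -/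
theorem exists_of_vface_nondegenerate {m N : ℕ} {e : Word (q + 1) N} {j : Fin (q + 2)}
    (h : (⟨N, q, vface (slits e) j⟩ : Cell).Nondegenerate (q + 1) m) :
    ∃ i : Fin q, j = i.succ.castSucc := by
  obtain ⟨-, -, h1, -, -, h3, -, -⟩ := nondegenerate_mk.1 h
  have hj0 : j ≠ 0 := by
    rintro rfl
    exact slits_succ_ne e 0 (by rw [Fin.castSucc_zero]; exact h3)
  have hjl : j ≠ Fin.last (q + 1) := by
    rintro rfl
    have : tupleNorm (vface (slits e) (Fin.last (q + 1))) = q := by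
      apply tupleNorm_of_forall_isSwap
      intro k
      unfold vface
      rw [Fin.succAbove_last, ← Fin.succ_castSucc, slits, arc_eq_mul_inv]
      exact letters_isSwap e _
    omega
  obtain ⟨r, rfl⟩ := Fin.exists_succ_eq.2 hj0
  have hr : r ≠ Fin.last q := by
    rintro rfl
    exact hjl rfl
  obtain ⟨i, rfl⟩ := Fin.exists_castSucc_eq.2 hr
  exact ⟨i, rfl⟩

theorem sign_arc {N : ℕ} (e : Word q N) (i : Fin q) : Perm.sign (arc (letters e) i) = -1 :=
  (letters_isSwap e i).sign_eq

/-- Exchange two successive chords. -/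
def exchange {N : ℕ} (i : Fin q) (e : Word (q + 1) N) : Word (q + 1) N :=
  reorder (swap i.castSucc i.succ) e

theorem slits_exchange {N : ℕ} (i : Fin q) (e : Word (q + 1) N) {k : Fin (q + 2)}
    (hk : k ≠ i.succ.castSucc) : slits (exchange i e) k = slits e k := by
  ext1 r
  induction r using Fin.lastCases with
  | last => rw [slits_last, slits_last]
  | cast r =>
    rw [← apply_symm_apply e r, exchange, slits_reorder_castSucc, slits_castSucc, symm_swap]
    congr 2
    have hk' : (k : ℕ) ≠ i + 1 := fun h => hk (Fin.ext (by simp [h]))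
    refine if_congr ?_ rfl rfl
    rw [swap_apply_def]
    split_ifs with h1 h2
    · rw [h1, Fin.val_succ, Fin.val_castSucc]; omega
    · rw [h2, Fin.val_succ, Fin.val_castSucc]; omega
    · rfl

theorem vface_exchange {N : ℕ} (i : Fin q) (e : Word (q + 1) N) :
    vface (slits (exchange i e)) i.succ.castSucc = vface (slits e) i.succ.castSucc :=
  funext fun _ => slits_exchange i e (Fin.succAbove_ne _ _)

theorem slits_exchange_ne {N : ℕ} (i : Fin q) (e : Word (q + 1) N) :
    slits e ≠ slits (exchange i e) := by
  intro h
  have h1 := arcs_eq_iff.1 h i.castSucc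
  rw [exchange, arc_reorder, swap_apply_left] at h1
  exact Fin.castSucc_lt_succ.ne (arc_injective e h1)

theorem eq_or_eq_of_vface_eq {m N : ℕ} {e e₁ : Word (q + 1) N} (hm : ncyc (top e) = m + 1)
    {i : Fin q} {j : Fin (q + 2)} (h : vface (slits e) i.succ.castSucc = vface (slits e₁) j) :
    j = i.succ.castSucc ∧ (slits e₁ = slits e ∨ slits e₁ = slits (exchange i e)) := by
  have h1 := vface_nondegenerate hm i
  rw [h] at h1
  obtain ⟨i', rfl⟩ := exists_of_vface_nondegenerate h1
  have hstep : ∀ k, _ := fun k => (vface_step e i k).symm.trans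
    ((congrArg (fun σ => σ k.succ * (σ k.castSucc)⁻¹) h).trans (vface_step e₁ i' k))
  -- The omitted place is visible in the face: it is the only step that is an even permutation.
  obtain rfl : i = i' := by
    by_contra hne
    have h2 := congrArg Perm.sign (hstep i)
    rw [if_neg (lt_irrefl _), if_pos rfl, if_neg hne] at h2
    split_ifs at h2 <;> simp [sign_arc] at h2
  refine ⟨rfl, ?_⟩
  have hk : ∀ k ≠ i.succ.castSucc, slits e₁ k = slits e k := by
    intro k hk
    obtain ⟨r, rfl⟩ := Fin.exists_succAbove_eq hk
    exact (congrFun h r).symm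
  have h2 := hstep i
  rw [if_neg (lt_irrefl _), if_pos rfl, if_neg (lt_irrefl _), if_pos rfl] at h2
  have hs : ∀ e : Word (q + 1) N, slits e i.succ.castSucc =
    arc (letters e) i.castSucc * slits e i.castSucc.castSucc := fun _ => rfl
  have h0 : slits e₁ i.castSucc.castSucc = slits e i.castSucc.castSucc := by
    apply hk
    simp [Fin.ext_iff]
  rcases arc_mul_arc_eq Fin.castSucc_lt_succ.ne h2.symm with h3 | h3
  · left
    funext k
    by_cases hkk : k = i.succ.castSucc
    · rw [hkk, hs, hs, h3, h0]
    · exact hk k hkk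
  · right
    funext k
    by_cases hkk : k = i.succ.castSucc
    · rw [hkk, hs, hs, h3, h0, slits_exchange, exchange, arc_reorder, swap_apply_left]
      simp [Fin.ext_iff]
    · rw [hk k hkk, slits_exchange i e hkk]

/-- The part of the boundary given by the vertical faces. -/
def verticalPart (m N q : ℕ) (z : Cell →₀ ℤ) (f : Cell) : ℤ :=
  ∑ σ : Fin (q + 2) → Perm (Fin (N + 1)), ∑ i : Fin (q + 2),
    z ⟨N, q + 1, σ⟩ * ((-1) ^ (i : ℕ) * Cell.cls (q + 1) m ⟨N, q, vface σ i⟩ f)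

theorem verticalPart_eq {m N : ℕ} (z : Cell →₀ ℤ) (hz : z ∈ chains (q + 1) m (3 * (q + 1)))
    {e : Word (q + 1) N} (hm : ncyc (top e) = m + 1) (i : Fin q) :
    verticalPart m N q z ⟨N, q, vface (slits e) i.succ.castSucc⟩ =
      (-1) ^ (i + 1 : ℕ) * (z (cellOf e) + z (cellOf (exchange i e))) := by
  classical
  rw [verticalPart, ← Finset.sum_product' (s := Finset.univ) (t := Finset.univ)
    (f := fun (σ : Fin (q + 2) → Perm (Fin (N + 1))) (j : Fin (q + 2)) =>
      z ⟨N, q + 1, σ⟩ * ((-1) ^ (j : ℕ) * Cell.cls (q + 1) m ⟨N, q, vface σ j⟩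
        ⟨N, q, vface (slits e) i.succ.castSucc⟩))]
  have hn := vface_nondegenerate hm i
  have hdiff : (slits e, i.succ.castSucc) ≠ (slits (exchange i e), i.succ.castSucc) := by
    intro h1
    exact slits_exchange_ne i e (Prod.mk.inj h1).1
  rw [Finset.univ_product_univ, Fintype.sum_eq_add _ _ hdiff]
  · have h2 : (⟨N, q, vface (slits (exchange i e)) i.succ.castSucc⟩ : Cell) =
        ⟨N, q, vface (slits e) i.succ.castSucc⟩ := by
      rw [vface_exchange]
    rw [cls_apply, cls_apply, if_pos ⟨rfl, hn⟩, if_pos ⟨h2, hn⟩, Fin.val_castSucc, Fin.val_succ,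
      cellOf, cellOf]
    ring
  · rintro ⟨σ, j⟩ ⟨h1, h2⟩
    by_contra h3
    have hz0 : z ⟨N, q + 1, σ⟩ ≠ 0 := fun h4 => h3 (by simp [h4])
    have hc : (⟨N, q, vface σ j⟩ : Cell) = ⟨N, q, vface (slits e) i.succ.castSucc⟩ := by
      by_contra h4
      exact h3 (by rw [cls_apply, if_neg (fun h5 => h4 h5.1), mul_zero, mul_zero])
    have hnd := ((Finsupp.mem_supported ℤ z).1 hz (Finsupp.mem_support_iff.2 hz0)).1
    obtain ⟨e₁, rfl, -⟩ := exists_word e.card_eq hnd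
    obtain ⟨h5, h4 | h4⟩ := eq_or_eq_of_vface_eq hm (mk_injective hc).symm
    · exact h1 (by rw [h4, h5])
    · exact h2 (by rw [h4, h5])

theorem verticalPart_eq_zero {m N : ℕ} (hN : N = 2 * (q + 1)) (z : Cell →₀ ℤ)
    (hz : z ∈ chains (q + 1) m (3 * (q + 1))) (f : Cell)
    (h : ∀ (e : Word (q + 1) N) (i : Fin q), ncyc (top e) = m + 1 →
      f ≠ ⟨N, q, vface (slits e) i.succ.castSucc⟩) :
    verticalPart m N q z f = 0 := by
  refine Finset.sum_eq_zero fun σ _ => Finset.sum_eq_zero fun j _ => ?_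
  by_contra h3
  have hz0 : z ⟨N, q + 1, σ⟩ ≠ 0 := fun h4 => h3 (by simp [h4])
  have hc : (⟨N, q, vface σ j⟩ : Cell) = f ∧ f.Nondegenerate (q + 1) m := by
    by_contra h4
    exact h3 (by simp [cls_apply, h4])
  obtain ⟨rfl, hf⟩ := hc
  have hnd := ((Finsupp.mem_supported ℤ z).1 hz (Finsupp.mem_support_iff.2 hz0)).1
  obtain ⟨e, rfl, hm⟩ := exists_word hN hnd
  obtain ⟨i, rfl⟩ := exists_of_vface_nondegenerate hf
  exact h e i hm rfl

theorem boundary_apply_eq_add {𝒪 : SignRule} {m n : ℕ} (hn : n + 1 = 2 * (q + 1)) {z : Cell →₀ ℤ}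
    (hz : z ∈ chains (q + 1) m (3 * (q + 1))) (f : Cell) :
    boundary 𝒪 (q + 1) m z f = verticalPart m (n + 1) q z f +
      (-1) ^ (q + 1) * horizontalPart 𝒪 m n (q + 1) z f := by
  rw [boundary_apply hn hz, verticalPart, horizontalPart, Finset.mul_sum,
    ← Finset.sum_add_distrib]
  refine Finset.sum_congr rfl fun σ _ => ?_
  rw [mul_add, ← mul_assoc, mul_comm (z _) ((-1) ^ (q + 1)), mul_assoc]
  congr 1
  · simp only [verticalBoundary, Finsupp.finsetSum_apply, Finsupp.smul_apply, Finset.mul_sum,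
      smul_eq_mul]
    rfl
  · congr 1
    simp only [horizontalBoundary, Finsupp.finsetSum_apply, Finsupp.smul_apply, Finset.mul_sum,
      smul_eq_mul]

/-- The condition that the coefficients of a chain cancel at the vertical faces. -/
def VerticalCancel (q m : ℕ) (z : Cell →₀ ℤ) : Prop :=
  ∀ (q' N : ℕ) (_ : q = q' + 1) (e : Word (q' + 1) N), ncyc (top e) = m + 1 → ∀ i : Fin q',
    z (cellOf (exchange i e)) = - z (cellOf e)

/-- The condition that the coefficients of a chain cancel at the horizontal faces. -/
def HorizontalCancel (𝒪 : SignRule) (q m : ℕ) (z : Cell →₀ ℤ) : Prop :=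
  ∀ (n : ℕ) (e e' : Word q (n + 1)) (x y : Fin q × Bool), Slide e e' x y → x.1 < y.1 →
    ncyc (top e) = m + 1 →
      (-1) ^ (e y : ℕ) * 𝒪 n (e x).succ (top e) * z (cellOf e) +
      (-1) ^ (e' y + 1 : ℕ) * 𝒪 n (e' y).succ (top e') * z (cellOf e') = 0

/-- Vertical and horizontal faces have different bidegrees, so the two kinds cancel separately. -/
theorem boundary_eq_zero_iff {𝒪 : SignRule} {m : ℕ} {z : Cell →₀ ℤ}
    (hz : z ∈ chains q m (3 * q)) :
    boundary 𝒪 q m z = 0 ↔ VerticalCancel q m z ∧ HorizontalCancel 𝒪 q m z := by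
  rcases q with _ | q
  -- Without chords `p = q = 0`, and there both boundary operators vanish by definition.
  · constructor
    · intro _
      refine ⟨fun q' N hq => by omega, fun n e e' x => x.1.elim0⟩
    · intro _
      ext f
      rw [boundary_apply (N := 0) rfl hz]
      simp [verticalBoundary, horizontalBoundary]
  have hN : 2 * q + 1 + 1 = 2 * (q + 1) := by ring
  have hv0 : ∀ (n : ℕ) (φ : Fin (q + 2) → Perm (Fin (n + 1))),
      verticalPart m (2 * q + 1 + 1) q z ⟨n, q + 1, φ⟩ = 0 := by
    intro n φ
    apply verticalPart_eq_zero hN z hz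
    intro e i _ h
    have := congrArg Cell.q h
    simp at this
  have hh0 : ∀ (N : ℕ) (φ : Fin (q + 1) → Perm (Fin (N + 1))),
      horizontalPart 𝒪 m (2 * q + 1) (q + 1) z ⟨N, q, φ⟩ = 0 := by
    intro n φ
    apply horizontalPart_eq_zero hN z hz
    intro e e' x y _ _ _ h
    have := congrArg Cell.q h
    simp at this
  constructor
  · intro h0
    constructor
    · rintro q' N hq e hm i
      obtain rfl : q = q' := by omega
      obtain rfl : N = 2 * q + 1 + 1 := by have := e.card_eq; omega
      have h1 := boundary_apply_eq_add (𝒪 := 𝒪) hN hz ⟨_, q, vface (slits e) i.succ.castSucc⟩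
      rw [h0, hh0, verticalPart_eq z hz hm] at h1
      simp only [Finsupp.coe_zero, Pi.zero_apply, mul_zero, add_zero, zero_eq_mul, pow_eq_zero_iff',
        neg_eq_zero, one_ne_zero, false_and, false_or] at h1
      linarith
    · intro n e e' x y h hlt hm
      obtain rfl : n = 2 * q + 1 := by have := e.card_eq; omega
      have h1 := boundary_apply_eq_add (𝒪 := 𝒪) hN hz ⟨_, q + 1, face e x⟩
      rw [h0, hv0, h.horizontalPart_eq z hz hlt hm] at h1
      simpa using h1.symm
  · rintro ⟨hV, hH⟩
    ext f
    rw [boundary_apply_eq_add hN hz]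
    have h1 : verticalPart m (2 * q + 1 + 1) q z f = 0 := by
      by_contra h1
      apply h1
      apply verticalPart_eq_zero hN z hz
      rintro e i hm rfl
      rw [verticalPart_eq z hz hm, hV q _ rfl e hm i] at h1
      simp at h1
    have h2 : horizontalPart 𝒪 m (2 * q + 1) (q + 1) z f = 0 := by
      by_contra h1
      apply h1
      apply horizontalPart_eq_zero hN z hz
      rintro e e' x y h hlt hm rfl
      rw [h.horizontalPart_eq z hz hlt hm] at h1
      exact h1 (hH _ e e' x y h hlt hm)
    rw [h1, h2]
    simp

end

section

/-! ### Punctures -/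

theorem exists_puncture_sameCycle {n : ℕ} {σ : Perm (Fin (n + 1))} {r : Fin (n + 1)}
    (h : ¬ σ.SameCycle 0 r) : ∃ s ∈ puncture σ, σ.SameCycle s r := by
  classical
  have hne : (Finset.univ.filter fun s => σ.SameCycle s r).Nonempty :=
    ⟨r, by simp [Perm.SameCycle.refl]⟩
  obtain ⟨s, hs, hmin⟩ := Finset.exists_min_image _ id hne
  simp only [Finset.mem_filter, Finset.mem_univ, true_and, id] at hs hmin
  exact ⟨s, ⟨fun h' => h (h'.trans hs), fun y hy => hmin y (hy.symm.trans hs)⟩, hs⟩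

theorem puncture_eq_of_sameCycle {n : ℕ} {σ : Perm (Fin (n + 1))} {s t : Fin (n + 1)}
    (hs : s ∈ puncture σ) (ht : t ∈ puncture σ) (h : σ.SameCycle s t) : s = t :=
  le_antisymm (hs.2 t h) (ht.2 s h.symm)

theorem ncyc_eq_card_puncture {n : ℕ} (σ : Perm (Fin (n + 1))) :
    ncyc σ = Nat.card (puncture σ) + 1 := by
  classical
  let f : Option (puncture σ) → Quotient (Perm.SameCycle.setoid σ) := fun o =>
    o.elim (Quotient.mk'' 0) fun s => Quotient.mk'' s.1
  have hf : Function.Bijective f := by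
    constructor
    · rintro (_ | s) (_ | t) h
      · rfl
      · exact absurd (Quotient.exact' (s₁ := Perm.SameCycle.setoid σ) h) t.2.1
      · exact absurd (Quotient.exact' (s₁ := Perm.SameCycle.setoid σ) h.symm) s.2.1
      · rw [Subtype.ext (puncture_eq_of_sameCycle s.2 t.2
          (Quotient.exact' (s₁ := Perm.SameCycle.setoid σ) h))]
    · rintro ⟨r⟩
      by_cases h : σ.SameCycle 0 r
      · exact ⟨none, Quotient.sound' (s₁ := Perm.SameCycle.setoid σ) h⟩
      · obtain ⟨s, hs, hr⟩ := exists_puncture_sameCycle h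
        exact ⟨some ⟨s, hs⟩, Quotient.sound' (s₁ := Perm.SameCycle.setoid σ) hr⟩
  rw [ncyc, ← Nat.card_congr (Equiv.ofBijective f hf), Finite.card_option]

/-- The enumeration of the punctures by increasing minima. -/
def enum {n m : ℕ} (σ : Perm (Fin (n + 1))) (h : ncyc σ = m + 1) : Fin m ≃o puncture σ :=
  letI := Fintype.ofFinite (puncture σ)
  monoEquivOfFin (puncture σ) (by
    rw [← Nat.card_eq_fintype_card]
    have := ncyc_eq_card_puncture σ
    omega)

theorem enum_congr {n m : ℕ} {σ τ : Perm (Fin (n + 1))} (h : σ = τ) (hσ : ncyc σ = m + 1)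
    (hτ : ncyc τ = m + 1) (a : Fin m) : (enum σ hσ a : Fin (n + 1)) = enum τ hτ a := by
  subst h
  rfl

theorem exists_enum_sameCycle {n m : ℕ} {σ : Perm (Fin (n + 1))} (hσ : ncyc σ = m + 1)
    {r : Fin (n + 1)} (h : ¬ σ.SameCycle 0 r) : ∃ a : Fin m, σ.SameCycle (enum σ hσ a) r := by
  obtain ⟨s, hs, hr⟩ := exists_puncture_sameCycle h
  exact ⟨(enum σ hσ).symm ⟨s, hs⟩, by rwa [OrderIso.apply_symm_apply]⟩

theorem enum_eq_of_sameCycle {n m : ℕ} {σ : Perm (Fin (n + 1))} {hσ : ncyc σ = m + 1}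
    {a b : Fin m} (h : σ.SameCycle (enum σ hσ a) (enum σ hσ b)) : a = b :=
  (enum σ hσ).injective (Subtype.ext
    (puncture_eq_of_sameCycle (enum σ hσ a).2 (enum σ hσ b).2 h))

/-! ### Punctures before and after the deletion of a letter -/

section Deletion

variable {p m : ℕ} {j : Fin (p + 2)} {σ : Perm (Fin (p + 2))}

theorem exists_corresponding (hj : j ≠ 0) (hσj : σ j ≠ j) (h : ncyc σ = m + 1)
    (h' : ncyc (del j σ) = m + 1) (a : Fin m) :
    ∃ b, σ.SameCycle (enum σ h a) (j.succAbove (enum (del j σ) h' b)) := by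
  obtain ⟨c, hc⟩ : ∃ c, σ.SameCycle (enum σ h a) (j.succAbove c) := by
    by_cases h1 : (enum σ h a : Fin (p + 2)) = j
    · obtain ⟨c, hc⟩ := Fin.exists_succAbove_eq hσj
      refine ⟨c, ?_⟩
      rw [hc, h1]
      exact (Perm.SameCycle.refl _ _).apply_right
    · obtain ⟨c, hc⟩ := Fin.exists_succAbove_eq h1
      exact ⟨c, by rw [hc]⟩
  have h0 : ¬ (del j σ).SameCycle 0 c := by
    intro h2
    rw [sameCycle_del, Fin.succAbove_ne_zero_zero hj] at h2
    exact (enum σ h a).2.1 (h2.trans hc.symm)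
  obtain ⟨b, hb⟩ := exists_enum_sameCycle h' h0
  exact ⟨b, hc.trans (sameCycle_del.1 hb).symm⟩

/-- The permutation between the enumerations of the punctures before and after the deletion of the
letter `j`. -/
def punctPerm (j : Fin (p + 2)) (σ : Perm (Fin (p + 2))) (hj : j ≠ 0) (hσj : σ j ≠ j)
    (h : ncyc σ = m + 1) : Perm (Fin m) :=
  Equiv.ofBijective
    (fun a => (exists_corresponding hj hσj h ((ncyc_del hσj).trans h) a).choose) (by
      rw [← Finite.injective_iff_bijective]
      intro a b hab
      have ha := (exists_corresponding hj hσj h ((ncyc_del hσj).trans h) a).choose_spec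
      have hb := (exists_corresponding hj hσj h ((ncyc_del hσj).trans h) b).choose_spec
      dsimp only at hab
      rw [hab] at ha
      exact enum_eq_of_sameCycle (ha.trans hb.symm))

theorem punctPerm_spec (hj : j ≠ 0) (hσj : σ j ≠ j) (h : ncyc σ = m + 1)
    (h' : ncyc (del j σ) = m + 1) (a : Fin m) :
    σ.SameCycle (enum σ h a) (j.succAbove (enum (del j σ) h' (punctPerm j σ hj hσj h a))) :=
  (exists_corresponding hj hσj h ((ncyc_del hσj).trans h) a).choose_spec

theorem sameCycle_succAbove_iff (hj : j ≠ 0) (hσj : σ j ≠ j) (h : ncyc σ = m + 1)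
    (h' : ncyc (del j σ) = m + 1) (a : Fin m) (r : Fin (p + 1)) :
    σ.SameCycle (enum σ h a) (j.succAbove r) ↔
      (del j σ).SameCycle (enum (del j σ) h' (punctPerm j σ hj hσj h a)) r := by
  have h1 := punctPerm_spec hj hσj h h' a
  rw [sameCycle_del]
  exact ⟨fun h2 => h1.symm.trans h2, fun h2 => h1.trans h2⟩

theorem overtakes_iff (hj : j ≠ 0) (hσj : σ j ≠ j) (h : ncyc σ = m + 1) (a b : Fin m) :
    Overtakes j σ (enum σ h a) (enum σ h b) ↔
      punctPerm j σ hj hσj h b < punctPerm j σ hj hσj h a := by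
  have h' : ncyc (del j σ) = m + 1 := (ncyc_del hσj).trans h
  rw [← (enum (del j σ) h').lt_iff_lt, ← Subtype.coe_lt_coe]
  constructor
  · rintro ⟨c, hc, hcj, hmin⟩
    obtain ⟨c, rfl⟩ := Fin.exists_succAbove_eq hcj
    have h1 := hmin _ (punctPerm_spec hj hσj h h' a) (Fin.succAbove_ne _ _)
    rw [Fin.succAbove_lt_succAbove_iff] at h1
    exact ((enum (del j σ) h' _).2.2 c ((sameCycle_succAbove_iff hj hσj h h' b c).1 hc)).trans_lt h1
  · intro h1
    refine ⟨_, punctPerm_spec hj hσj h h' b, Fin.succAbove_ne _ _, fun d hd hdj => ?_⟩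
    obtain ⟨d, rfl⟩ := Fin.exists_succAbove_eq hdj
    rw [Fin.succAbove_lt_succAbove_iff]
    exact h1.trans_le
      ((enum (del j σ) h' _).2.2 d ((sameCycle_succAbove_iff hj hσj h h' a d).1 hd))

/-- The overtaking pairs are the inversions of `punctPerm` (`overtakes_iff`), and the sign of a
permutation is `-1` to the number of inversions. Pairs that do not consist of punctures contribute
the factor one. -/
theorem orientation_eq_sign (hj : j ≠ 0) (hσj : σ j ≠ j) (h : ncyc σ = m + 1) :
    orientation p j σ = Perm.sign (punctPerm j σ hj hσj h) := by
  classical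
  rw [Perm.sign_eq_prod_prod_Iio, Finset.prod_sigma', Units.coe_prod, orientation]
  have hinj : Function.Injective fun z : (_ : Fin m) × Fin m =>
      ((enum σ h z.2 : Fin (p + 2)), (enum σ h z.1 : Fin (p + 2))) := by
    rintro ⟨a, b⟩ ⟨c, d⟩ h1
    obtain ⟨h2, h3⟩ := Prod.mk.inj h1
    have h4 := (enum σ h).injective (Subtype.ext h2)
    have h5 := (enum σ h).injective (Subtype.ext h3)
    dsimp only at h4 h5
    rw [h4, h5]
  symm
  apply Finset.prod_of_injOn (fun z : (_ : Fin m) × Fin m =>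
    ((enum σ h z.2 : Fin (p + 2)), (enum σ h z.1 : Fin (p + 2)))) hinj.injOn
  · exact fun _ _ => Finset.mem_coe.2 (Finset.mem_univ _)
  · rintro ⟨x, y⟩ - hz
    rw [if_neg]
    rintro ⟨hx, hy, hlt, -⟩
    apply hz
    refine ⟨⟨(enum σ h).symm ⟨y, hy⟩, (enum σ h).symm ⟨x, hx⟩⟩, ?_, by simp⟩
    simpa using hlt
  · rintro ⟨b, a⟩ hz
    simp only [Finset.mem_sigma, Finset.mem_univ, true_and, Finset.mem_Iio] at hz
    have h1 : (enum σ h a : Fin (p + 2)) < enum σ h b :=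
      Subtype.coe_lt_coe.2 ((enum σ h).lt_iff_lt.2 hz)
    have h2 := overtakes_iff hj hσj h a b
    dsimp only
    simp only [h2, (enum σ h a).2, (enum σ h b).2, h1, true_and]
    have h3 : punctPerm j σ hj hσj h a ≠ punctPerm j σ hj hσj h b :=
      fun h3 => hz.ne ((punctPerm j σ hj hσj h).injective h3)
    rcases h3.lt_or_gt with h4 | h4
    · rw [if_pos h4, if_neg h4.not_gt]
      rfl
    · rw [if_neg h4.not_gt, if_pos h4]
      rfl

end Deletion

/-- A sign rule that compares the enumerations of the punctures. -/
def Compatible (𝒪 : SignRule) (m : ℕ) : Prop :=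
  ∀ (p : ℕ) (j : Fin (p + 2)) (σ : Perm (Fin (p + 2))) (hj : j ≠ 0) (hσj : σ j ≠ j)
    (h : ncyc σ = m + 1), 𝒪 p j σ = Perm.sign (punctPerm j σ hj hσj h)

theorem compatible_orientation (m : ℕ) : Compatible orientation m :=
  fun _ _ _ hj hσj h => orientation_eq_sign hj hσj h

/-- A permutation of at most one puncture is trivial. -/
theorem compatible_integral {m : ℕ} (hm : m ≤ 1) : Compatible integral m := by
  intro p j σ hj hσj h
  have : Subsingleton (Fin m) := by
    rcases Nat.le_one_iff_eq_zero_or_eq_one.1 hm with rfl | rfl <;> infer_instance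
  rw [Subsingleton.elim (punctPerm j σ hj hσj h) 1]
  simp [integral]

end

section

/-! ### Isomorphisms of the homology data of words -/

variable {q N m : ℕ}

/-- The sign with which an end of a chord enters the closed curve of the chord. -/
def wt (b : Bool) : ℤ := if b then -1 else 1

theorem wt_mul_self (b : Bool) : wt b * wt b = 1 := by cases b <;> rfl

@[simp] theorem wt_not (b : Bool) : wt (!b) = -wt b := by cases b <;> rfl

/-- The sign of the difference of two heights. -/
def order (u v : ℕ) : ℤ := ((v : ℤ) - u).sign

theorem order_swap (u v : ℕ) : order v u = -order u v := by
  rw [order, order, ← Int.sign_neg, neg_sub]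

theorem order_congr {u v u' v' : ℕ} (h₁ : u < v ↔ u' < v') (h₂ : v < u ↔ v' < u') :
    order u v = order u' v' := by
  unfold order
  rcases lt_trichotomy u v with h | rfl | h
  · rw [Int.sign_eq_one_of_pos (by omega), Int.sign_eq_one_of_pos (by omega)]
  · rw [show u' = v' by omega]
    simp
  · rw [Int.sign_eq_neg_one_of_neg (by omega), Int.sign_eq_neg_one_of_neg (by omega)]

theorem order_eq_one {u v : ℕ} (h : u < v) : order u v = 1 :=
  Int.sign_eq_one_of_pos (by omega)

/-- Twice the contribution of two ends of chords to the intersection number. -/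
def endInter (e : Word q N) (l l' : Fin q × Bool) : ℤ := wt l.2 * wt l'.2 * order (e l) (e l')

/-- Twice the intersection matrix. -/
def inter (e : Word q N) : Matrix (Fin q) (Fin q) ℤ := fun i j =>
  ∑ a : Bool, ∑ b : Bool, endInter e (i, a) (j, b)

theorem sum_bool {ι : Type*} (f : ι × Bool → ℤ) (l : ι × Bool) :
    ∑ a : Bool, f (l.1, a) = f l + f (opp l) := by
  obtain ⟨i, b⟩ := l
  cases b <;> simp [opp, add_comm]

theorem inter_eq (e : Word q N) (l l' : Fin q × Bool) :
    inter e l.1 l'.1 = (endInter e l l' + endInter e l (opp l')) +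
      (endInter e (opp l) l' + endInter e (opp l) (opp l')) := by
  unfold inter
  rw [sum_bool (fun l => ∑ b : Bool, endInter e l (l'.1, b)), sum_bool (fun k => endInter e l k),
    sum_bool (fun k => endInter e (opp l) k)]

theorem endInter_swap (e : Word q N) (l l' : Fin q × Bool) : endInter e l' l = -endInter e l l' := by
  rw [endInter, endInter, order_swap]
  ring

theorem inter_swap (e : Word q N) (i j : Fin q) : inter e j i = -inter e i j := by
  rw [show i = (i, true).1 from rfl, show j = (j, true).1 from rfl, inter_eq, inter_eq,
    endInter_swap e (i, true) (j, true), endInter_swap e (opp (i, true)) (j, true),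
    endInter_swap e (i, true) (opp (j, true)), endInter_swap e (opp (i, true)) (opp (j, true))]
  ring

theorem inter_self (e : Word q N) (i : Fin q) : inter e i i = 0 := by
  have := inter_swap e i i
  omega

open Classical in
/-- The indicator function of the cycle of `s`. -/
def ind {n : ℕ} (σ : Perm (Fin n)) (s r : Fin n) : ℤ := if σ.SameCycle s r then 1 else 0

theorem ind_congr {n n' : ℕ} {σ : Perm (Fin n)} {σ' : Perm (Fin n')} {s r : Fin n}
    {s' r' : Fin n'} (h : σ.SameCycle s r ↔ σ'.SameCycle s' r') : ind σ s r = ind σ' s' r' := by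
  unfold ind
  simp only [h]

/-- The loops around the punctures. -/
def loops (e : Word q N) (h : ncyc (top e) = m + 1) : Matrix (Fin m) (Fin q) ℤ := fun a i =>
  ∑ b : Bool, wt b * ind (top e) (enum (top e) h a) (e (i, b)).castSucc

theorem loops_eq (e : Word q N) (h : ncyc (top e) = m + 1) (a : Fin m) (l : Fin q × Bool) :
    loops e h a l.1 = wt l.2 * (ind (top e) (enum (top e) h a) (e l).castSucc -
      ind (top e) (enum (top e) h a) (e (opp l)).castSucc) := by
  unfold loops
  rw [sum_bool (fun l => wt l.2 * ind (top e) (enum (top e) h a) (e l).castSucc)]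
  simp only [opp, wt_not]
  ring

/-- An isomorphism between the homology data of two words, with the permutation of the punctures
that it induces. -/
structure IsIso (e : Word q N) (he : ncyc (top e) = m + 1) (e' : Word q N)
    (he' : ncyc (top e') = m + 1) (B : Matrix (Fin q) (Fin q) ℤ) (P : Perm (Fin m)) : Prop where
  det : IsUnit B.det
  inter : B * inter e' * B.transpose = inter e
  loops : loops e he * B = (loops e' he').submatrix P id

theorem IsIso.refl (e : Word q N) (he : ncyc (top e) = m + 1) : IsIso e he e he 1 1 :=
  ⟨by simp, by simp, by simp⟩

theorem IsIso.trans {e₁ e₂ e₃ : Word q N} {h₁ : ncyc (top e₁) = m + 1}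
    {h₂ : ncyc (top e₂) = m + 1} {h₃ : ncyc (top e₃) = m + 1} {B C : Matrix (Fin q) (Fin q) ℤ}
    {P Q : Perm (Fin m)} (h : IsIso e₁ h₁ e₂ h₂ B P) (h' : IsIso e₂ h₂ e₃ h₃ C Q) :
    IsIso e₁ h₁ e₃ h₃ (B * C) (Q * P) := by
  refine ⟨by rw [Matrix.det_mul]; exact h.det.mul h'.det, ?_, ?_⟩
  · rw [Matrix.transpose_mul, ← h.inter, ← h'.inter]
    simp only [Matrix.mul_assoc]
  · rw [← Matrix.mul_assoc, h.loops]
    have := congrArg (fun M => M.submatrix P id) h'.loops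
    rw [Matrix.submatrix_submatrix] at this
    rw [Perm.coe_mul, ← Function.id_comp (id : Fin q → Fin q), ← this]
    rfl

theorem IsIso.symm {e₁ e₂ : Word q N} {h₁ : ncyc (top e₁) = m + 1}
    {h₂ : ncyc (top e₂) = m + 1} {B : Matrix (Fin q) (Fin q) ℤ}
    {P : Perm (Fin m)} (h : IsIso e₁ h₁ e₂ h₂ B P) :
    IsIso e₂ h₂ e₁ h₁ B⁻¹ P⁻¹ := by
  have hB := h.det
  refine ⟨by rw [Matrix.det_nonsing_inv]; exact hB.ringInverse, ?_, ?_⟩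
  · rw [← h.inter, Matrix.transpose_nonsing_inv]
    rw [Matrix.mul_assoc B, Matrix.nonsing_inv_mul_cancel_left _ _ hB, Matrix.mul_nonsing_inv_cancel_right]
    simpa using hB
  · have h2 := congrArg (fun M => M.submatrix (P⁻¹ : Perm _) id * B⁻¹) h.loops
    rw [Matrix.submatrix_submatrix, ← Perm.coe_mul, mul_inv_cancel, Function.id_comp, Perm.coe_one,
      Matrix.submatrix_id_id] at h2
    rw [← h2]
    have h3 : (ParallelSlit.loops e₁ h₁ * B).submatrix (P⁻¹ : Perm _) id =
      (ParallelSlit.loops e₁ h₁).submatrix (P⁻¹ : Perm _) id * B := rfl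
    rw [h3, Matrix.mul_nonsing_inv_cancel_right _ _ hB]

/-- The sign of an isomorphism. -/
def isoSign (B : Matrix (Fin q) (Fin q) ℤ) (P : Perm (Fin m)) : ℤ := B.det * Perm.sign P

theorem isoSign_mul (B C : Matrix (Fin q) (Fin q) ℤ) (P Q : Perm (Fin m)) :
    isoSign (B * C) (Q * P) = isoSign B P * isoSign C Q := by
  simp only [isoSign, Matrix.det_mul, Perm.sign_mul, Units.val_mul]
  ring

theorem IsIso.isoSign_mul_self {e₁ e₂ : Word q N} {h₁ : ncyc (top e₁) = m + 1}
    {h₂ : ncyc (top e₂) = m + 1} {B : Matrix (Fin q) (Fin q) ℤ}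
    {P : Perm (Fin m)} (h : IsIso e₁ h₁ e₂ h₂ B P) : isoSign B P * isoSign B P = 1 :=
  Int.isUnit_mul_self (h.det.mul (Units.isUnit _))

/-! ### The isomorphism given by a slide -/

section Slide

variable {n : ℕ} {e e' : Word q (n + 1)} {x y : Fin q × Bool}

theorem Slide.ncyc_eq (h : Slide e e' x y) (hlt : x.1 < y.1) : ncyc (top e') = ncyc (top e) := by
  rw [← ncyc_del h.src.top_ne, ← ncyc_del h.tgt.top_ne]
  exact congrArg ncyc (congrFun (h.face_eq hlt) (Fin.last q)).symm

/-- The matrix of a slide. -/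
def slideMatrix (x y : Fin q × Bool) : Matrix (Fin q) (Fin q) ℤ :=
  Matrix.transvection y.1 x.1 (wt x.2 * wt y.2)

/-- The permutation of the punctures under a slide. -/
def Slide.perm (h : Slide e e' x y) (he : ncyc (top e) = m + 1) (he' : ncyc (top e') = m + 1) :
    Perm (Fin m) :=
  (punctPerm (e' y).succ (top e') (Fin.succ_ne_zero _) h.tgt.top_ne he')⁻¹ *
    punctPerm (e x).succ (top e) (Fin.succ_ne_zero _) h.src.top_ne he

theorem Slide.order_congr (h : Slide e e' x y) {l l' : Fin q × Bool} (hl : l ≠ y) (hl' : l' ≠ y) :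
    order (e' l) (e' l') = order (e l) (e l') := by
  obtain ⟨r, hr⟩ := h.rem
  rw [(hr l hl).1, (hr l hl).2, (hr l' hl').1, (hr l' hl').2]
  apply ParallelSlit.order_congr <;> simp only [← Fin.lt_def, Fin.succAbove_lt_succAbove_iff]

theorem Above.order_eq {z w l : Fin q × Bool} (h : Above e z w) (hz : l ≠ z) (hw : l ≠ w) :
    order (e z) (e l) = order (e w) (e l) := by
  have h1 : (e w : ℕ) = e z + 1 := by simpa [Fin.ext_iff] using h.eq
  have h2 : (e l : ℕ) ≠ e z := fun h' => hz (e.injective (Fin.ext h'))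
  have h3 : (e l : ℕ) ≠ e w := fun h' => hw (e.injective (Fin.ext h'))
  apply ParallelSlit.order_congr <;> omega

theorem Above.order_eq_one {z w : Fin q × Bool} (h : Above e z w) : order (e z) (e w) = 1 := by
  have h1 : (e w : ℕ) = e z + 1 := by simpa [Fin.ext_iff] using h.eq
  exact ParallelSlit.order_eq_one (by omega)

theorem Slide.inter_of_ne (h : Slide e e' x y) {i j : Fin q} (hi : i ≠ y.1) (hj : j ≠ y.1) :
    inter e' i j = inter e i j := by
  unfold inter endInter
  refine Finset.sum_congr rfl fun a _ => Finset.sum_congr rfl fun b _ => ?_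
  rw [h.order_congr]
  · rintro rfl; exact hi rfl
  · rintro rfl; exact hj rfl

/-- The end `y` jumps from the neighbourhood of `x` to that of `opp x`. The change of its position
relative to any other end is the contribution of the curve of `x`, with the sign determined by the
two ends. -/
theorem Slide.inter_left (h : Slide e e' x y) {j : Fin q} (hj : j ≠ y.1) :
    inter e y.1 j = inter e' y.1 j + wt x.2 * wt y.2 * inter e' x.1 j := by
  have hxy := h.src.fst_ne
  have hox : opp x ≠ y := by rintro rfl; exact hxy rfl
  have hx := h.src.ne
  -- Against the chord of `x` itself, `y` is next to one of the ends, so the order of these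
  -- neighbours enters explicitly.
  by_cases hjx : j = x.1
  · subst hjx
    rw [inter_self, inter_eq, inter_eq]
    simp only [endInter]
    have h1 := h.src.order_eq_one
    have h2 := h.tgt.order_eq_one
    have h3 := h.src.order_eq (opp_ne x) hox
    have h4 := h.tgt.order_eq (l := x) hx (opp_ne x).symm
    rw [h.order_congr (opp_ne y) hx, h.order_congr (opp_ne y) hox, h2, h4,
      h.order_congr hox hx, ← h3, order_swap (e x) (e y), h1, order_swap (e x) (e (opp x))]
    simp only [opp, wt_not]
    ring
  · rw [show j = (j, true).1 from rfl, inter_eq, inter_eq, inter_eq]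
    simp only [endInter]
    have key : ∀ l : Fin q × Bool, l.1 = j → order (e y) (e l) = order (e x) (e l) ∧
        order (e' y) (e' l) = order (e (opp x)) (e l) ∧
        order (e' (opp y)) (e' l) = order (e (opp y)) (e l) ∧
        order (e' x) (e' l) = order (e x) (e l) ∧
        order (e' (opp x)) (e' l) = order (e (opp x)) (e l) := by
      rintro l rfl
      have hly : l ≠ y := by rintro rfl; exact hj rfl
      have hlx : l ≠ x := by rintro rfl; exact hjx rfl
      have hlox : l ≠ opp x := by rintro rfl; exact hjx rfl
      refine ⟨(h.src.order_eq hlx hly).symm, ?_, h.order_congr (opp_ne y) hly,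
        h.order_congr hx hly, h.order_congr hox hly⟩
      rw [h.tgt.order_eq hly hlox, h.order_congr hox hly]
    obtain ⟨h1, h2, h3, h4, h5⟩ := key (j, true) rfl
    obtain ⟨h1', h2', h3', h4', h5'⟩ := key (opp (j, true)) rfl
    rw [h1, h2, h3, h4, h5, h1', h2', h3', h4', h5']
    simp only [opp, wt_not]
    have hw := wt_mul_self x.2
    linear_combination (- wt y.2 * wt (j, true).2 * order (e x) (e (j, true)) +
      wt y.2 * wt (j, true).2 * order (e (x.1, !x.2)) (e (j, true)) +
      wt y.2 * wt (j, true).2 * order (e x) (e (j, !true)) -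
      wt y.2 * wt (j, true).2 * order (e (x.1, !x.2)) (e (j, !true))) * hw

theorem Slide.inter_eq (h : Slide e e' x y) :
    slideMatrix x y * inter e' * (slideMatrix x y).transpose = inter e := by
  have hxy := h.src.fst_ne
  have ht : (slideMatrix x y).transpose = Matrix.transvection x.1 y.1 (wt x.2 * wt y.2) := by
    simp [slideMatrix, Matrix.transvection]
  rw [ht]
  unfold slideMatrix
  ext i j
  by_cases hj : j = y.1
  · subst hj
    rw [Matrix.mul_transvection_apply_same]
    by_cases hi : i = y.1
    · subst hi
      rw [Matrix.transvection_mul_apply_same, Matrix.transvection_mul_apply_same, inter_self,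
        inter_self, inter_self, inter_swap e' x.1 y.1]
      ring
    · rw [Matrix.transvection_mul_apply_of_ne _ _ _ _ hi,
        Matrix.transvection_mul_apply_of_ne _ _ _ _ hi, inter_swap e y.1 i, h.inter_left hi,
        inter_swap e' y.1 i, inter_swap e' x.1 i]
      ring
  · rw [Matrix.mul_transvection_apply_of_ne _ _ _ _ hj]
    by_cases hi : i = y.1
    · subst hi
      rw [Matrix.transvection_mul_apply_same, h.inter_left hj]
    · rw [Matrix.transvection_mul_apply_of_ne _ _ _ _ hi, h.inter_of_ne hi hj]

/-- Both sides describe the cycles of the common face. -/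
theorem Slide.sameCycle_iff (h : Slide e e' x y) (hlt : x.1 < y.1) (he : ncyc (top e) = m + 1)
    (he' : ncyc (top e') = m + 1) (a : Fin m) (r : Fin (n + 1)) :
    (top e).SameCycle (enum (top e) he a) ((e x).succ.succAbove r) ↔
      (top e').SameCycle (enum (top e') he' (h.perm he he' a)) ((e' y).succ.succAbove r) := by
  have hτ : del (e x).succ (top e) = del (e' y).succ (top e') :=
    congrFun (h.face_eq hlt) (Fin.last q)
  have h1 := (ncyc_del h.src.top_ne).trans he
  have h2 := (ncyc_del h.tgt.top_ne).trans he'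
  rw [sameCycle_succAbove_iff (Fin.succ_ne_zero _) h.src.top_ne he h1,
    sameCycle_succAbove_iff (Fin.succ_ne_zero _) h.tgt.top_ne he' h2, enum_congr hτ h1 h2, hτ]
  simp [Slide.perm]

/-- The remaining rows correspond to each other through the common face. The deleted row lies below
`y` in `e` and below `opp x` in `e'`. It is the image under the top permutation of the row below
`opp x` in `e`, and of the row below `opp y` in `e'`, hence lies in the same cycle as that row. -/
theorem Slide.isIso (h : Slide e e' x y) (hlt : x.1 < y.1) (he : ncyc (top e) = m + 1)
    (he' : ncyc (top e') = m + 1) :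
    IsIso e he e' he' (slideMatrix x y) (h.perm he he') := by
  have hxy := h.src.fst_ne
  have hox : opp x ≠ y := by rintro rfl; exact hxy rfl
  have hoy : opp y ≠ opp x := fun h1 => hxy (congrArg Prod.fst h1 : (opp y).1 = (opp x).1).symm
  refine ⟨?_, h.inter_eq, ?_⟩
  · rw [slideMatrix, Matrix.det_transvection_of_ne _ _ hxy.symm]
    exact isUnit_one
  · obtain ⟨r, hr⟩ := h.rem
    have htgt : (e' (opp x) : ℕ) = e' y + 1 := by simpa [Fin.ext_iff] using h.tgt.eq
    have hrow : ∀ l ≠ y, (e l).castSucc = (e x).succ.succAbove (r l).castSucc := by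
      intro l hl
      rw [← h.src.eq, Fin.castSucc_succAbove_castSucc, (hr l hl).1]
    have hrow' : ∀ l ≠ y, l ≠ opp x →
        (e' l).castSucc = (e' y).succ.succAbove (r l).castSucc := by
      intro l hl hlx
      have h2 := (hr l hl).2
      have h3 : (e' l : ℕ) ≠ e' (opp x) := fun h3 => hlx (e'.injective (Fin.ext h3))
      have h4 := congrArg Fin.val h2
      rw [val_succAbove] at h4
      ext
      rw [val_succAbove, Fin.val_castSucc, Fin.val_castSucc, Fin.val_succ]
      split_ifs at h4 ⊢ <;> omega
    have hrow'y : (e' y).castSucc = (e' y).succ.succAbove (r (opp x)).castSucc := by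
      have h4 := congrArg Fin.val (hr _ hox).2
      rw [val_succAbove] at h4
      ext
      rw [val_succAbove, Fin.val_castSucc, Fin.val_castSucc, Fin.val_succ]
      split_ifs at h4 ⊢ <;> omega
    ext a i
    set s := enum (top e) he a
    set s' := enum (top e') he' (h.perm he he' a) with hs'
    have hcyc := h.sameCycle_iff hlt he he' a
    have i1 : ∀ l ≠ y, l ≠ opp x →
        ind (top e') s' (e' l).castSucc = ind (top e) s (e l).castSucc := by
      intro l hl hlx
      rw [hrow l hl, hrow' l hl hlx]
      exact ind_congr (hcyc _).symm
    have i2 : ind (top e') s' (e' y).castSucc = ind (top e) s (e (opp x)).castSucc := by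
      rw [hrow _ hox, hrow'y]
      exact ind_congr (hcyc _).symm
    have i3 : ind (top e) s (e y).castSucc = ind (top e) s (e (opp x)).castSucc := by
      apply ind_congr
      rw [h.src.eq, ← Perm.sameCycle_apply_right (y := (e (opp x)).castSucc), top_castSucc, opp_opp]
    have i4 : ind (top e') s' (e' (opp x)).castSucc = ind (top e) s (e (opp y)).castSucc := by
      rw [← i1 _ (opp_ne y) hoy]
      apply ind_congr
      rw [h.tgt.eq, ← Perm.sameCycle_apply_right (y := (e' (opp y)).castSucc), top_castSucc,
        opp_opp]
    rw [Matrix.submatrix_apply, id, slideMatrix]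
    have lk : loops e' he' (h.perm he he' a) y.1 = loops e he a y.1 := by
      rw [loops_eq, loops_eq, ← hs', i2, i1 _ (opp_ne y) hoy, i3]
    by_cases hi : i = x.1
    · subst hi
      rw [Matrix.mul_transvection_apply_same, loops_eq, loops_eq e he a y, loops_eq, ← hs', i4,
        i1 x h.src.ne (opp_ne x).symm, i3]
      linear_combination (wt x.2 * (ind (top e) s (e (opp x)).castSucc -
        ind (top e) s (e (opp y)).castSucc)) * wt_mul_self y.2
    · rw [Matrix.mul_transvection_apply_of_ne _ _ _ _ hi]
      by_cases hiy : i = y.1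
      · subst hiy
        exact lk.symm
      · have h5 : ∀ l : Fin q × Bool, l.1 = i → l ≠ y ∧ l ≠ opp x := by
          rintro l rfl
          exact ⟨by rintro rfl; exact hiy rfl, by rintro rfl; exact hi rfl⟩
        rw [show i = (i, true).1 from rfl, loops_eq, loops_eq, ← hs',
          i1 _ (h5 (i, true) rfl).1 (h5 (i, true) rfl).2,
          i1 _ (h5 (opp (i, true)) rfl).1 (h5 (opp (i, true)) rfl).2]

/-- A transvection has determinant one. What remains is the comparison of the punctures on either
side with those of the common face, as recorded by the sign rule. -/
theorem Slide.isoSign_eq (h : Slide e e' x y) (he : ncyc (top e) = m + 1)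
    (he' : ncyc (top e') = m + 1) {𝒪 : SignRule} (h𝒪 : Compatible 𝒪 m) :
    isoSign (slideMatrix x y) (h.perm he he') =
      𝒪 n (e x).succ (top e) * 𝒪 n (e' y).succ (top e') := by
  rw [isoSign, slideMatrix, Matrix.det_transvection_of_ne _ _ h.src.fst_ne.symm,
    h𝒪 n _ _ (Fin.succ_ne_zero _) h.src.top_ne he, h𝒪 n _ _ (Fin.succ_ne_zero _) h.tgt.top_ne he',
    Slide.perm, Perm.sign_mul, Perm.sign_inv]
  push_cast
  ring

end Slide

/-! ### The isomorphisms given by relabelings -/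

theorem sgn_trans (b e : Word q N) (f : Perm (Fin q × Bool)) :
    sgn b (f.trans e) = Perm.sign f * sgn b e := by
  have h : b.symm.trans (f.trans e) = (b.symm.trans e) * ((b.symm.trans f).trans b) := by
    ext1 r
    simp
  rw [sgn, h, Perm.sign_mul, Perm.sign_symm_trans_trans, sgn]
  push_cast
  ring

/-- The permutation acts alike on both ends of the chords, so its sign occurs squared. -/
theorem sgn_reorder (b e : Word q N) (π : Perm (Fin q)) : sgn b (reorder π e) = sgn b e := by
  rw [reorder, sgn_trans, show Equiv.prodCongr π (Equiv.refl Bool) =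
    Equiv.prodCongrLeft (fun _ => π) from rfl, Perm.sign_prodCongrLeft]
  simp

theorem loops_congr {e e' : Word q N} (h : top e = top e') (he : ncyc (top e) = m + 1)
    (he' : ncyc (top e') = m + 1) (a : Fin m) (i : Fin q) : loops e' he' a i =
      ∑ b : Bool, wt b * ind (top e) (enum (top e) he a) (e' (i, b)).castSucc := by
  unfold loops
  rw [enum_congr h he he', h]

theorem reorder_isIso (π : Perm (Fin q)) (e : Word q N) (he : ncyc (top e) = m + 1)
    (he' : ncyc (top (reorder π e)) = m + 1) :
    IsIso (reorder π e) he' e he (Perm.permMatrix ℤ π) 1 := by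
  refine ⟨?_, ?_, ?_⟩
  · rw [Matrix.det_permutation]
    exact Units.isUnit _
  · rw [Perm.permMatrix, PEquiv.toMatrix_toPEquiv_mul, ← PEquiv.toMatrix_symm,
      ← Equiv.toPEquiv_symm, PEquiv.mul_toMatrix_toPEquiv]
    rfl
  · rw [Perm.permMatrix, PEquiv.mul_toMatrix_toPEquiv]
    ext a i
    rw [Matrix.submatrix_apply, Matrix.submatrix_apply,
      loops_congr (top_reorder π e).symm he he']
    simp only [reorder_apply, apply_symm_apply, id]
    rfl

/-- Exchange the ends of some chords. -/
def flip (c : Fin q → Bool) (e : Word q N) : Word q N :=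
  (Equiv.prodCongrRight fun i => if c i then Equiv.boolNot else 1).trans e

theorem flip_apply (c : Fin q → Bool) (e : Word q N) (i : Fin q) (b : Bool) :
    flip c e (i, b) = e (i, b ^^ c i) := by
  rw [flip, trans_apply, prodCongrRight_apply]
  congr 2
  by_cases h : c i <;> simp [h]

theorem top_flip (c : Fin q → Bool) (e : Word q N) : top (flip c e) = top e := by
  apply top_eq_of_opp
  intro r
  obtain ⟨l, rfl⟩ := (flip c e).surjective r
  obtain ⟨i, b⟩ := l
  rw [symm_apply_apply]
  simp [flip_apply, opp]

theorem slits_flip (c : Fin q → Bool) (e : Word q N) : slits (flip c e) = slits e := by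
  rw [slits_eq_iff]
  rintro ⟨i, b⟩
  rw [flip_apply, symm_apply_apply]

theorem sgn_flip (b e : Word q N) (c : Fin q → Bool) :
    sgn b (flip c e) = (∏ i, wt (c i)) * sgn b e := by
  rw [flip, sgn_trans, Perm.sign_prodCongrRight, Units.coe_prod]
  congr 1
  refine Finset.prod_congr rfl fun i _ => ?_
  cases c i <;> simp [wt]
  decide

theorem inter_flip (c : Fin q → Bool) (e : Word q N) (i j : Fin q) :
    inter (flip c e) i j = wt (c i) * inter e i j * wt (c j) := by
  unfold inter endInter
  simp only [flip_apply, Fintype.sum_bool]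
  cases c i <;> cases c j <;> simp [wt] <;> ring

theorem flip_isIso (c : Fin q → Bool) (e : Word q N) (he : ncyc (top e) = m + 1)
    (he' : ncyc (top (flip c e)) = m + 1) :
    IsIso (flip c e) he' e he (Matrix.diagonal fun i => wt (c i)) 1 := by
  refine ⟨?_, ?_, ?_⟩
  · rw [Matrix.det_diagonal]
    exact IsUnit.of_mul_eq_one (∏ i, wt (c i)) (by
      rw [← Finset.prod_mul_distrib]
      exact Finset.prod_eq_one fun i _ => wt_mul_self _)
  · ext i j
    rw [Matrix.diagonal_transpose, Matrix.mul_diagonal, Matrix.diagonal_mul, inter_flip]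
  · ext a i
    rw [Matrix.mul_diagonal, Matrix.submatrix_apply, loops_congr (top_flip c e).symm he he', loops]
    simp only [flip_apply, Fintype.sum_bool, Perm.one_apply, id]
    cases c i <;> simp [wt]

end

section

/-! ### Normal forms under slides -/

section Lists

variable {ι : Type*}

/-- A slide of a list of ends of chords. -/
def ListSlide (L L' : List (ι × Bool)) : Prop :=
  ∃ A B C D x y, L = A ++ x :: y :: B ∧ L' = C ++ y :: opp x :: D ∧
    A ++ x :: B = C ++ opp x :: D ∧ x.1 ≠ y.1

/-- The equivalence relation generated by slides. -/
abbrev SlideEquiv : List (ι × Bool) → List (ι × Bool) → Prop := Relation.EqvGen ListSlide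

theorem slideEquiv_of_eq {L L' : List (ι × Bool)} (h : L = L') : SlideEquiv L L' := by
  subst h
  exact .refl _

theorem SlideEquiv.context {L L' : List (ι × Bool)} (h : SlideEquiv L L')
    (U W : List (ι × Bool)) : SlideEquiv (U ++ L ++ W) (U ++ L' ++ W) := by
  induction h with
  | rel L L' h =>
    obtain ⟨A, B, C, D, x, y, rfl, rfl, h3, h4⟩ := h
    refine .rel _ _ ⟨U ++ A, B ++ W, U ++ C, D ++ W, x, y, by simp, by simp, ?_, h4⟩
    have := congrArg (fun K => U ++ K ++ W) h3
    simpa using this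
  | refl => exact .refl _
  | symm _ _ _ ih => exact .symm _ _ ih
  | trans _ _ _ _ _ ih₁ ih₂ => exact .trans _ _ _ ih₁ ih₂

theorem slideEquiv_of {A B C D : List (ι × Bool)} {x y : ι × Bool} (h : x.1 ≠ y.1)
    {L L' : List (ι × Bool)} (hL : L = A ++ x :: y :: B) (hL' : L' = C ++ y :: opp x :: D)
    (hK : A ++ x :: B = C ++ opp x :: D) : SlideEquiv L L' :=
  .rel _ _ ⟨A, B, C, D, x, y, hL, hL', hK, h⟩

/-- An end directly above a pair of neighbours slides along this chord to the place directly below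
the pair; thus the pair rises past everything. -/
theorem slideEquiv_pair (d : ι × Bool) (U W : List (ι × Bool)) (hW : ∀ y ∈ W, d.1 ≠ y.1) :
    SlideEquiv (U ++ d :: opp d :: W) (U ++ W ++ [d, opp d]) := by
  induction W generalizing U with
  | nil => exact slideEquiv_of_eq (by simp)
  | cons y W ih =>
    have h1 := ih (U ++ [y]) fun z hz => hW z (by simp [hz])
    have h2 : SlideEquiv (U ++ d :: opp d :: y :: W) (U ++ [y] ++ d :: opp d :: W) :=
      slideEquiv_of (A := U ++ [d]) (B := W) (C := U) (D := opp d :: W) (x := opp d) (y := y)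
        (hW y (by simp)) (by simp) (by simp) (by simp)
    refine (h2.trans _ _ _ h1).trans _ _ _ (slideEquiv_of_eq (by simp))

/-! ### Clearing an interlocking pair of chords and moving it to the bottom -/

section Handle

variable {c d : ι × Bool}

/-- Each end in `X` in turn is directly above `c` and slides along this chord to the place directly
below `opp c`. -/
theorem slideEquiv_handle_first (V X Y Z W : List (ι × Bool)) (hX : ∀ y ∈ X, c.1 ≠ y.1) :
    SlideEquiv (V ++ c :: X ++ d :: Y ++ opp c :: Z ++ opp d :: W)
      (V ++ c :: d :: Y ++ X ++ opp c :: Z ++ opp d :: W) := by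
  induction X generalizing Y with
  | nil => exact slideEquiv_of_eq (by simp)
  | cons y X ih =>
    have h1 := ih (Y ++ [y]) fun z hz => hX z (by simp [hz])
    refine .trans _ _ _ (slideEquiv_of (A := V) (x := c) (y := y)
      (B := X ++ d :: Y ++ opp c :: Z ++ opp d :: W) (C := V ++ c :: X ++ d :: Y)
      (D := Z ++ opp d :: W) (hX y (by simp)) (by simp) rfl (by simp))
      (.trans _ _ _ (slideEquiv_of_eq (by simp)) (.trans _ _ _ h1 (slideEquiv_of_eq (by simp))))

/-- Similarly, the ends in `Y` slide along the chord of `d` to the place directly below `opp d`. -/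
theorem slideEquiv_handle_second (V Y Z W : List (ι × Bool)) (hY : ∀ y ∈ Y, d.1 ≠ y.1) :
    SlideEquiv (V ++ c :: d :: Y ++ opp c :: Z ++ opp d :: W)
      (V ++ c :: d :: opp c :: Z ++ Y ++ opp d :: W) := by
  induction Y generalizing Z with
  | nil => exact slideEquiv_of_eq (by simp)
  | cons y Y ih =>
    have h1 := ih (Z ++ [y]) fun z hz => hY z (by simp [hz])
    refine .trans _ _ _ (slideEquiv_of (A := V ++ [c]) (x := d) (y := y)
      (B := Y ++ opp c :: Z ++ opp d :: W) (C := V ++ c :: d :: Y ++ opp c :: Z)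
      (D := W) (hY y (by simp)) (by simp) rfl (by simp))
      (.trans _ _ _ (slideEquiv_of_eq (by simp)) (.trans _ _ _ h1 (slideEquiv_of_eq (by simp))))

/-- The ends in `Z` are directly above `opp c` in turn, and slide to the place below `c`, outside
the handle. -/
theorem slideEquiv_handle_third (V Z W : List (ι × Bool)) (hZ : ∀ y ∈ Z, c.1 ≠ y.1) :
    SlideEquiv (V ++ c :: d :: opp c :: Z ++ opp d :: W)
      (V ++ Z ++ c :: d :: opp c :: opp d :: W) := by
  induction Z generalizing V with
  | nil => exact slideEquiv_of_eq (by simp)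
  | cons z Z ih =>
    have h1 := ih (V ++ [z]) fun y hy => hZ y (by simp [hy])
    refine .trans _ _ _ (slideEquiv_of (A := V ++ [c, d]) (x := opp c) (y := z)
      (B := Z ++ opp d :: W) (C := V)
      (D := d :: opp c :: Z ++ opp d :: W) (hZ z (by simp)) (by simp) rfl (by simp))
      (.trans _ _ _ (slideEquiv_of_eq (by simp)) (.trans _ _ _ h1 (slideEquiv_of_eq (by simp))))

/-- Four slides, starting at `opp d`, `c`, `d` and `opp c`, carry an end around the boundary of the
cleared handle from the place above it to the place below it. Inverted, they move the handle down
past `V`. -/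
theorem slideEquiv_handle_fourth (V W : List (ι × Bool)) (hc : ∀ y ∈ V, c.1 ≠ y.1)
    (hd : ∀ y ∈ V, d.1 ≠ y.1) :
    SlideEquiv (V ++ c :: d :: opp c :: opp d :: W) (c :: d :: opp c :: opp d :: (V ++ W)) := by
  induction V using List.reverseRecOn generalizing W with
  | nil => exact .refl _
  | append_singleton V z ih =>
    have h1 := ih (z :: W) (fun y hy => hc y (by simp [hy])) fun y hy => hd y (by simp [hy])
    have hcz := hc z (by simp)
    have hdz := hd z (by simp)
    have s1 : SlideEquiv (V ++ [c, d, opp c, z, opp d] ++ W)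
        (V ++ [z, c, d, opp c, opp d] ++ W) :=
      slideEquiv_of (A := V ++ [c, d]) (x := opp c) (y := z) (B := opp d :: W) (C := V)
        (D := d :: opp c :: opp d :: W) hcz (by simp) (by simp) (by simp)
    have s2 : SlideEquiv (V ++ [c, d, z, opp c, opp d] ++ W)
        (V ++ [c, d, opp c, z, opp d] ++ W) :=
      slideEquiv_of (A := V ++ [c]) (x := d) (y := z) (B := opp c :: opp d :: W)
        (C := V ++ [c, d, opp c]) (D := W) hdz (by simp) (by simp) (by simp)
    have s3 : SlideEquiv (V ++ [c, z, d, opp c, opp d] ++ W)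
        (V ++ [c, d, z, opp c, opp d] ++ W) :=
      slideEquiv_of (A := V) (x := c) (y := z) (B := d :: opp c :: opp d :: W)
        (C := V ++ [c, d]) (D := opp d :: W) hcz (by simp) (by simp) (by simp)
    have s4 : SlideEquiv (V ++ [c, d, opp c, opp d, z] ++ W)
        (V ++ [c, z, d, opp c, opp d] ++ W) :=
      slideEquiv_of (A := V ++ [c, d, opp c]) (x := opp d) (y := z) (B := W)
        (C := V ++ [c]) (D := opp c :: opp d :: W) hdz (by simp) (by simp) (by simp)
    have s := (((s4.trans _ _ _ s3).trans _ _ _ s2).trans _ _ _ s1).symm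
    exact .trans _ _ _ (slideEquiv_of_eq (by simp)) (.trans _ _ _ s (.trans _ _ _ (slideEquiv_of_eq (by simp))
      (.trans _ _ _ h1 (slideEquiv_of_eq (by simp)))))

theorem slideEquiv_handle (V X Y Z W : List (ι × Bool))
    (hc : ∀ y ∈ V ++ X ++ Y ++ Z ++ W, c.1 ≠ y.1) (hd : ∀ y ∈ V ++ X ++ Y ++ Z ++ W, d.1 ≠ y.1) :
    SlideEquiv (V ++ c :: X ++ d :: Y ++ opp c :: Z ++ opp d :: W)
      ([c, d, opp c, opp d] ++ (V ++ (Z ++ (Y ++ X)) ++ W)) := by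
  simp only [List.mem_append] at hc hd
  have s1 := slideEquiv_handle_first (c := c) (d := d) V X Y Z W fun y hy => hc y (by tauto)
  have s2 := slideEquiv_handle_second (c := c) (d := d) V (Y ++ X) Z W fun y hy => hd y (by
    rw [List.mem_append] at hy; tauto)
  have s3 := slideEquiv_handle_third (c := c) (d := d) V (Z ++ (Y ++ X)) W fun y hy => hc y (by
    simp only [List.mem_append] at hy; tauto)
  have s4 := slideEquiv_handle_fourth (c := c) (d := d) (V ++ (Z ++ (Y ++ X))) W
    (fun y hy => hc y (by simp only [List.mem_append] at hy; tauto))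
    (fun y hy => hd y (by simp only [List.mem_append] at hy; tauto))
  refine .trans _ _ _ s1 (.trans _ _ _ (slideEquiv_of_eq (by simp)) (.trans _ _ _ s2
    (.trans _ _ _ (slideEquiv_of_eq (by simp)) (.trans _ _ _ s3 (.trans _ _ _ s4 (slideEquiv_of_eq (by simp)))))))

end Handle

/-- Every end of a chord occurs at most once, and together with the other end. -/
structure Complete (L : List (ι × Bool)) : Prop where
  nodup : L.Nodup
  opp_mem : ∀ x ∈ L, opp x ∈ L

theorem Complete.of_perm {L R : List (ι × Bool)} {d : ι × Bool} (h : Complete L)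
    (hp : L.Perm (d :: opp d :: R)) : Complete R ∧ ∀ y ∈ R, d.1 ≠ y.1 := by
  have hn := hp.nodup_iff.1 h.nodup
  simp only [List.nodup_cons, List.mem_cons, not_or] at hn
  have hne : ∀ y ∈ R, y ≠ d ∧ y ≠ opp d := fun y hy =>
    ⟨by rintro rfl; exact hn.1.2 hy, by rintro rfl; exact hn.2.1 hy⟩
  refine ⟨⟨hn.2.2, fun y hy => ?_⟩, fun y hy hdy => ?_⟩
  · have h1 := hp.mem_iff.1 (h.opp_mem y (hp.mem_iff.2 (by simp [hy])))
    simp only [List.mem_cons] at h1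
    rcases h1 with h1 | h1 | h1
    · exact absurd (by rw [← h1, opp_opp]) (hne y hy).2
    · exact absurd (by rw [← opp_opp y, h1, opp_opp]) (hne y hy).1
    · exact h1
  · rcases eq_or_eq_opp hdy.symm with h1 | h1
    · exact (hne y hy).1 h1
    · exact (hne y hy).2 h1

/-- Let `d` be the first end between `c` and `opp c`. If the partner of `d` lies outside, the two
chords interlock; otherwise `d` and its partner bound a shorter segment. -/
theorem exists_pair_or_handle_of_segment {L : List (ι × Bool)} (hL : Complete L) (n : ℕ) :
    ∀ (U : List (ι × Bool)) (c : ι × Bool) (X W : List (ι × Bool)), X.length = n →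
      L = U ++ c :: X ++ opp c :: W →
      (∃ U d W, L = U ++ d :: opp d :: W) ∨
      ∃ V c X d Y Z W, L = V ++ c :: X ++ d :: Y ++ opp c :: Z ++ opp d :: W := by
  induction n using Nat.strong_induction_on with
  | _ n ih =>
    intro U c X W hX h
    rcases X with _ | ⟨d, X⟩
    · exact Or.inl ⟨U, c, W, by simpa using h⟩
    · have hp : L.Perm (c :: opp c :: (d :: U ++ X ++ W)) := by
        rw [h]
        classical
        rw [List.perm_iff_count]
        intro a
        simp only [List.count_append, List.count_cons]
        omega
      have hd : d ∈ L := by simp [h]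
      obtain ⟨h1, h2⟩ := hL.of_perm hp
      have h3 := h1.opp_mem d (by simp)
      simp only [List.cons_append, List.mem_cons, List.mem_append, opp_ne, false_or] at h3
      rcases h3 with (h3 | h3) | h3
      · obtain ⟨U₁, U₂, rfl⟩ := List.append_of_mem h3
        exact Or.inr ⟨U₁, opp d, U₂, c, [], X, W, by simp [h]⟩
      · obtain ⟨P, Q, rfl⟩ := List.append_of_mem h3
        refine ih P.length ?_ (U ++ [c]) d P (Q ++ opp c :: W) rfl (by simp [h])
        simp only [List.length_cons, List.length_append] at hX
        omega
      · obtain ⟨W₁, W₂, rfl⟩ := List.append_of_mem h3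
        exact Or.inr ⟨U, c, [], d, X, W₁, W₂, by simp [h]⟩

theorem exists_pair_or_handle {L : List (ι × Bool)} (hL : Complete L) (h0 : L ≠ []) :
    (∃ U d W, L = U ++ d :: opp d :: W) ∨
      ∃ V c X d Y Z W, L = V ++ c :: X ++ d :: Y ++ opp c :: Z ++ opp d :: W := by
  obtain ⟨c, L, rfl⟩ := List.exists_cons_of_ne_nil h0
  have h1 := hL.opp_mem c (by simp)
  simp only [List.mem_cons, opp_ne, false_or] at h1
  obtain ⟨X, W, rfl⟩ := List.append_of_mem h1
  exact exists_pair_or_handle_of_segment hL _ [] c X W rfl (by simp)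

/-- The list of `g` interlocking pairs of chords followed by `m` chords of neighbours. -/
def normalList (g m : ℕ) (c : ℕ → ι × Bool) : List (ι × Bool) :=
  (List.range g).flatMap
    (fun k => [c (2 * k), c (2 * k + 1), opp (c (2 * k)), opp (c (2 * k + 1))]) ++
  (List.range m).flatMap fun s => [c (2 * g + s), opp (c (2 * g + s))]

theorem normalList_congr {g m : ℕ} {c c' : ℕ → ι × Bool} (h : ∀ i < 2 * g + m, c i = c' i) :
    normalList g m c = normalList g m c' := by
  unfold normalList
  congr 1
  · refine List.flatMap_congr fun k hk => ?_
    rw [List.mem_range] at hk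
    rw [h _ (by omega), h _ (by omega)]
  · refine List.flatMap_congr fun k hk => ?_
    rw [List.mem_range] at hk
    rw [h _ (by omega)]

/-- This is the combinatorial classification of surfaces: a pair of neighbours is moved to the end
of the list and an interlocking pair to the front, and induction applies to the shorter list that is
left. -/
theorem exists_slideEquiv_normalList [Nonempty ι] (n : ℕ) :
    ∀ L : List (ι × Bool), L.length = n → Complete L →
      ∃ g m c, SlideEquiv L (normalList g m c) := by
  induction n using Nat.strong_induction_on with
  | _ n ih =>
    intro L hn hL
    by_cases h0 : L = []
    · subst h0
      exact ⟨0, 0, fun _ => (Classical.arbitrary ι, true), .refl _⟩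
    rcases exists_pair_or_handle hL h0 with ⟨U, d, W, rfl⟩ | ⟨V, c, X, d, Y, Z, W, rfl⟩
    · have hp : (U ++ d :: opp d :: W).Perm (d :: opp d :: (U ++ W)) := by
        classical
        rw [List.perm_iff_count]
        intro a
        simp only [List.count_append, List.count_cons]
        omega
      obtain ⟨h1, h2⟩ := hL.of_perm hp
      obtain ⟨g, m, k, h3⟩ := ih _ (by rw [← hn]; simp) (U ++ W) rfl h1
      -- The pair at the end of the list gets the first unused number.
      refine ⟨g, m + 1, Function.update k (2 * g + m) d, ?_⟩
      refine .trans _ _ _ (slideEquiv_pair d U W fun y hy => h2 y (by simp [hy])) ?_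
      have h4 := h3.context [] [d, opp d]
      refine .trans _ _ _ (slideEquiv_of_eq (by simp)) (.trans _ _ _ h4 (slideEquiv_of_eq ?_))
      rw [normalList_congr (c' := Function.update k (2 * g + m) d)]
      · simp [normalList, List.range_succ]
      · intro i hi
        rw [Function.update_of_ne (by omega)]
    · have hp : (V ++ c :: X ++ d :: Y ++ opp c :: Z ++ opp d :: W).Perm
          (c :: opp c :: d :: opp d :: (V ++ (Z ++ (Y ++ X)) ++ W)) := by
        classical
        rw [List.perm_iff_count]
        intro a
        simp only [List.count_append, List.count_cons]
        omega
      obtain ⟨h1, h2⟩ := hL.of_perm hp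
      obtain ⟨h1', h2'⟩ := h1.of_perm (.refl _)
      obtain ⟨g, m, k, h3⟩ := ih _ (by
        rw [← hn, hp.length_eq]
        simp only [List.length_cons]
        omega) _ rfl h1'
      -- The handle at the front takes the numbers `0` and `1`, and the other numbers shift by two.
      refine ⟨g + 1, m, fun i => if i = 0 then c else if i = 1 then d else k (i - 2), ?_⟩
      refine .trans _ _ _ (slideEquiv_handle V X Y Z W ?_ ?_) ?_
      · intro y hy
        apply h2
        simp only [List.mem_append, List.mem_cons] at hy ⊢
        tauto
      · intro y hy
        apply h2'
        simp only [List.mem_append] at hy ⊢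
        tauto
      have h4 := h3.context [c, d, opp c, opp d] []
      refine .trans _ _ _ (slideEquiv_of_eq (by simp)) (.trans _ _ _ h4 (slideEquiv_of_eq ?_))
      rw [normalList, normalList, List.range_succ_eq_map, List.flatMap_cons, List.flatMap_map]
      have e1 : ∀ i : ℕ, 2 * i.succ = 2 * i + 2 := fun i => by omega
      simp only [e1]
      simp only [List.append_nil, List.cons_append, List.nil_append]
      congr 1
      congr 1
      congr 1
      congr 1
      congr 1
      refine List.flatMap_congr fun s _ => ?_
      rw [if_neg (by omega), if_neg (by omega), show 2 * g + 2 + s - 2 = 2 * g + s by omega]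

end Lists

end

section

/-! ### Connectivity -/

variable {q n : ℕ}

def wordList {N : ℕ} (e : Word q N) : List (Fin q × Bool) := List.ofFn e.symm

theorem wordList_injective {N : ℕ} : Function.Injective (wordList (q := q) (N := N)) := by
  intro e e' h
  have := List.ofFn_injective h
  rw [DFunLike.coe_fn_eq] at this
  exact Equiv.symm_bijective.injective this

theorem nodup_wordList {N : ℕ} (e : Word q N) : (wordList e).Nodup :=
  List.nodup_ofFn.2 e.symm.injective

theorem mem_wordList {N : ℕ} (e : Word q N) (l : Fin q × Bool) : l ∈ wordList e :=
  (List.mem_ofFn' _ _).2 ⟨e l, by simp⟩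

theorem idxOf_wordList {N : ℕ} (e : Word q N) (l : Fin q × Bool) :
    (wordList e).idxOf l = e l := by
  have h : (wordList e)[(e l : ℕ)]'(by simp [wordList]) = l := by simp [wordList]
  conv_lhs => rw [← h]
  exact (nodup_wordList e).idxOf_getElem _ _

theorem exists_wordList_eq {N : ℕ} {L : List (Fin q × Bool)} {e : Word q N}
    (h : (wordList e).Perm L) : ∃ e' : Word q N, wordList e' = L := by
  have hlen : L.length = N := by rw [← h.length_eq]; simp [wordList]
  subst hlen
  refine ⟨(((h.nodup_iff.1 (nodup_wordList e)).getEquivOfForallMemList L fun l =>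
    h.mem_iff.1 (mem_wordList e l))).symm, ?_⟩
  rw [wordList, symm_symm]
  exact List.ofFn_get L

theorem complete_wordList {N : ℕ} (e : Word q N) : Complete (wordList e) :=
  ⟨nodup_wordList e, fun _ _ => mem_wordList e _⟩

theorem ListSlide.perm {ι : Type*} {L L' : List (ι × Bool)} (h : ListSlide L L') : L.Perm L' := by
  obtain ⟨A, B, C, D, x, y, rfl, rfl, h, -⟩ := h
  have h1 : (A ++ x :: y :: B).Perm (y :: (A ++ x :: B)) := by
    rw [show A ++ x :: y :: B = (A ++ [x]) ++ y :: B by simp,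
      show A ++ x :: B = (A ++ [x]) ++ B by simp]
    exact List.perm_middle
  rw [h] at h1
  exact h1.trans List.perm_middle.symm

theorem SlideEquiv.perm {ι : Type*} {L L' : List (ι × Bool)} (h : SlideEquiv L L') :
    L.Perm L' := by
  induction h with
  | rel _ _ h => exact h.perm
  | refl => exact .refl _
  | symm _ _ _ ih => exact ih.symm
  | trans _ _ _ _ _ ih₁ ih₂ => exact ih₁.trans ih₂

theorem idxOf_append_cons {α : Type*} [BEq α] [LawfulBEq α] {A B : List α} {y l : α}
    (hl : l ≠ y) :
    (A ++ y :: B).idxOf l =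
      if (A ++ B).idxOf l < A.length then (A ++ B).idxOf l else (A ++ B).idxOf l + 1 := by
  by_cases h : l ∈ A
  · rw [List.idxOf_append_of_mem h, List.idxOf_append_of_mem h,
      if_pos (List.idxOf_lt_length_iff.2 h)]
  · rw [List.idxOf_append_of_notMem h, List.idxOf_append_of_notMem h, if_neg (by omega),
      List.idxOf_cons_ne _ hl.symm]
    omega

theorem slide_of_wordList {e e' : Word q (n + 1)} {A B C D : List (Fin q × Bool)}
    {x y : Fin q × Bool} (he : wordList e = A ++ x :: y :: B)
    (he' : wordList e' = C ++ y :: opp x :: D) (hK : A ++ x :: B = C ++ opp x :: D)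
    (hxy : x.1 ≠ y.1) : Slide e e' x y := by
  have hn := nodup_wordList e
  have hn' := nodup_wordList e'
  have hlen : (wordList e).length = n + 1 := by simp [wordList]
  rw [he] at hn hlen
  rw [he'] at hn'
  have hA : (A ++ x :: y :: B) = (A ++ [x]) ++ y :: B := by simp
  have hA' : A ++ x :: B = (A ++ [x]) ++ B := by simp
  simp only [List.nodup_append, List.nodup_cons, List.mem_cons] at hn hn'
  have hxA : x ∉ A := fun h => hn.2.2 x h x (by simp) rfl
  have hyA : y ∉ A := fun h => hn.2.2 y h y (by simp) rfl
  have hyC : y ∉ C := fun h => hn'.2.2 y h y (by simp) rfl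
  have hoC : opp x ∉ C := fun h => hn'.2.2 _ h (opp x) (by simp) rfl
  have hne : x ≠ y := by rintro rfl; exact hxy rfl
  have hne' : opp x ≠ y := by rintro rfl; exact hxy rfl
  have ex : (e x : ℕ) = A.length := by
    rw [← idxOf_wordList, he, List.idxOf_append_of_notMem hxA, List.idxOf_cons_self, add_zero]
  have ey : (e y : ℕ) = A.length + 1 := by
    rw [← idxOf_wordList, he, List.idxOf_append_of_notMem hyA, List.idxOf_cons_ne _ hne,
      List.idxOf_cons_self]
  have ey' : (e' y : ℕ) = C.length := by
    rw [← idxOf_wordList, he', List.idxOf_append_of_notMem hyC, List.idxOf_cons_self, add_zero]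
  have eo' : (e' (opp x) : ℕ) = C.length + 1 := by
    rw [← idxOf_wordList, he', List.idxOf_append_of_notMem hoC, List.idxOf_cons_ne _ hne'.symm,
      List.idxOf_cons_self]
  have hKlen : (A ++ x :: B).length = n := by
    simp only [List.length_append, List.length_cons] at hlen ⊢
    omega
  have hmem : ∀ l ≠ y, (A ++ x :: B).idxOf l < n := by
    intro l hl
    have h1 := mem_wordList e l
    rw [he] at h1
    rw [← hKlen, List.idxOf_lt_length_iff]
    simp only [List.mem_append, List.mem_cons] at h1 ⊢
    tauto
  have : Nonempty (Fin n) := ⟨⟨_, hmem x hne⟩⟩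
  -- The remainder is the position in the list without `y`; the default value is met only at `y`
  -- itself.
  refine ⟨⟨hxy, Fin.ext (by simp [ex, ey])⟩, ⟨hxy.symm, Fin.ext (by simp [ey', eo'])⟩,
    fun l => if h : (A ++ x :: B).idxOf l < n then ⟨_, h⟩ else Classical.arbitrary _, ?_⟩
  intro l hl
  simp only [dif_pos (hmem l hl)]
  refine ⟨Fin.ext ?_, Fin.ext ?_⟩
  · have h1 := idxOf_append_cons (A := A ++ [x]) (B := B) hl
    rw [← hA, ← hA', List.length_append, List.length_singleton] at h1
    rw [val_succAbove, ey, ← idxOf_wordList, he, h1]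
  · rw [val_succAbove, ey', ← idxOf_wordList, he', idxOf_append_cons hl, ← hK]

/-- The equivalence relation on words generated by slides, reorderings and flips. -/
inductive Linked : Word q (n + 1) → Word q (n + 1) → Prop
  | slide {e e' x y} (h : Slide e e' x y) (hlt : x.1 < y.1) : Linked e e'
  | reorder (π : Perm (Fin q)) (e) : Linked e (reorder π e)
  | flip (c : Fin q → Bool) (e) : Linked e (flip c e)
  | symm {e e'} : Linked e e' → Linked e' e
  | trans {e e' e''} : Linked e e' → Linked e' e'' → Linked e e''

theorem Linked.refl (e : Word q (n + 1)) : Linked e e := by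
  have := Linked.reorder 1 e
  exact this.trans this.symm

/-- The generators of `Linked` are slides along the earlier chord; the other case is reduced to them
by interchanging the numbers of the two chords. -/
theorem Slide.linked {e e' : Word q (n + 1)} {x y : Fin q × Bool} (h : Slide e e' x y) :
    Linked e e' := by
  rcases h.src.fst_ne.lt_or_gt with hlt | hlt
  · exact .slide h hlt
  · set π : Perm (Fin q) := swap x.1 y.1
    have h1 : Slide (ParallelSlit.reorder π e) (ParallelSlit.reorder π e') (y.1, x.2) (x.1, y.2) := by
      apply Slide.relabel (f := Equiv.prodCongr π (Equiv.refl Bool))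
      · intro l
        rfl
      · simpa [π] using h
    exact (Linked.reorder π e).trans ((Linked.slide h1 hlt).trans (Linked.reorder π e').symm)

theorem SlideEquiv.linked {L L' : List (Fin q × Bool)} (h : SlideEquiv L L') :
    ∀ {e e' : Word q (n + 1)}, wordList e = L → wordList e' = L' → Linked e e' := by
  induction h with
  | rel L L' h =>
    obtain ⟨A, B, C, D, x, y, rfl, rfl, h1, h2⟩ := h
    intro e e' he he'
    exact (slide_of_wordList he he' h1 h2).linked
  | refl L =>
    intro e e' he he'
    rw [wordList_injective (he.trans he'.symm)]
    exact .refl _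
  | symm _ _ _ ih => exact fun he he' => (ih he' he).symm
  | trans L K M h₁ h₂ ih₁ ih₂ =>
    intro e e' he he'
    obtain ⟨e₁, he₁⟩ := exists_wordList_eq (e := e) (L := K) (by rw [he]; exact SlideEquiv.perm h₁)
    exact (ih₁ he he₁).trans (ih₂ he₁ he')

theorem exists_flip_reorder_eq {N : ℕ} (f : Perm (Fin q × Bool)) (hf : ∀ l, f (opp l) = opp (f l))
    (e : Word q N) : ∃ π c, f.trans e = flip c (reorder π e) := by
  have hinj : Function.Injective fun i => (f (i, false)).1 := by
    intro i j hij
    rcases eq_or_eq_opp hij with h | h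
    · exact congrArg Prod.fst (f.injective h)
    · rw [← hf] at h
      exact congrArg Prod.fst (f.injective h)
  refine ⟨Equiv.ofBijective _ (Finite.injective_iff_bijective.1 hinj),
    fun i => (f (i, false)).2, ?_⟩
  ext1 ⟨i, b⟩
  rw [flip_apply, reorder_apply, trans_apply]
  congr 1
  cases b
  · simp
  · have := hf (i, false)
    simp only [opp, Bool.not_false] at this
    rw [this]
    simp

theorem linked_relabel (f : Perm (Fin q × Bool)) (hf : ∀ l, f (opp l) = opp (f l))
    (e : Word q (n + 1)) : Linked e (f.trans e) := by
  obtain ⟨π, c, h⟩ := exists_flip_reorder_eq f hf e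
  rw [h]
  exact (Linked.reorder π e).trans (.flip c _)

/-! ### The base word -/

def baseLo (g i : ℕ) : ℕ := if i < 2 * g ∧ i % 2 = 1 then 2 * i - 1 else 2 * i

def baseHi (g i : ℕ) : ℕ := if i < 2 * g ∧ i % 2 = 0 then 2 * i + 2 else 2 * i + 1

/-- The word of `g` interlocking pairs of chords followed by chords of neighbours. -/
def IsBase (g : ℕ) {N : ℕ} (b : Word q N) : Prop :=
  ∀ i : Fin q, (b (i, false) : ℕ) = baseLo g i ∧ (b (i, true) : ℕ) = baseHi g i

theorem baseLo_injective (g : ℕ) : Function.Injective (baseLo g) := by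
  intro i j h
  unfold baseLo at h
  split_ifs at h <;> omega

theorem baseHi_injective (g : ℕ) : Function.Injective (baseHi g) := by
  intro i j h
  unfold baseHi at h
  split_ifs at h <;> omega

theorem baseLo_ne_baseHi (g i j : ℕ) : baseLo g i ≠ baseHi g j := by
  intro h
  unfold baseLo baseHi at h
  split_ifs at h <;> omega

theorem baseList_eq_range (g m : ℕ) :
    (List.range g).flatMap (fun k => [4 * k, 4 * k + 1, 4 * k + 2, 4 * k + 3]) ++
      (List.range m).flatMap (fun s => [4 * g + 2 * s, 4 * g + 2 * s + 1]) =
      List.range (4 * g + 2 * m) := by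
  have h1 : (List.range g).flatMap (fun k => [4 * k, 4 * k + 1, 4 * k + 2, 4 * k + 3]) =
      List.range (4 * g) := by
    induction g with
    | zero => rfl
    | succ g ih =>
      rw [List.range_succ, List.flatMap_append, ih, mul_add]
      simp [List.range_succ]
  rw [h1]
  induction m with
  | zero => simp
  | succ m ih =>
    rw [List.range_succ, List.flatMap_append, ← List.append_assoc, ih, mul_add, ← add_assoc]
    simp [List.range_succ]

theorem eq_of_flatMap_range_eq {α : Type*} {f f' : ℕ → List α}
    (hl : ∀ k, (f k).length = (f' k).length) {g : ℕ}
    (h : (List.range g).flatMap f = (List.range g).flatMap f') : ∀ k < g, f k = f' k := by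
  induction g with
  | zero => exact fun k hk => absurd hk (Nat.not_lt_zero k)
  | succ g ih =>
    rw [List.range_succ, List.flatMap_append, List.flatMap_append] at h
    obtain ⟨h1, h2⟩ := List.append_inj' h (by simp [hl])
    intro k hk
    rcases Nat.lt_succ_iff_lt_or_eq.1 hk with h3 | rfl
    · exact ih h1 k h3
    · simpa using h2

theorem exists_linked_isBase (e : Word q (n + 1)) :
    ∃ g m, q = 2 * g + m ∧ ∃ b : Word q (n + 1), Linked e b ∧ IsBase g b := by
  have hcard := e.card_eq
  have : Nonempty (Fin q) := ⟨(e.symm 0).1⟩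
  obtain ⟨g, m, c, h⟩ := exists_slideEquiv_normalList _ (wordList e) rfl (complete_wordList e)
  obtain ⟨e₁, he₁⟩ := exists_wordList_eq h.perm
  have hlink : Linked e e₁ := h.linked rfl he₁
  have hq : q = 2 * g + m := by
    have h1 := h.perm.length_eq
    simp [wordList, normalList] at h1
    omega
  refine ⟨g, m, hq, ?_⟩
  -- The positions of the successive ends are `0, 1, 2, …`; comparison with `baseList_eq_range`
  -- gives the position of both ends of each chord `c i`.
  have hmap : (normalList g m c).map (fun l => (e₁ l : ℕ)) = List.range (4 * g + 2 * m) := by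
    rw [← he₁, wordList, List.map_ofFn]
    have h1 : (fun l => (e₁ l : ℕ)) ∘ e₁.symm = fun r : Fin (n + 1) => (r : ℕ) := by
      funext r
      simp
    rw [h1, List.ofFn_eq_map, ← List.map_coe_finRange_eq_range]
    rw [show 4 * g + 2 * m = n + 1 by omega]
  rw [← baseList_eq_range, normalList, List.map_append, List.map_flatMap, List.map_flatMap] at hmap
  obtain ⟨h1, h2⟩ := List.append_inj hmap (by simp)
  have h3 := eq_of_flatMap_range_eq (fun k => by simp) h1
  have h4 := eq_of_flatMap_range_eq (fun k => by simp) h2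
  have hval : ∀ i < q, (e₁ (c i) : ℕ) = baseLo g i ∧ (e₁ (opp (c i)) : ℕ) = baseHi g i := by
    intro i hi
    by_cases hig : i < 2 * g
    · have h5 := h3 (i / 2) (by omega)
      simp only [List.map_cons, List.map_nil, List.cons.injEq, and_true] at h5
      rcases Nat.mod_two_eq_zero_or_one i with h6 | h6
      · rw [show 2 * (i / 2) = i by omega] at h5
        rw [h5.1, h5.2.2.1, baseLo, baseHi, if_neg (by omega), if_pos (by omega)]
        omega
      · rw [show 2 * (i / 2) + 1 = i by omega] at h5
        rw [h5.2.1, h5.2.2.2, baseLo, baseHi, if_pos (by omega), if_neg (by omega)]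
        omega
    · have h5 := h4 (i - 2 * g) (by omega)
      simp only [List.map_cons, List.map_nil, List.cons.injEq, and_true] at h5
      rw [show 2 * g + (i - 2 * g) = i by omega] at h5
      rw [h5.1, h5.2, baseLo, baseHi, if_neg (by omega), if_neg (by omega)]
      omega
  let f : Fin q × Bool → Fin q × Bool := fun l => if l.2 then opp (c l.1) else c l.1
  have hf : Function.Injective f := by
    rintro ⟨i, b⟩ ⟨j, b'⟩ hij
    have h5 := congrArg (fun l => (e₁ l : ℕ)) hij
    cases b <;> cases b' <;>
      simp only [f, if_true, if_false, Bool.false_eq_true, hval _ (Fin.is_lt _)] at h5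
    · rw [Fin.ext (baseLo_injective g h5)]
    · exact absurd h5 (baseLo_ne_baseHi g _ _)
    · exact absurd h5.symm (baseLo_ne_baseHi g _ _)
    · rw [Fin.ext (baseHi_injective g h5)]
  let F : Perm (Fin q × Bool) := Equiv.ofBijective f (Finite.injective_iff_bijective.1 hf)
  have hF : ∀ l, F (opp l) = opp (F l) := by
    rintro ⟨i, b⟩
    cases b <;> simp [F, f, opp]
  refine ⟨F.trans e₁, hlink.trans (linked_relabel F hF e₁), fun i => ?_⟩
  exact hval i i.isLt

end

section

/-! ### The homology data of the base word -/

/-! ### Cycles, punctures and intersection numbers of the base word -/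

namespace IsBase

variable {g m q N : ℕ} {b : Word q N}

theorem top_val (hb : IsBase g b) (r : Fin N) : (top b r.castSucc : ℕ) =
    if (r : ℕ) < 4 * g then (if (r : ℕ) % 4 < 2 then (r : ℕ) + 3 else (r : ℕ) - 1)
    else if (r : ℕ) % 2 = 0 then (r : ℕ) + 2 else (r : ℕ) := by
  obtain ⟨⟨i, c⟩, rfl⟩ := b.surjective r
  have h1 := (hb i).1
  have h2 := (hb i).2
  unfold baseLo at h1
  unfold baseHi at h2
  rw [top_castSucc, Fin.val_succ]
  cases c <;> simp only [opp, Bool.not_true, Bool.not_false]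
  · rw [h1, h2]
    split_ifs <;> omega
  · rw [h1, h2]
    split_ifs <;> omega

/-- The cycle of `0` runs through each handle as `4k, 4k+3, 4k+2, 4k+1, 4k+4` and then through the
even rows. The odd rows above the handles are fixed points, and these are the punctures. -/
theorem sameCycle_zero (hb : IsBase g b) (hq : q = 2 * g + m) (r : Fin (N + 1))
    (hr : ¬ (4 * g ≤ (r : ℕ) ∧ (r : ℕ) % 2 = 1)) : (top b).SameCycle 0 r := by
  have hN := b.card_eq
  have step : ∀ {u v : ℕ} (hu : u < N) (hv : v < N + 1),
      v = (if u < 4 * g then (if u % 4 < 2 then u + 3 else u - 1)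
        else if u % 2 = 0 then u + 2 else u) →
      (top b).SameCycle 0 ⟨u, by omega⟩ → (top b).SameCycle 0 ⟨v, hv⟩ := by
    intro u v hu hv huv h
    have h1 : top b (⟨u, hu⟩ : Fin N).castSucc = ⟨v, hv⟩ := by
      exact Fin.ext ((hb.top_val _).trans huv.symm)
    rw [← h1, Perm.sameCycle_apply_right]
    exact h
  have block : ∀ k (hk : k < g), (top b).SameCycle 0 ⟨4 * k, by omega⟩ →
      (top b).SameCycle 0 ⟨4 * k + 3, by omega⟩ ∧ (top b).SameCycle 0 ⟨4 * k + 2, by omega⟩ ∧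
        (top b).SameCycle 0 ⟨4 * k + 1, by omega⟩ ∧ (top b).SameCycle 0 ⟨4 * k + 4, by omega⟩ := by
    intro k hk h0
    have h3 := step (u := 4 * k) (v := 4 * k + 3) (by omega) (by omega)
      (by split_ifs <;> omega) h0
    have h2 := step (u := 4 * k + 3) (v := 4 * k + 2) (by omega) (by omega)
      (by split_ifs <;> omega) h3
    have h1 := step (u := 4 * k + 2) (v := 4 * k + 1) (by omega) (by omega)
      (by split_ifs <;> omega) h2
    exact ⟨h3, h2, h1, step (u := 4 * k + 1) (v := 4 * k + 4) (by omega) (by omega)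
      (by split_ifs <;> omega) h1⟩
  have h4 : ∀ k (hk : k ≤ g), (top b).SameCycle 0 ⟨4 * k, by omega⟩ := by
    intro k
    induction k with
    | zero => exact fun _ => Perm.SameCycle.refl _ _
    | succ k ih => exact fun hk => (block k (by omega) (ih (by omega))).2.2.2
  have h5 : ∀ s (hs : s ≤ m), (top b).SameCycle 0 ⟨4 * g + 2 * s, by omega⟩ := by
    intro s
    induction s with
    | zero => exact fun _ => h4 g le_rfl
    | succ s ih =>
      exact fun hs => step (u := 4 * g + 2 * s) (by omega) (by omega)
        (by split_ifs <;> omega) (ih (by omega))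
  obtain ⟨r, hr'⟩ := r
  simp only at hr
  by_cases hg : r < 4 * g
  · obtain ⟨b3, b2, b1, -⟩ := block (r / 4) (by omega) (h4 _ (by omega))
    have h0 := h4 (r / 4) (by omega)
    obtain h | h | h | h : r = 4 * (r / 4) ∨ r = 4 * (r / 4) + 1 ∨ r = 4 * (r / 4) + 2 ∨
        r = 4 * (r / 4) + 3 := by omega
    · exact (Fin.ext h : (⟨r, hr'⟩ : Fin (N + 1)) = ⟨4 * (r / 4), by omega⟩) ▸ h0
    · exact (Fin.ext h : (⟨r, hr'⟩ : Fin (N + 1)) = ⟨4 * (r / 4) + 1, by omega⟩) ▸ b1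
    · exact (Fin.ext h : (⟨r, hr'⟩ : Fin (N + 1)) = ⟨4 * (r / 4) + 2, by omega⟩) ▸ b2
    · exact (Fin.ext h : (⟨r, hr'⟩ : Fin (N + 1)) = ⟨4 * (r / 4) + 3, by omega⟩) ▸ b3
  · have h := h5 ((r - 4 * g) / 2) (by omega)
    have h' : r = 4 * g + 2 * ((r - 4 * g) / 2) := by omega
    exact (Fin.ext h' : (⟨r, hr'⟩ : Fin (N + 1)) = ⟨4 * g + 2 * ((r - 4 * g) / 2), by omega⟩) ▸ h

theorem sameCycle_fixed_iff (hb : IsBase g b) (hq : q = 2 * g + m) {s : Fin (N + 1)}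
    (h1 : 4 * g ≤ (s : ℕ)) (h2 : (s : ℕ) % 2 = 1) (r : Fin (N + 1)) :
    (top b).SameCycle s r ↔ s = r := by
  have hN := b.card_eq
  have hs : (s : ℕ) < N := by omega
  have hfix : top b s = s := by
    have h3 := hb.top_val ⟨s, hs⟩
    rw [if_neg (by simpa using h1), if_neg (by simp [h2])] at h3
    exact Fin.ext h3
  refine ⟨fun h => ?_, fun h => h ▸ Perm.SameCycle.refl _ _⟩
  obtain ⟨k, rfl⟩ := h
  exact (Perm.zpow_apply_eq_self_of_apply_eq_self hfix k).symm

theorem mem_puncture_iff (hb : IsBase g b) (hq : q = 2 * g + m) (s : Fin (N + 1)) :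
    s ∈ puncture (top b) ↔ 4 * g ≤ (s : ℕ) ∧ (s : ℕ) % 2 = 1 := by
  constructor
  · intro h
    by_contra h'
    exact h.1 (hb.sameCycle_zero hq s h')
  · rintro ⟨h1, h2⟩
    refine ⟨fun h => ?_, fun y hy => ((hb.sameCycle_fixed_iff hq h1 h2 y).1 hy).le⟩
    have := (hb.sameCycle_fixed_iff hq h1 h2 0).1 h.symm
    simp [this] at h2

/-- The punctures of the base word. -/
def punctureIso (hb : IsBase g b) (hq : q = 2 * g + m) : Fin m ≃o puncture (top b) :=
  have hN := b.card_eq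
  StrictMono.orderIsoOfSurjective
    (fun a => ⟨⟨4 * g + 2 * a + 1, by omega⟩, (hb.mem_puncture_iff hq _).2 (by simp; omega)⟩)
    (fun a a' h => by simpa using h) (fun s => by
      obtain ⟨h1, h2⟩ := (hb.mem_puncture_iff hq _).1 s.2
      have h3 := s.1.isLt
      exact ⟨⟨(s.1 - 4 * g) / 2, by omega⟩, by ext; simp; omega⟩)

theorem ncyc_top (hb : IsBase g b) (hq : q = 2 * g + m) : ncyc (top b) = m + 1 := by
  rw [ncyc_eq_card_puncture, ← Nat.card_congr (hb.punctureIso hq).toEquiv, Nat.card_fin]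

theorem enum_val (hb : IsBase g b) (hq : q = 2 * g + m) (h : ncyc (top b) = m + 1) (a : Fin m) :
    ((enum (top b) h a : Fin (N + 1)) : ℕ) = 4 * g + 2 * a + 1 := by
  rw [Subsingleton.elim (enum (top b) h) (hb.punctureIso hq)]
  rfl

/-- The puncture `a` is the single row directly below the upper end of the chord `2g + a`, and upper
ends have weight `-1`. -/
theorem loops_apply (hb : IsBase g b) (hq : q = 2 * g + m) (h : ncyc (top b) = m + 1) (a : Fin m)
    (i : Fin q) : loops b h a i = if (i : ℕ) = 2 * g + a then -1 else 0 := by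
  have hs := hb.enum_val hq h a
  have key : ∀ r : Fin (N + 1), ind (top b) (enum (top b) h a) r =
      if (r : ℕ) = 4 * g + 2 * a + 1 then 1 else 0 := by
    intro r
    unfold ind
    simp only [hb.sameCycle_fixed_iff hq (s := (enum (top b) h a : Fin (N + 1))) (by omega)
      (by omega) r, Fin.ext_iff, hs, eq_comm]
  have h1 := (hb i).1
  have h2 := (hb i).2
  unfold baseLo at h1
  unfold baseHi at h2
  rw [loops, Fintype.sum_bool]
  simp only [key, Fin.val_castSucc, h1, h2, wt]
  split_ifs <;> simp <;> omega

theorem inter_apply_of_lt (hb : IsBase g b) {i j : Fin q} (hij : i < j) :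
    inter b i j = if (j : ℕ) < 2 * g ∧ (i : ℕ) % 2 = 0 ∧ (j : ℕ) = i + 1 then 2 else 0 := by
  have h1 := (hb i).1
  have h2 := (hb i).2
  have h3 := (hb j).1
  have h4 := (hb j).2
  unfold baseLo at h1 h3
  unfold baseHi at h2 h4
  have hlt : (i : ℕ) < j := hij
  have o1 : order (b (i, false)) (b (j, false)) = 1 :=
    order_eq_one (by rw [h1, h3]; split_ifs <;> omega)
  have o2 : order (b (i, false)) (b (j, true)) = 1 :=
    order_eq_one (by rw [h1, h4]; split_ifs <;> omega)
  have o3 : order (b (i, true)) (b (j, true)) = 1 :=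
    order_eq_one (by rw [h2, h4]; split_ifs <;> omega)
  simp only [inter, endInter, Fintype.sum_bool, wt, o1, o2, o3, if_true, Bool.false_eq_true,
    if_false]
  split_ifs with h
  · have o4 : order (b (j, false)) (b (i, true)) = 1 :=
      order_eq_one (by rw [h2, h3]; split_ifs <;> omega)
    rw [order_swap, o4]
    simp
  · have o4 : order (b (i, true)) (b (j, false)) = 1 :=
      order_eq_one (by rw [h2, h3]; split_ifs <;> omega)
    rw [o4]
    simp

end IsBase

/-- The chords of the base word, sorted into the first and the second chords of the interlocking
pairs and the remaining ones. -/
def baseIndex {g m q : ℕ} (hq : q = 2 * g + m) : (Fin g ⊕ Fin g) ⊕ Fin m ≃ Fin q :=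
  Equiv.ofBijective
    (Sum.elim (Sum.elim (fun k => ⟨2 * k, by omega⟩) fun k => ⟨2 * k + 1, by omega⟩)
      fun a => ⟨2 * g + a, by omega⟩) <| by
    rw [Fintype.bijective_iff_injective_and_card]
    refine ⟨?_, by simp; omega⟩
    rintro ((k | k) | a) ((k' | k') | a') h <;> simp [Fin.ext_iff] at h ⊢ <;> omega

/-! ### Automorphisms of the homology data of the base word -/

namespace IsBase

open Matrix

variable {g m q N : ℕ} {b : Word q N}

theorem inter_submatrix (hb : IsBase g b) (hq : q = 2 * g + m) :
    (inter b).submatrix (baseIndex hq) (baseIndex hq) =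
      fromBlocks ((-2 : ℤ) • J (Fin g) ℤ) 0 0 (0 : Matrix (Fin m) (Fin m) ℤ) := by
  have key : ∀ i j : Fin q, inter b i j =
      if (j : ℕ) < 2 * g ∧ (i : ℕ) % 2 = 0 ∧ (j : ℕ) = i + 1 then 2 else
      if (i : ℕ) < 2 * g ∧ (j : ℕ) % 2 = 0 ∧ (i : ℕ) = j + 1 then -2 else 0 := by
    intro i j
    rcases lt_trichotomy i j with h | rfl | h
    · rw [hb.inter_apply_of_lt h]
      have : (i : ℕ) < j := h
      split_ifs <;> omega
    · rw [inter_self]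
      split_ifs <;> omega
    · rw [inter_swap, hb.inter_apply_of_lt h]
      have : (j : ℕ) < i := h
      split_ifs <;> omega
  ext ((i | i) | i) ((j | j) | j) <;>
    simp only [submatrix_apply, key, baseIndex, ofBijective_apply, Sum.elim_inl, Sum.elim_inr, J,
      fromBlocks_apply₁₁, fromBlocks_apply₁₂, fromBlocks_apply₂₁, fromBlocks_apply₂₂, Matrix.smul_apply,
      Matrix.zero_apply, Matrix.neg_apply, Matrix.one_apply, Fin.ext_iff, smul_eq_mul] <;>
    split_ifs <;> omega

theorem loops_submatrix (hb : IsBase g b) (hq : q = 2 * g + m) (h : ncyc (top b) = m + 1) :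
    (loops b h).submatrix id (baseIndex hq) = fromCols 0 (-1) := by
  ext a ((i | i) | i) <;>
    simp only [submatrix_apply, hb.loops_apply hq, baseIndex, ofBijective_apply, Sum.elim_inl,
      Sum.elim_inr, fromCols_apply_inl, fromCols_apply_inr, Matrix.zero_apply, Matrix.neg_apply, Matrix.one_apply,
      Fin.ext_iff, id] <;>
    split_ifs <;> omega

/-- Automorphisms of the homology data of the base word preserve the orientation. -/
theorem isoSign_eq_one (hb : IsBase g b) (hq : q = 2 * g + m) {h : ncyc (top b) = m + 1}
    {B : Matrix (Fin q) (Fin q) ℤ} {P : Perm (Fin m)} (hB : IsIso b h b h B P) :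
    isoSign B P = 1 := by
  set φ := baseIndex hq
  obtain ⟨A, X, Y, D, hblock⟩ : ∃ A X Y D, B.submatrix φ φ = fromBlocks A X Y D :=
    ⟨_, _, _, _, (fromBlocks_toBlocks _).symm⟩
  have h1 := congrArg (fun M => M.submatrix φ φ) hB.inter
  have h2 := congrArg (fun M => M.submatrix id φ) hB.loops
  beta_reduce at h1 h2
  rw [← submatrix_mul_equiv _ _ _ φ, ← submatrix_mul_equiv _ _ _ φ, ← transpose_submatrix,
    hb.inter_submatrix, hblock, fromBlocks_transpose, fromBlocks_multiply, fromBlocks_multiply,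
    fromBlocks_inj] at h1
  rw [← submatrix_mul_equiv _ _ _ φ, hb.loops_submatrix, hblock, submatrix_submatrix,
    show (loops b h).submatrix (P ∘ id) (id ∘ φ) =
      ((loops b h).submatrix id φ).submatrix P id from rfl, hb.loops_submatrix,
    fromCols_mul_fromBlocks] at h2
  -- The loops around the punctures are basis vectors up to sign, so their invariance determines the
  -- lower block row of `B`: zero, followed by the permutation matrix of `P`.
  have hYD : fromCols (-Y) (-D) = fromCols 0 (-Perm.permMatrix ℤ P) := by
    rw [Matrix.zero_mul, Matrix.zero_mul, zero_add, zero_add, Matrix.neg_mul, Matrix.neg_mul,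
      Matrix.one_mul, Matrix.one_mul] at h2
    rw [h2]
    ext a (i | i) <;> simp [Perm.permMatrix, PEquiv.toMatrix_apply, Matrix.one_apply]
  obtain ⟨hY, hD⟩ := (fromCols_ext_iff _ _ _ _).1 hYD
  rw [neg_eq_zero] at hY
  rw [neg_inj] at hD
  -- The upper left block preserves `-2J`, hence is symplectic and has determinant one.
  have hA : A ∈ symplecticGroup (Fin g) ℤ := by
    rw [SymplecticGroup.mem_iff]
    have h3 := h1.1
    simp only [Matrix.mul_zero, add_zero, Matrix.mul_smul, Matrix.smul_mul, Matrix.zero_mul] at h3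
    exact smul_right_injective _ (by norm_num) h3
  have hdet : B.det = Perm.sign P := by
    rw [← det_submatrix_equiv_self φ, hblock, hY, det_fromBlocks_zero₂₁,
      SymplecticGroup.det_eq_one hA, hD, det_permutation, one_mul]
    simp
  rw [isoSign, hdet, ← Units.val_mul, Int.units_mul_self, Units.val_one]

/-- The chords around the punctures can be permuted freely. This serves to make the permutation of
the punctures of a given isomorphism trivial. -/
theorem exists_isIso (hb : IsBase g b) (hq : q = 2 * g + m) (h : ncyc (top b) = m + 1)
    (P : Perm (Fin m)) : ∃ B, IsIso b h b h B P := by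
  set φ := baseIndex hq
  set B' : Matrix ((Fin g ⊕ Fin g) ⊕ Fin m) ((Fin g ⊕ Fin g) ⊕ Fin m) ℤ :=
    fromBlocks 1 0 0 (Perm.permMatrix ℤ P)
  have hB : (B'.submatrix φ.symm φ.symm).submatrix φ φ = B' := by simp
  refine ⟨B'.submatrix φ.symm φ.symm, ?_, ?_, ?_⟩
  · rw [det_submatrix_equiv_self, det_fromBlocks_zero₂₁, det_permutation, det_one, one_mul]
    exact Units.isUnit _
  · apply (Matrix.reindex φ.symm φ.symm).injective
    rw [reindex_apply, reindex_apply, symm_symm, ← submatrix_mul_equiv _ _ _ φ,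
      ← submatrix_mul_equiv _ _ _ φ, ← transpose_submatrix, hB, hb.inter_submatrix,
      fromBlocks_transpose, fromBlocks_multiply, fromBlocks_multiply]
    simp
  · apply (Matrix.reindex (Equiv.refl _) φ.symm).injective
    rw [reindex_apply, reindex_apply, symm_symm, refl_symm, coe_refl,
      ← submatrix_mul_equiv _ _ _ φ, hB, submatrix_submatrix,
      show (loops b h).submatrix (P ∘ id) (id ∘ φ) =
      ((loops b h).submatrix id φ).submatrix P id from rfl, hb.loops_submatrix,
      fromCols_mul_fromBlocks]
    ext a (i | i) <;> simp [Perm.permMatrix, PEquiv.toMatrix_apply, Matrix.one_apply]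

end IsBase

end

section

/-! ### The orientation of a word -/

theorem Linked.exists_isIso {q n m : ℕ} {e e' : Word q (n + 1)} (h : Linked e e') :
    ncyc (top e') = ncyc (top e) ∧ ∀ (he : ncyc (top e) = m + 1) (he' : ncyc (top e') = m + 1),
      ∃ B P, IsIso e he e' he' B P := by
  induction h with
  | slide h hlt => exact ⟨h.ncyc_eq hlt, fun he he' => ⟨_, _, h.isIso hlt he he'⟩⟩
  | reorder π e =>
    exact ⟨congrArg ncyc (top_reorder π e), fun he he' => ⟨_, _, (reorder_isIso π e he he').symm⟩⟩
  | flip c e =>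
    exact ⟨congrArg ncyc (top_flip c e), fun he he' => ⟨_, _, (flip_isIso c e he he').symm⟩⟩
  | symm _ ih =>
    refine ⟨ih.1.symm, fun he he' => ?_⟩
    obtain ⟨B, P, h⟩ := ih.2 he' he
    exact ⟨_, _, h.symm⟩
  | trans _ _ ih ih' =>
    refine ⟨ih'.1.trans ih.1, fun he he' => ?_⟩
    obtain ⟨B, P, h⟩ := ih.2 he (ih.1.trans he)
    obtain ⟨C, Q, h'⟩ := ih'.2 (ih.1.trans he) he'
    exact ⟨_, _, h.trans h'⟩

section Base

variable {g m q N : ℕ} {b : Word q N}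

theorem IsBase.ext {b' : Word q N} (hb : IsBase g b) (hb' : IsBase g b') : b = b' := by
  ext1 ⟨i, c⟩
  cases c
  · exact Fin.ext ((hb i).1.trans (hb' i).1.symm)
  · exact Fin.ext ((hb i).2.trans (hb' i).2.symm)

/-- A normal form exists for some genus; invariance of the number of cycles under `Linked` shows
that it is the genus of `b`. -/
theorem IsBase.linked {n : ℕ} {b e : Word q (n + 1)} (hb : IsBase g b) (hq : q = 2 * g + m)
    (he : ncyc (top e) = m + 1) : Linked b e := by
  obtain ⟨g', m', hq', b', h, hb'⟩ := exists_linked_isBase e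
  have h1 := (h.exists_isIso (m := m)).1
  rw [hb'.ncyc_top hq', he] at h1
  obtain rfl : g' = g := by omega
  rw [hb.ext hb']
  exact h.symm

theorem Word.eq_or_exists (e b : Word q N) : e = b ∨ ∃ n, N = n + 1 := by
  have hN := b.card_eq
  rcases N with _ | n
  · left
    ext1 l
    exact (e l).elim0
  · exact .inr ⟨n, rfl⟩

theorem IsBase.exists_isIso_of (hb : IsBase g b) (hq : q = 2 * g + m) (h : ncyc (top b) = m + 1)
    {e : Word q N} (he : ncyc (top e) = m + 1) : ∃ B P, IsIso b h e he B P := by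
  rcases e.eq_or_exists b with rfl | ⟨n, rfl⟩
  · exact ⟨_, _, .refl e h⟩
  · exact (hb.linked hq he).exists_isIso.2 h he

/-- The sign of an isomorphism from the homology data of `b` to that of `e`. -/
def orient (m : ℕ) (b e : Word q N) : ℤ :=
  Classical.epsilon fun s => ∃ (h : ncyc (top b) = m + 1) (he : ncyc (top e) = m + 1) (B : _)
    (P : _), IsIso b h e he B P ∧ isoSign B P = s

/-- Two isomorphisms differ by an automorphism of the data of `b`, which has sign one, so the choice
made in `orient` is immaterial. -/
theorem IsBase.orient_eq (hb : IsBase g b) (hq : q = 2 * g + m) {h : ncyc (top b) = m + 1}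
    {e : Word q N} {he : ncyc (top e) = m + 1} {B : Matrix (Fin q) (Fin q) ℤ} {P : Perm (Fin m)}
    (hB : IsIso b h e he B P) : orient m b e = isoSign B P := by
  obtain ⟨_, _, C, Q, hC, hs⟩ : ∃ (h : ncyc (top b) = m + 1) (he : ncyc (top e) = m + 1) (B : _)
      (P : _), IsIso b h e he B P ∧ isoSign B P = orient m b e :=
    Classical.epsilon_spec (p := fun s => ∃ (h : ncyc (top b) = m + 1)
      (he : ncyc (top e) = m + 1) (B : _) (P : _), IsIso b h e he B P ∧ isoSign B P = s)
      ⟨_, h, he, B, P, hB, rfl⟩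
  have h1 := hb.isoSign_eq_one hq (hB.trans hC.symm)
  have h2 := hb.isoSign_eq_one hq (hC.trans hC.symm)
  rw [isoSign_mul] at h1 h2
  have h3 := hC.symm.isoSign_mul_self
  rw [← hs]
  linear_combination (isoSign C⁻¹ Q⁻¹) * (h2 - h1) + (isoSign B P - isoSign C Q) * h3

theorem IsBase.orient_mul (hb : IsBase g b) (hq : q = 2 * g + m) {e e' : Word q N}
    {he : ncyc (top e) = m + 1} {he' : ncyc (top e') = m + 1} {B : Matrix (Fin q) (Fin q) ℤ}
    {P : Perm (Fin m)} (hB : IsIso e he e' he' B P) :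
    orient m b e' = orient m b e * isoSign B P := by
  obtain ⟨C, Q, hC⟩ := hb.exists_isIso_of hq (hb.ncyc_top hq) he
  rw [hb.orient_eq hq hC, hb.orient_eq hq (hC.trans hB), isoSign_mul]

theorem IsBase.orient_mul_self (hb : IsBase g b) (hq : q = 2 * g + m) {e : Word q N}
    (he : ncyc (top e) = m + 1) : orient m b e * orient m b e = 1 := by
  obtain ⟨C, Q, hC⟩ := hb.exists_isIso_of hq (hb.ncyc_top hq) he
  rw [hb.orient_eq hq hC, hC.isoSign_mul_self]

theorem prod_wt_mul_self (c : Fin q → Bool) : (∏ i, wt (c i)) * (∏ i, wt (c i)) = 1 := by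
  rw [← Finset.prod_mul_distrib]
  exact Finset.prod_eq_one fun i _ => wt_mul_self _

theorem IsBase.orient_reorder (hb : IsBase g b) (hq : q = 2 * g + m) (π : Perm (Fin q))
    {e : Word q N} (he : ncyc (top e) = m + 1) :
    orient m b (reorder π e) = Perm.sign π * orient m b e := by
  have he' : ncyc (top (reorder π e)) = m + 1 := by rwa [top_reorder]
  have h := hb.orient_mul hq (reorder_isIso π e he he')
  rw [isoSign, Matrix.det_permutation, Perm.sign_one, Units.val_one, mul_one] at h
  have h1 : (Perm.sign π : ℤ) * Perm.sign π = 1 := Int.isUnit_mul_self (Units.isUnit _)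
  simp only [Int.cast_id] at h
  linear_combination (-(Perm.sign π : ℤ)) * h - orient m b (reorder π e) * h1

theorem IsBase.orient_flip (hb : IsBase g b) (hq : q = 2 * g + m) (c : Fin q → Bool)
    {e : Word q N} (he : ncyc (top e) = m + 1) :
    orient m b (flip c e) = (∏ i, wt (c i)) * orient m b e := by
  have he' : ncyc (top (flip c e)) = m + 1 := by rwa [top_flip]
  have h := hb.orient_mul hq (flip_isIso c e he he')
  rw [isoSign, Matrix.det_diagonal, Perm.sign_one, Units.val_one, mul_one] at h
  linear_combination (-(∏ i, wt (c i))) * h - orient m b (flip c e) * prod_wt_mul_self c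

/-! ### The normalized coefficients of a chain -/

/-- The coefficient with which the fundamental class runs through the cell of a word. -/
def fundSign (m : ℕ) (b e : Word q N) : ℤ := sgn b e * orient m b e

theorem IsBase.fundSign_mul_self (hb : IsBase g b) (hq : q = 2 * g + m) {e : Word q N}
    (he : ncyc (top e) = m + 1) : fundSign m b e * fundSign m b e = 1 := by
  rw [fundSign]
  linear_combination (orient m b e * orient m b e) * sgn_mul_self b e + hb.orient_mul_self hq he

theorem IsBase.fundSign_self (hb : IsBase g b) (hq : q = 2 * g + m) : fundSign m b b = 1 := by
  rw [fundSign, sgn, symm_trans_self, Perm.sign_refl,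
    hb.orient_eq hq (IsIso.refl b (hb.ncyc_top hq)), isoSign]
  simp

theorem IsBase.fundSign_reorder (hb : IsBase g b) (hq : q = 2 * g + m) (π : Perm (Fin q))
    {e : Word q N} (he : ncyc (top e) = m + 1) :
    fundSign m b (reorder π e) = Perm.sign π * fundSign m b e := by
  rw [fundSign, fundSign, sgn_reorder, hb.orient_reorder hq π he]
  ring

/-- The sign of the word and the determinant change by the same factor, so `fundSign` depends only
on the cell. -/
theorem IsBase.fundSign_flip (hb : IsBase g b) (hq : q = 2 * g + m) (c : Fin q → Bool)
    {e : Word q N} (he : ncyc (top e) = m + 1) :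
    fundSign m b (flip c e) = fundSign m b e := by
  rw [fundSign, fundSign, sgn_flip, hb.orient_flip hq c he]
  linear_combination (sgn b e * orient m b e) * prod_wt_mul_self c

theorem IsBase.fundSign_slide {n : ℕ} {b e e' : Word q (n + 1)} {x y : Fin q × Bool}
    (hb : IsBase g b) (hq : q = 2 * g + m) (h : Slide e e' x y) (hlt : x.1 < y.1)
    (he : ncyc (top e) = m + 1) {𝒪 : SignRule} (h𝒪 : Compatible 𝒪 m) :
    fundSign m b e' = (-1) ^ (e y + e' y : ℕ) * (𝒪 n (e x).succ (top e) *
      𝒪 n (e' y).succ (top e')) * fundSign m b e := by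
  have he' := (h.ncyc_eq hlt).trans he
  rw [fundSign, fundSign, h.sgn_eq, hb.orient_mul hq (h.isIso hlt he he'),
    h.isoSign_eq he he' h𝒪]
  ring

/-- The coefficient of a chain at the cell of a word, relative to the fundamental class. -/
def coeff (m : ℕ) (b : Word q N) (z : Cell →₀ ℤ) (e : Word q N) : ℤ :=
  fundSign m b e * z (cellOf e)

theorem cellOf_flip (c : Fin q → Bool) (e : Word q N) : cellOf (flip c e) = cellOf e := by
  rw [cellOf, slits_flip, cellOf]

/-- Exchanges of successive chords generate all reorderings, and for them the vertical cancellation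
matches the change of `fundSign`. -/
theorem IsBase.coeff_reorder {z : Cell →₀ ℤ} (hb : IsBase g b) (hq : q = 2 * g + m)
    (hz : VerticalCancel q m z) (π : Perm (Fin q)) {e : Word q N} (he : ncyc (top e) = m + 1) :
    coeff m b z (reorder π e) = coeff m b z e := by
  rcases q with _ | q
  · rw [Subsingleton.elim π 1]
    rfl
  · have hπ : π ∈ Submonoid.closure
        (Set.range fun i : Fin q => swap i.castSucc i.succ) := by
      rw [Perm.mclosure_swap_castSucc_succ]
      trivial
    induction hπ using Submonoid.closure_induction generalizing e with
    | mem π hπ =>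
      obtain ⟨i, rfl⟩ := hπ
      have h1 := hz q N rfl e he i
      rw [exchange] at h1
      rw [coeff, coeff, h1, hb.fundSign_reorder hq _ he,
        Perm.sign_swap (Fin.castSucc_lt_succ).ne]
      simp
    | one => rfl
    | mul π ρ _ _ ih ih' =>
      have h2 : reorder (π * ρ) e = reorder ρ (reorder π e) := rfl
      rw [h2, ih' (by rwa [top_reorder]), ih he]

theorem compatible_mul_self {𝒪 : SignRule} (h𝒪 : Compatible 𝒪 m) {p : ℕ} {j : Fin (p + 2)}
    {σ : Perm (Fin (p + 2))} (hj : j ≠ 0) (hσj : σ j ≠ j) (h : ncyc σ = m + 1) :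
    𝒪 p j σ * 𝒪 p j σ = 1 := by
  rw [h𝒪 p j σ hj hσj h]
  exact Int.isUnit_mul_self (Units.isUnit _)

theorem neg_one_pow_mul_self (k : ℕ) : (-1 : ℤ) ^ k * (-1) ^ k = 1 := by
  rw [← mul_pow]
  simp

/-- All the signs are units, so the cancellation at the common face of a slide can be rewritten as
an equality of normalized coefficients. -/
theorem IsBase.coeff_slide {n : ℕ} {b e e' : Word q (n + 1)} {x y : Fin q × Bool} {z : Cell →₀ ℤ}
    (hb : IsBase g b) (hq : q = 2 * g + m) (h : Slide e e' x y) (hlt : x.1 < y.1)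
    (he : ncyc (top e) = m + 1) {𝒪 : SignRule} (h𝒪 : Compatible 𝒪 m) :
    coeff m b z e' = coeff m b z e ↔
      (-1) ^ (e y : ℕ) * 𝒪 n (e x).succ (top e) * z (cellOf e) +
        (-1) ^ (e' y + 1 : ℕ) * 𝒪 n (e' y).succ (top e') * z (cellOf e') = 0 := by
  have he' := (h.ncyc_eq hlt).trans he
  rw [coeff, coeff, hb.fundSign_slide hq h hlt he h𝒪, pow_add, pow_succ]
  have h1 := compatible_mul_self h𝒪 (Fin.succ_ne_zero _) h.src.top_ne he
  have h2 := neg_one_pow_mul_self (e y)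
  have h3 := hb.fundSign_mul_self hq he
  set s := fundSign m b e
  set u := (-1 : ℤ) ^ (e y : ℕ)
  set u' := (-1 : ℤ) ^ (e' y : ℕ)
  set o := 𝒪 n (e x).succ (top e)
  set o' := 𝒪 n (e' y).succ (top e')
  have h4 : (u * o) * (u * o) = 1 := by linear_combination (o * o) * h2 + h1
  constructor
  · intro h5
    linear_combination (-(s * u * o)) * h5 + (u' * o' * z (cellOf e') * s * s) * h4 +
      (u' * o' * z (cellOf e') - u * o * z (cellOf e)) * h3
  · intro h5
    linear_combination (-(s * u * o)) * h5 + (s * z (cellOf e)) * h4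

/-- Cancellation at the walls means that the normalized coefficient does not change under exchanges
and slides; under flips it never changes. By connectivity it is constant. -/
theorem IsBase.boundary_eq_zero_iff {z : Cell →₀ ℤ} (hb : IsBase g b) (hq : q = 2 * g + m)
    {𝒪 : SignRule} (h𝒪 : Compatible 𝒪 m) (hz : z ∈ chains q m (3 * q)) :
    boundary 𝒪 q m z = 0 ↔
      ∀ e : Word q N, ncyc (top e) = m + 1 → coeff m b z e = coeff m b z b := by
  rw [ParallelSlit.boundary_eq_zero_iff hz]
  constructor
  · rintro ⟨hv, hh⟩ e he
    rcases e.eq_or_exists b with rfl | ⟨n, rfl⟩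
    · rfl
    · have key : ∀ {e e' : Word q (n + 1)}, Linked e e' → ncyc (top e) = m + 1 →
          coeff m b z e' = coeff m b z e := by
        intro e e' h
        induction h with
        | slide h hlt => exact fun he => (hb.coeff_slide hq h hlt he h𝒪).2 (hh n _ _ _ _ h hlt he)
        | reorder π e => exact hb.coeff_reorder hq hv π
        | flip c e =>
          intro he
          rw [coeff, coeff, cellOf_flip, hb.fundSign_flip hq c he]
        | symm h ih => exact fun he => (ih ((h.exists_isIso (m := m)).1.symm.trans he)).symm
        | trans h _ ih ih' =>
          exact fun he => (ih' ((h.exists_isIso (m := m)).1.trans he)).trans (ih he)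
      exact key (hb.linked hq he) (hb.ncyc_top hq)
  · intro h
    constructor
    · rintro q' N' rfl e he i
      obtain rfl : N = N' := b.card_eq.trans e.card_eq.symm
      have h1 := (h (exchange i e) (by rwa [exchange, top_reorder])).trans (h e he).symm
      rw [coeff, coeff, exchange, hb.fundSign_reorder hq _ he,
        Perm.sign_swap (Fin.castSucc_lt_succ).ne] at h1
      have h2 := hb.fundSign_mul_self hq he
      rw [exchange]
      push_cast at h1
      linear_combination (-fundSign m b e) * h1 -
        (z (cellOf (reorder (swap i.castSucc i.succ) e)) + z (cellOf e)) * h2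
    · intro n e e' x y hs hlt he
      obtain rfl : N = n + 1 := b.card_eq.trans e.card_eq.symm
      rw [← hb.coeff_slide hq hs hlt he h𝒪, h e he, h e' ((hs.ncyc_eq hlt).trans he)]

theorem chains_eq_bot (q m : ℕ) : chains q m (3 * q + 1) = ⊥ := by
  rw [chains]
  convert Finsupp.supported_empty
  ext c
  simp only [Set.mem_ofPred_eq, Set.mem_empty_iff_false, iff_false]
  rintro ⟨⟨⟨h1, h2, -⟩, -⟩, h⟩
  omega

/-- A chain whose coefficients are those of the fundamental class represents it. -/
theorem IsBase.representsFundamentalClass {z : Cell →₀ ℤ} (hb : IsBase g b) (hq : q = 2 * g + m)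
    {𝒪 : SignRule} (h𝒪 : Compatible 𝒪 m) (hz : z ∈ chains q m (3 * q))
    (hcoeff : ∀ e : Word q N, ncyc (top e) = m + 1 → z (cellOf e) = fundSign m b e) :
    RepresentsFundamentalClass 𝒪 q m z := by
  have hN := b.card_eq
  subst hN
  have hcyc : z ∈ cycles 𝒪 q m (3 * q) := by
    refine ⟨hz, (hb.boundary_eq_zero_iff hq h𝒪 hz).2 fun e he => ?_⟩
    rw [coeff, coeff, hcoeff e he, hcoeff b (hb.ncyc_top hq), hb.fundSign_mul_self hq he,
      hb.fundSign_mul_self hq (hb.ncyc_top hq)]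
  have hself : z (cellOf b) = 1 := by
    rw [hcoeff b (hb.ncyc_top hq), hb.fundSign_self hq]
  -- There are no cells of degree `3q + 1`, so nothing is divided out.
  have hker : (boundaries 𝒪 q m (3 * q)).comap (cycles 𝒪 q m (3 * q)).subtype = ⊥ := by
    rw [boundaries, chains_eq_bot, Submodule.map_bot, Submodule.comap_bot,
      Submodule.ker_subtype]
  refine ⟨hcyc, ?_, ?_, ?_⟩
  · intro c hc hpq
    obtain ⟨e, rfl, he⟩ := cell_eq_of_mem_chains (z := Finsupp.single c 1) (c := c)
      ((Finsupp.mem_supported ℤ _).2 fun c' hc' => by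
        obtain rfl := Finset.mem_singleton.1 (Finsupp.support_single_subset hc')
        exact ⟨hc, hpq⟩) (by simp)
    rw [hcoeff e he]
    exact IsUnit.of_mul_eq_one _ (hb.fundSign_mul_self hq he)
  · intro k k' h
    have h1 := (Submodule.Quotient.eq _).1 (h : Submodule.Quotient.mk (k • _) =
      Submodule.Quotient.mk (k' • (⟨z, hcyc⟩ : cycles 𝒪 q m (3 * q))))
    rw [hker, Submodule.mem_bot] at h1
    have h2 := congrArg (fun w : cycles 𝒪 q m (3 * q) => w.1 (cellOf b)) h1
    simp [hself] at h2
    omega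
  · intro w
    obtain ⟨⟨w, hw⟩, rfl⟩ := Submodule.Quotient.mk_surjective _ w
    -- The multiple is the constant value of the normalized coefficient of `w`.
    refine ⟨coeff m b w b, ?_⟩
    beta_reduce
    rw [← Submodule.Quotient.mk_smul]
    congr 1
    ext c
    have h1 := (hb.boundary_eq_zero_iff hq h𝒪 hw.1).1 hw.2
    change coeff m b w b * z c = w c
    by_cases hc : z c = 0 ∧ w c = 0
    · rw [hc.1, hc.2, mul_zero]
    · obtain ⟨e, rfl, he⟩ : ∃ e : Word q (2 * q), c = cellOf e ∧ ncyc (top e) = m + 1 := by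
        by_cases h2 : z c = 0
        · exact cell_eq_of_mem_chains hw.1 fun h3 => hc ⟨h2, h3⟩
        · exact cell_eq_of_mem_chains hz h2
      rw [← h1 e he, hcoeff e he, coeff]
      linear_combination w (cellOf e) * hb.fundSign_mul_self hq he

end Base

end

section

/-! ### The words of the conjugates of `T` -/

variable {g m : ℕ}

theorem lo_val (g m : ℕ) (i : Fin (2 * g + m)) : (lo g m i : ℕ) = baseLo g i := by
  unfold lo baseLo
  split_ifs <;> rfl

theorem hi_val (g m : ℕ) (i : Fin (2 * g + m)) : (hi g m i : ℕ) = baseHi g i := by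
  unfold hi baseHi
  split_ifs <;> rfl

/-- The word of `T`. -/
def base (g m : ℕ) : Word (2 * g + m) (2 * (2 * g + m)) :=
  Equiv.ofBijective (fun l => if l.2 then hi g m l.1 else lo g m l.1) <| by
    rw [Fintype.bijective_iff_injective_and_card]
    refine ⟨?_, by simp [mul_comm]⟩
    rintro ⟨i, c⟩ ⟨j, d⟩ h
    have h1 := congrArg Fin.val h
    cases c <;> cases d <;>
      simp only [Bool.false_eq_true, if_true, if_false, lo_val, hi_val] at h1
    · rw [Fin.ext (baseLo_injective g h1)]
    · exact absurd h1 (baseLo_ne_baseHi g _ _)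
    · exact absurd h1.symm (baseLo_ne_baseHi g _ _)
    · rw [Fin.ext (baseHi_injective g h1)]

theorem base_false (i : Fin (2 * g + m)) : base g m (i, false) = lo g m i := rfl

theorem base_true (i : Fin (2 * g + m)) : base g m (i, true) = hi g m i := rfl

/-- The word of `κ_α(T)`. -/
def kappaWord (g m : ℕ) (α : Perm (Fin (2 * (2 * g + m)))) :
    Word (2 * g + m) (2 * (2 * g + m)) := (base g m).trans α

theorem isBase_kappaWord_one (g m : ℕ) : IsBase g (kappaWord g m 1) :=
  fun i => ⟨lo_val g m i, hi_val g m i⟩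

theorem exists_kappaWord_eq (e : Word (2 * g + m) (2 * (2 * g + m))) :
    ∃ α, kappaWord g m α = e :=
  ⟨(base g m).symm.trans e, by ext1; simp [kappaWord]⟩

theorem sgn_kappaWord (α : Perm (Fin (2 * (2 * g + m)))) :
    sgn (kappaWord g m 1) (kappaWord g m α) = Perm.sign α := by
  rw [sgn, show kappaWord g m 1 = base g m from rfl, kappaWord, ← Equiv.trans_assoc, symm_trans_self, Equiv.refl_trans]

theorem conjTau_eq (α : Perm (Fin (2 * (2 * g + m)))) :
    conjTau g m α = arc (letters (kappaWord g m α)) := by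
  funext i
  rw [conjTau, tau, ← swap_apply_apply, fixZero_succ, fixZero_succ]
  rfl

theorem permKappa_eq (π : Perm (Fin (2 * g + m))) (α : Perm (Fin (2 * (2 * g + m)))) :
    permKappa g m π α = cellOf (reorder π (kappaWord g m α)) := by
  rw [permKappa, conjTau_eq]
  rfl

theorem kappaTop_eq (α : Perm (Fin (2 * (2 * g + m)))) :
    kappaTop g m α = top (kappaWord g m α) := by
  have h : ∀ {τ τ' : Fin (2 * g + m) → Perm (Fin (2 * (2 * g + m) + 1))}, τ = τ' →
      (bar τ).top = (bar τ').top := by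
    rintro _ _ rfl
    rfl
  exact h (conjTau_eq α)

theorem mem_Lam {α : Perm (Fin (2 * (2 * g + m)))} :
    α ∈ Lam g m ↔ ncyc (top (kappaWord g m α)) = m + 1 := by
  rw [Lam, Set.mem_ofPred_eq, kappaTop_eq]

theorem intersection_eq (α : Perm (Fin (2 * (2 * g + m)))) :
    intersection g m α = inter (kappaWord g m α) := by
  ext i j
  simp only [intersection, inter, endInter, Fintype.sum_bool, wt, order, kappaWord, trans_apply,
    base_false, base_true, if_true, Bool.false_eq_true, if_false]
  ring

theorem punctureLoop_eq (α : Perm (Fin (2 * (2 * g + m)))) (s : Fin (2 * (2 * g + m) + 1)) :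
    punctureLoop g m α s = fun i => ∑ b : Bool, wt b *
      ind (top (kappaWord g m α)) s (kappaWord g m α (i, b)).castSucc := by
  have h : punctureLoop g m α s = fun i =>
      ind (kappaTop g m α) s (α (lo g m i)).castSucc -
        ind (kappaTop g m α) s (α (hi g m i)).castSucc := rfl
  rw [h, kappaTop_eq]
  funext i
  simp only [Fintype.sum_bool, wt, kappaWord, trans_apply, base_false, base_true, if_true,
    Bool.false_eq_true, if_false]
  ring

/-- There is only one order isomorphism between the two sets of punctures, so enumerating both by
increasing minima turns it into the identity permutation. -/
theorem positive_iff {α : Perm (Fin (2 * (2 * g + m)))}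
    (h : ncyc (top (kappaWord g m 1)) = m + 1) (hα : ncyc (top (kappaWord g m α)) = m + 1) :
    Positive g m α ↔ ∃ A : Matrix (Fin (2 * g + m)) (Fin (2 * g + m)) ℤ,
      A.det = 1 ∧ IsIso (kappaWord g m 1) h (kappaWord g m α) hα A 1 := by
  unfold Positive
  rw [kappaTop_eq 1, kappaTop_eq α, intersection_eq, intersection_eq]
  refine exists_congr fun A => and_congr_right fun hA => ?_
  have hrow : ∀ a, Matrix.vecMul (punctureLoop g m 1 (enum _ h a)) A =
      (loops (kappaWord g m 1) h * A) a := fun a => by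
    rw [punctureLoop_eq]
    exact (Matrix.mul_apply_eq_vecMul (loops (kappaWord g m 1) h) A a).symm
  have hrow' : ∀ a, punctureLoop g m α (enum _ hα a) = loops (kappaWord g m α) hα a :=
    fun a => punctureLoop_eq _ _
  constructor
  · rintro ⟨h1, e, he⟩
    refine ⟨by simp [hA], h1, ?_⟩
    have h2 : ∀ a, e (enum _ h a) = enum _ hα a := fun a =>
      DFunLike.congr_fun (Subsingleton.elim ((enum _ h).trans e) (enum _ hα)) a
    funext a
    rw [← hrow, he, h2, hrow']
    rfl
  · rintro ⟨-, h1, h2⟩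
    refine ⟨h1, (enum _ h).symm.trans (enum _ hα), fun s => ?_⟩
    obtain ⟨a, rfl⟩ := (enum _ h).surjective s
    rw [hrow, h2, OrderIso.trans_apply, OrderIso.symm_apply_apply, hrow']
    rfl

theorem exists_flip_eq {q N : ℕ} {e e' : Word q N} (h : slits e = slits e') :
    ∃ c, e = flip c e' := by
  have h1 := slits_eq_iff.1 h
  refine ⟨fun i => (e'.symm (e (i, false))).2, ?_⟩
  have h2 : ∀ i, e (i, false) = e' (i, (e'.symm (e (i, false))).2) := by
    intro i
    rw [← e'.symm_apply_eq]
    exact Prod.ext (h1 (i, false)) rfl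
  ext1 ⟨i, b⟩
  rw [flip_apply]
  cases b
  · rw [Bool.false_xor]
    exact h2 i
  · rw [Bool.true_xor]
    rcases eq_or_eq_opp (l' := (i, (e'.symm (e (i, false))).2)) (h1 (i, true)) with h3 | h3
    · rw [e'.symm_apply_eq, ← h2] at h3
      simpa using e.injective h3
    · rw [e'.symm_apply_eq] at h3
      exact h3

theorem fundSign_kappaWord {α : Perm (Fin (2 * (2 * g + m)))} (hα : α ∈ Lam g m)
    (hpos : Positive g m α) : fundSign m (kappaWord g m 1) (kappaWord g m α) = Perm.sign α := by
  obtain ⟨A, hA, hiso⟩ := (positive_iff ((isBase_kappaWord_one g m).ncyc_top rfl) (mem_Lam.1 hα)).1 hpos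
  rw [fundSign, (isBase_kappaWord_one g m).orient_eq rfl hiso, sgn_kappaWord, isoSign, hA]
  simp

/-- Connectivity provides an isomorphism from the data of `T`. An automorphism of `T` corrects its
permutation of the punctures, and if the determinant is then `-1`, exchanging the ends of one chord
corrects it without changing any transposition. -/
theorem exists_positive {β : Perm (Fin (2 * (2 * g + m)))} (hβ : β ∈ Lam g m) :
    ∃ α ∈ Lam g m, Positive g m α ∧ Set.range (conjTau g m α) = Set.range (conjTau g m β) := by
  have hb := isBase_kappaWord_one g m
  have h := hb.ncyc_top (m := m) rfl
  have he := mem_Lam.1 hβ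
  obtain ⟨B, P, hB⟩ := hb.exists_isIso_of rfl h he
  obtain ⟨C, hC⟩ := hb.exists_isIso rfl h P⁻¹
  have hA := hC.trans hB
  rw [mul_inv_cancel] at hA
  rcases Int.isUnit_iff.1 hA.det with h1 | h1
  · exact ⟨β, hβ, (positive_iff h he).2 ⟨_, h1, hA⟩, rfl⟩
  · have hne : Nonempty (Fin (2 * g + m)) := by
      by_contra hem
      rw [not_nonempty_iff] at hem
      rw [Matrix.det_isEmpty] at h1
      omega
    obtain ⟨i⟩ := hne
    set c : Fin (2 * g + m) → Bool := fun j => decide (j = i)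
    have hc : ∏ j, wt (c j) = -1 := by
      rw [Finset.prod_eq_single i]
      · simp [c, wt]
      · intro j _ hj
        simp [c, wt, hj]
      · simp
    have he' : ncyc (top (flip c (kappaWord g m β))) = m + 1 := by rwa [top_flip]
    have hF := flip_isIso c _ he he'
    obtain ⟨α, hα⟩ := exists_kappaWord_eq (flip c (kappaWord g m β))
    have hG := hA.trans hF.symm
    have hdet : (C * B * (Matrix.diagonal fun i => wt (c i))⁻¹).det = 1 := by
      have h2 := Matrix.det_nonsing_inv_mul_det _ hF.det
      rw [Matrix.det_diagonal, hc] at h2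
      rw [Matrix.det_mul, h1]
      linarith
    rw [← hα] at he'
    refine ⟨α, mem_Lam.2 he', (positive_iff h he').2 ⟨_, hdet, ?_⟩, ?_⟩
    · convert hG
      simp
    · rw [conjTau_eq, conjTau_eq, hα]
      exact congrArg Set.range (funext (arcs_eq_iff.1 (slits_flip c _)))

theorem exists_isRepresentativeSystem (g m : ℕ) : ∃ R, IsRepresentativeSystem g m R := by
  classical
  -- One element is chosen for each set of transpositions, not for each `β`, which makes the
  -- representative unique.
  have h : ∀ s : Set (Perm (Fin (2 * (2 * g + m) + 1))), ∃ α,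
      (∃ β ∈ Lam g m, Set.range (conjTau g m β) = s) →
        α ∈ Lam g m ∧ Positive g m α ∧ Set.range (conjTau g m α) = s := by
    intro s
    by_cases hs : ∃ β ∈ Lam g m, Set.range (conjTau g m β) = s
    · obtain ⟨β, hβ, rfl⟩ := hs
      obtain ⟨α, h1, h2, h3⟩ := exists_positive hβ
      exact ⟨α, fun _ => ⟨h1, h2, h3⟩⟩
    · exact ⟨1, fun h => absurd h hs⟩
  choose f hf using h
  refine ⟨Finset.univ.filter fun α =>
    α ∈ Lam g m ∧ Positive g m α ∧ f (Set.range (conjTau g m α)) = α, ?_, ?_⟩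
  · intro α hα
    obtain ⟨h1, h2, -⟩ := (Finset.mem_filter.1 hα).2
    exact ⟨h1, h2⟩
  · intro β hβ
    obtain ⟨h1, h2, h3⟩ := hf _ ⟨β, hβ, rfl⟩
    refine ⟨f (Set.range (conjTau g m β)), ⟨?_, h3⟩, ?_⟩
    · exact Finset.mem_filter.2 ⟨Finset.mem_univ _, h1, h2, by rw [h3]⟩
    · rintro α ⟨hα, h4⟩
      rw [← (Finset.mem_filter.1 hα).2.2.2, h4]

/-! ### The chain `μ` -/

variable {R : Finset (Perm (Fin (2 * (2 * g + m))))}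

theorem mu_mem_bichains (hR : IsRepresentativeSystem g m R) :
    mu g m R ∈ bichains (2 * g + m) m (2 * (2 * g + m)) (2 * g + m) := by
  refine Submodule.sum_mem _ fun π _ => Submodule.sum_mem _ fun α hα => Submodule.smul_mem _ _ ?_
  rw [permKappa_eq]
  refine Finsupp.single_mem_supported ℤ 1 ⟨slits_nondegenerate ?_, rfl, rfl⟩
  rw [top_reorder]
  exact mem_Lam.1 (hR.1 α hα).1

theorem bichains_le_chains (h m p q : ℕ) : bichains h m p q ≤ chains h m (p + q) :=
  Finsupp.supported_mono fun c hc => ⟨hc.1, by rw [hc.2.1, hc.2.2]⟩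

/-- A single summand contributes: the set of transpositions of the cell determines `α`, and their
order determines `π`. Since the word differs from `reorder π (kappaWord g m α)` only by flips, its
`fundSign` is `sign π` times that of `κ_α(T)`. -/
theorem mu_apply (hR : IsRepresentativeSystem g m R) {e : Word (2 * g + m) (2 * (2 * g + m))}
    (he : ncyc (top e) = m + 1) : mu g m R (cellOf e) = fundSign m (kappaWord g m 1) e := by
  classical
  obtain ⟨β, rfl⟩ := exists_kappaWord_eq e
  obtain ⟨α, ⟨hα, hrange⟩, huniq⟩ := hR.2 β (mem_Lam.2 he)
  obtain ⟨hαL, hαP⟩ := hR.1 α hα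
  have hinj : ∀ γ, Function.Injective (conjTau g m γ) := fun γ => by
    rw [conjTau_eq]
    exact arc_injective _
  have hcell : ∀ (π : Perm (Fin (2 * g + m))) γ,
      permKappa g m π γ = cellOf (kappaWord g m β) ↔ ∀ i, conjTau g m γ (π i) = conjTau g m β i := by
    intro π γ
    rw [permKappa_eq, cellOf, cellOf, mk_injective.eq_iff, slits, slits, arcs_eq_iff, conjTau_eq,
      conjTau_eq]
    rfl
  obtain ⟨π, hπ⟩ : ∃ π : Perm (Fin (2 * g + m)), ∀ i, conjTau g m α (π i) = conjTau g m β i := by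
    have h1 : ∀ i, ∃ j, conjTau g m α j = conjTau g m β i := fun i => by
      rw [← Set.mem_range, hrange]
      exact ⟨i, rfl⟩
    choose f hf using h1
    have hfi : Function.Injective f := fun i j hij =>
      hinj β (by rw [← hf i, hij, hf j])
    exact ⟨Equiv.ofBijective f (Finite.injective_iff_bijective.1 hfi), hf⟩
  have hsum : mu g m R (cellOf (kappaWord g m β)) = Perm.sign π * Perm.sign α := by
    simp only [mu, Finsupp.coe_finsetSum, Finset.sum_apply, Finsupp.smul_apply,
      Finsupp.single_apply, smul_eq_mul, hcell]
    rw [Finset.sum_eq_single π, Finset.sum_eq_single α]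
    · rw [if_pos hπ, mul_one]
    · intro γ hγ hne
      rw [if_neg, mul_zero]
      intro h1
      refine hne (huniq γ ⟨hγ, ?_⟩)
      rw [← π.surjective.range_comp]
      exact congrArg Set.range (funext h1)
    · exact fun h1 => absurd hα h1
    · intro ρ _ hne
      refine Finset.sum_eq_zero fun γ hγ => ?_
      rw [if_neg, mul_zero]
      intro h1
      obtain rfl : γ = α := by
        refine huniq γ ⟨hγ, ?_⟩
        rw [← ρ.surjective.range_comp]
        exact congrArg Set.range (funext h1)
      exact hne (Equiv.ext fun i => hinj γ ((h1 i).trans (hπ i).symm))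
    · exact fun h1 => absurd (Finset.mem_univ _) h1
  have hslits : slits (kappaWord g m β) = slits (reorder π (kappaWord g m α)) := by
    have := (hcell π α).2 hπ
    rw [permKappa_eq] at this
    exact mk_injective this.symm
  obtain ⟨c, hc⟩ := exists_flip_eq hslits
  have hb := isBase_kappaWord_one g m
  have h2 := mem_Lam.1 hαL
  rw [hsum, hc, hb.fundSign_flip rfl c (by rwa [top_reorder]), hb.fundSign_reorder rfl π h2,
    fundSign_kappaWord hαL hαP]

theorem mu_representsFundamentalClass (hR : IsRepresentativeSystem g m R) {𝒪 : SignRule}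
    (h𝒪 : Compatible 𝒪 m) : RepresentsFundamentalClass 𝒪 (2 * g + m) m (mu g m R) := by
  refine (isBase_kappaWord_one g m).representsFundamentalClass rfl h𝒪 ?_ fun e he => mu_apply hR he
  have := bichains_le_chains _ _ _ _ (mu_mem_bichains hR)
  rwa [show 2 * (2 * g + m) + (2 * g + m) = 3 * (2 * g + m) by omega] at this

end

end

end ParallelSlit

theorem mainTheorem3 (g m : ℕ) :
    (∃ R, ParallelSlit.IsRepresentativeSystem g m R) ∧
    ∀ R, ParallelSlit.IsRepresentativeSystem g m R →
      ParallelSlit.mu g m R ∈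
          ParallelSlit.bichains (2 * g + m) m (2 * (2 * g + m)) (2 * g + m) ∧
      ParallelSlit.RepresentsFundamentalClass ParallelSlit.orientation (2 * g + m) m
          (ParallelSlit.mu g m R) ∧
      (m ≤ 1 → ParallelSlit.RepresentsFundamentalClass ParallelSlit.integral (2 * g + m) m
          (ParallelSlit.mu g m R)) :=
  ⟨ParallelSlit.exists_isRepresentativeSystem g m, fun _ hR =>
    ⟨ParallelSlit.mu_mem_bichains hR,
      ParallelSlit.mu_representsFundamentalClass hR (ParallelSlit.compatible_orientation m),
      fun hm => ParallelSlit.mu_representsFundamentalClass hR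
        (ParallelSlit.compatible_integral hm)⟩⟩
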